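/- Let $M$ be a connected smooth $4$-manifold (Hausdorff, second countable), $TM$ its tangent bundle with induced coordinates $(x^i,\dot x^i)$; write $_{,i}=\partial/\partial x^i$ and $_{\cdot i}=\partial/\partial\dot x^i$. A conic subbundle of $TM$ is a non-empty open set of non-zero tangent vectors, projecting onto $M$ and invariant under $(x,\dot x)\mapsto(x,\lambda\dot x)$, $\lambda>0$. Let $(M,L)$ be a Finsler spacetime: $L$ is a smooth function on a conic subbundle $\mathcal A$ (the admissible vectors) with $L(x,\lambda\dot x)=\lambda^2L(x,\dot x)$ for $\lambda>0$ and with $g_{ij}=\tfrac12L_{\cdot i\cdot j}$ nondegenerate on $\mathcal A$, and there is a conic subbundle $\mathcal T\subset\mathcal A$ with connected fibres on which $L>0$, $g_{ij}$ has signature $(+,-,-,-)$, and $L$ extends continuously by $0$ to $\partial\mathcal T$. Let $\mathcal A_0=\{v\in\mathcal A: L(v)\neq0\}$, $F=\sqrt{|L|}$, let $\omega=F_{\cdot i}\,dx^i$ be the Hilbert form on $\mathcal A_0$, let $\pi^+:TM\setminus\{0\}\to PTM^+=(TM\setminus\{0\})/\mathbb R_{>0}$ be the projection onto the ($7$-dimensional)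 manifold of oriented tangent directions, and $\mathcal A_0^+=\pi^+(\mathcal A_0)$. Put $2G^i=\tfrac12g^{ih}(L_{\cdot h,j}\dot x^j-L_{,h})$, $G^i{}_j=G^i{}_{\cdot j}$, $\delta_i=\frac{\partial}{\partial x^i}-G^j{}_i\frac{\partial}{\partial\dot x^j}$ and $l^i=\dot x^i/F$. Then: 1. There is a unique smooth $1$-form $\omega^+$ on $\mathcal A_0^+$ with $(\pi^+)^*\omega^+=\omega$, and it is a contact form: $\omega^+\wedge d\omega^+\wedge d\omega^+\wedge d\omega^+$ vanishes nowhere on $\mathcal A_0^+$. 2. There is a unique smooth vector field $\ell^+$ on $\mathcal A_0^+$ (the Reeb field) with $\mathbf i_{\ell^+}\omega^+=1$ and $\mathbf i_{\ell^+}d\omega^+=0$. The local expressions $l^i\delta_i$ in all induced charts define one vector field $\ell$ on $\mathcal A_0$, and $\ell^+=(\pi^+)_*\ell$; that is, $\ell^+=l^i\delta_i$ in local homogeneous coordinates. 3. Let $2\le k\le\infty$, $a<b$, and let $c:[a,b]\to M$ be a $C^k$ curve with $(c(s),\dot c(s))\in\mathcal A_0$ (non-lightlike, admissible) and $F(c(s),\dot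 c(s))=1$ (parametrized by arc length) for all $s$. Then the canonical lift $C:[a,b]\to\mathcal A_0^+$, $C(s)=[(c(s),\dot c(s))]$, is an integral curve of $\ell^+$ if and only if $c$ is a geodesic of $(M,L)$, i.e. a critical point of the length functional $\int_a^bF(\gamma,\dot\gamma)\,ds$ with respect to all $C^k$ variations $\Gamma:(-r,r)\times[a,b]\to M$ of $c$ with fixed endpoints. -/

import Mathlib

open Set Filter Topology
open scoped Manifold ContDiff

namespace Finsler

noncomputable section

/-- The model space of a four-dimensional manifold. -/
abbrev E4 : Type := EuclideanSpace ℝ (Fin 4)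
/-- The model space of the fibre coordinates on the positively projectivized tangent bundle. -/
abbrev E3 : Type := EuclideanSpace ℝ (Fin 3)

/-- The tangent bundle `TM`. -/
abbrev TanB (M : Type*) [TopologicalSpace M] [ChartedSpace E4 M] : Type _ := TangentBundle (𝓡 4) M

section PTM
variable {M : Type*} [TopologicalSpace M] [ChartedSpace E4 M] [IsManifold (𝓡 4) ∞ M]

/-- The chart of `TM` induced by the preferred chart of `M` at `x₀`. -/
def tanChart (x₀ : M) : OpenPartialHomeomorph (TanB M) (E4 × E4) :=
  chartAt (ModelProd E4 E4) (⟨x₀, 0⟩ : TanB M)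

theorem tanChart_source (x₀ : M) (q : TanB M) :
    q ∈ (tanChart x₀).source ↔ q.1 ∈ (chartAt E4 x₀).source :=
  TangentBundle.mem_chart_source_iff _ _

theorem tanChart_target (x₀ : M) (p : E4 × E4) :
    p ∈ (tanChart x₀).target ↔ p.1 ∈ (chartAt E4 x₀).target :=
  TangentBundle.mem_chart_target_iff p (⟨x₀, 0⟩ : TanB M)

theorem tanChart_fst (x₀ : M) (q : TanB M) : (tanChart x₀ q).1 = chartAt E4 x₀ q.1 := rfl

theorem tanChart_snd (x₀ : M) (q : TanB M) :
    (tanChart x₀ q).2 = tangentCoordChange (𝓡 4) q.1 x₀ q.1 q.2 := rfl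

theorem tanChart_smul (x₀ x : M) (c : ℝ) (v : TangentSpace (𝓡 4) x) :
    (tanChart x₀ (⟨x, c • v⟩ : TanB M)).2 = c • (tanChart x₀ (⟨x, v⟩ : TanB M)).2 := by
  rw [tanChart_snd, tanChart_snd]
  exact map_smul (tangentCoordChange (𝓡 4) x x₀ x) c v

theorem tanChart_zero (x₀ x : M) :
    (tanChart x₀ (⟨x, (0 : TangentSpace (𝓡 4) x)⟩ : TanB M)).2 = 0 := by
  rw [tanChart_snd]
  exact map_zero (tangentCoordChange (𝓡 4) x x₀ x)

theorem tanChart_ne_zero (x₀ : M) {q : TanB M} (hq : q.1 ∈ (chartAt E4 x₀).source) :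
    (tanChart x₀ q).2 ≠ 0 ↔ q.2 ≠ 0 := by
  obtain ⟨x, v⟩ := q
  constructor
  · intro h h0
    have h0' : v = (0 : TangentSpace (𝓡 4) x) := h0
    subst h0'
    exact h (tanChart_zero x₀ x)
  · intro h h0
    apply h
    have h1 : tanChart x₀ (⟨x, v⟩ : TanB M) =
        tanChart x₀ (⟨x, (0 : TangentSpace (𝓡 4) x)⟩ : TanB M) :=
      Prod.ext rfl (h0.trans (tanChart_zero x₀ x).symm)
    have h2 := (tanChart x₀).injOn ((tanChart_source x₀ ⟨x, v⟩).2 hq)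
      ((tanChart_source x₀ ⟨x, (0 : TangentSpace (𝓡 4) x)⟩).2 hq) h1
    rw [Bundle.TotalSpace.mk.injEq] at h2
    exact eq_of_heq h2.2

variable (M) in
/-- The slit tangent bundle: nonzero tangent vectors, an open submanifold of `TM`. -/
def slit : TopologicalSpace.Opens (TanB M) where
  carrier := {q | q.2 ≠ 0}
  is_open' := by
    rw [isOpen_iff_mem_nhds]
    intro q hq
    have hs : q ∈ (tanChart q.1).source := (tanChart_source _ _).2 (mem_chart_source _ _)
    have hne : (tanChart q.1 q).2 ≠ 0 := (tanChart_ne_zero _ (mem_chart_source _ _)).2 hq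
    have h1 : ∀ᶠ p in 𝓝 q, (tanChart q.1 p).2 ≠ 0 :=
      (continuous_snd.continuousAt.comp ((tanChart q.1).continuousAt hs)).eventually_ne hne
    filter_upwards [h1, (tanChart q.1).open_source.mem_nhds hs] with p hp hps
    exact (tanChart_ne_zero _ ((tanChart_source _ _).1 hps)).1 hp

/-- The fibre homothety `(x, v) ↦ (x, c v)`. -/
def tanScale (c : ℝ) (q : TanB M) : TanB M := ⟨q.1, c • q.2⟩

theorem continuous_tanScale (c : ℝ) : Continuous (tanScale (M := M) c) := by
  rw [continuous_iff_continuousAt]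
  intro q
  have hs : q ∈ (tanChart q.1).source := (tanChart_source _ _).2 (mem_chart_source _ _)
  have hs' : tanScale c q ∈ (tanChart q.1).source :=
    (tanChart_source _ _).2 (mem_chart_source _ _)
  have hp : ContinuousAt (fun p : TanB M => (⟨p.1, c • p.2⟩ : TanB M).1) q :=
    (FiberBundle.continuous_proj E4 (TangentSpace (𝓡 4) : M → Type _)).continuousAt
  rw [(tanChart q.1).continuousAt_iff_continuousAt_comp_left]
  · have h2 : ((tanChart q.1) ∘ tanScale c) =
        fun p => ((tanChart q.1 p).1, c • (tanChart q.1 p).2) := by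
      funext p
      exact Prod.ext rfl (tanChart_smul _ _ _ _)
    rw [h2]
    have := (tanChart q.1).continuousAt hs
    exact this.fst.prodMk (this.snd.const_smul c)
  · have : tanScale c ⁻¹' (tanChart q.1).source = (tanChart q.1).source := by
      ext p
      rw [mem_preimage, tanChart_source, tanChart_source]; rfl
    rw [this]
    exact (tanChart q.1).open_source.mem_nhds hs

variable (M) in
/-- `(x, v) ∼ (x, c v)` for `c > 0`. -/
def raySetoid : Setoid (slit M) where
  r p q := ∃ c : ℝ, 0 < c ∧ (q : TanB M) = ⟨p.1.1, c • p.1.2⟩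
  iseqv := by
    refine ⟨fun p => ⟨1, one_pos, ?_⟩, ?_, ?_⟩
    · simp
    · rintro ⟨⟨x, v⟩, hp⟩ ⟨q, hq⟩ ⟨c, hc, rfl⟩
      refine ⟨c⁻¹, inv_pos.2 hc, ?_⟩
      simp [smul_smul, inv_mul_cancel₀ hc.ne']
    · rintro ⟨⟨x, v⟩, hp⟩ ⟨q, hq⟩ ⟨r, hr⟩ ⟨c, hc, rfl⟩ ⟨d, hd, rfl⟩
      exact ⟨d * c, mul_pos hd hc, by simp [smul_smul]⟩

variable (M) in
/-- The positively projectivized tangent bundle `PTM⁺`, with the quotient topology. -/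
def PTM : Type _ := Quotient (raySetoid M)

instance : TopologicalSpace (PTM M) := inferInstanceAs (TopologicalSpace (Quotient (raySetoid M)))

/-- The canonical projection `π⁺`. -/
def toPTM (q : slit M) : PTM M := Quotient.mk (raySetoid M) q

theorem toPTM_eq {p q : slit M} :
    toPTM p = toPTM q ↔ ∃ c : ℝ, 0 < c ∧ (q : TanB M) = ⟨p.1.1, c • p.1.2⟩ :=
  Quotient.eq

theorem isOpenQuotientMap_toPTM : IsOpenQuotientMap (toPTM (M := M)) := by
  refine ⟨Quotient.mk_surjective, continuous_quotient_mk', fun U hU => ?_⟩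
  refine isOpen_coinduced.2 ?_
  have : Quotient.mk (raySetoid M) ⁻¹' (toPTM '' U) =
      ⋃ c : {c : ℝ // 0 < c}, {q : slit M | tanScale (c : ℝ) (q : TanB M) ∈ Subtype.val '' U} := by
    ext q
    simp only [mem_preimage, mem_image, mem_iUnion, mem_ofPred_eq]
    constructor
    · rintro ⟨p, hp, h⟩
      obtain ⟨c, hc, h'⟩ := toPTM_eq.1 (show toPTM q = toPTM p from h.symm)
      exact ⟨⟨c, hc⟩, p, hp, h'⟩
    · rintro ⟨⟨c, hc⟩, p, hp, h'⟩
      exact ⟨p, hp, (toPTM_eq.2 ⟨c, hc, h'⟩).symm⟩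
  change IsOpen (Quotient.mk (raySetoid M) ⁻¹' (toPTM '' U))
  rw [this]
  refine isOpen_iUnion fun c => ?_
  have hU' : IsOpen (Subtype.val '' U : Set (TanB M)) := (slit M).isOpen.isOpenMap_subtype_val U hU
  exact hU'.preimage ((continuous_tanScale (c : ℝ)).comp continuous_subtype_val)

/-- Affine coordinates `w ↦ (w^a / w^i)_{a ≠ i}`. -/
def affCoord (i : Fin 4) (w : E4) : E3 := WithLp.toLp 2 fun a => w (i.succAbove a) / w i

/-- The vector `w` with `w^i = s` and `w^a = s u^a` for `a ≠ i`; for `s = ±1` it is a representative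
of the ray with affine coordinates `u` in the half space `s w^i > 0`. -/
def affLift (i : Fin 4) (s : ℝ) (u : E3) : E4 :=
  WithLp.toLp 2 (i.insertNth s fun a => s * u a : Fin 4 → ℝ)

theorem affLift_same (i : Fin 4) (s : ℝ) (u : E3) : affLift i s u i = s := by simp [affLift]

theorem affCoord_affLift (i : Fin 4) {s : ℝ} (hs : s ≠ 0) (u : E3) :
    affCoord i (affLift i s u) = u := by
  ext a
  simp [affCoord, affLift, hs]

theorem affLift_affCoord (i : Fin 4) {s : ℝ} {w : E4} (hs : 0 < s * w i) :
    affLift i s (affCoord i w) = (s * (w i)⁻¹) • w := by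
  have hw : w i ≠ 0 := right_ne_zero_of_mul hs.ne'
  ext j
  refine i.succAboveCases ?_ (fun a => ?_) j
  · simp [affLift, hw]
  · simp [affLift, affCoord]; ring

theorem affCoord_smul (i : Fin 4) {c : ℝ} (hc : c ≠ 0) (w : E4) :
    affCoord i (c • w) = affCoord i w := by
  ext a
  simp [affCoord, mul_div_mul_left _ _ hc]

theorem contDiff_affLift (i : Fin 4) (s : ℝ) : ContDiff ℝ ∞ (affLift i s) := by
  rw [contDiff_euclidean]
  intro j
  refine i.succAboveCases ?_ (fun a => ?_) j
  · simpa [affLift] using contDiff_const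
  · simp only [affLift, PiLp.toLp_apply, Fin.insertNth_apply_succAbove]
    fun_prop

theorem contDiffOn_affCoord (i : Fin 4) : ContDiffOn ℝ ∞ (affCoord i) {w | w i ≠ 0} := by
  rw [contDiffOn_euclidean]
  intro a
  have : ∀ j : Fin 4, ContDiffOn ℝ ∞ (fun w : E4 => w j) {w | w i ≠ 0} := fun j => by fun_prop
  exact (this _).div (this _) fun w hw => hw


theorem affLift_ne_zero (i : Fin 4) {s : ℝ} (hs : s ≠ 0) (u : E3) : affLift i s u ≠ 0 := by
  intro h
  have := affLift_same i s u
  rw [h] at this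
  exact hs (by simpa using this.symm)

theorem tanChart_symm_ne_zero (x₀ : M) {z : E4 × E4} (hz : z.1 ∈ (chartAt E4 x₀).target)
    (h0 : z.2 ≠ 0) : ((tanChart x₀).symm z).2 ≠ 0 := by
  have ht := (tanChart_target x₀ z).2 hz
  have hs := (tanChart x₀).map_target ht
  rw [← tanChart_ne_zero x₀ ((tanChart_source x₀ _).1 hs), (tanChart x₀).right_inv ht]
  exact h0

theorem tanChart_symm_smul (x₀ : M) {q : TanB M} (hq : q.1 ∈ (chartAt E4 x₀).source) (c : ℝ) :
    (tanChart x₀).symm ((tanChart x₀ q).1, c • (tanChart x₀ q).2) = ⟨q.1, c • q.2⟩ := by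
  have h1 : ((tanChart x₀ q).1, c • (tanChart x₀ q).2) = tanChart x₀ ⟨q.1, c • q.2⟩ :=
    Prod.ext rfl (tanChart_smul x₀ q.1 c q.2).symm
  rw [h1]
  exact (tanChart x₀).left_inv ((tanChart_source x₀ _).2 hq)

/-- The coordinates `[(x, v)] ↦ (x, v^a / v^i)` on `PTM⁺`. -/
def ptmCoord (x₀ : M) (i : Fin 4) : PTM M → E4 × E3 :=
  Quotient.lift (s := raySetoid M)
    (fun q => ((tanChart x₀ q).1, affCoord i (tanChart x₀ q).2)) (by
      rintro p q ⟨c, hc, h⟩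
      rw [h, tanChart_smul, affCoord_smul i hc.ne']
      rfl)

open scoped Classical in
/-- The inverse of `ptmCoord` on the half space `s v^i > 0`; the second branch is never used on the
target of the chart. -/
def ptmCoordSymm (x₀ : M) (i : Fin 4) (s : ℝ) (z : E4 × E3) : PTM M :=
  if h : ((tanChart x₀).symm (z.1, affLift i s z.2)).2 ≠ 0
    then toPTM ⟨(tanChart x₀).symm (z.1, affLift i s z.2), h⟩
    else toPTM ⟨⟨x₀, (EuclideanSpace.single 0 1 : E4)⟩, by
      change (EuclideanSpace.single 0 1 : E4) ≠ 0
      simp⟩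

/-- Vectors over the domain of the chart at `x₀` with `s v^i > 0`. -/
def ptmDomain (x₀ : M) (i : Fin 4) (s : ℝ) : Set (slit M) :=
  {q | (q : TanB M).1 ∈ (chartAt E4 x₀).source ∧ 0 < s * (tanChart x₀ q).2 i}

theorem ptmCoord_toPTM (x₀ : M) (i : Fin 4) (q : slit M) :
    ptmCoord x₀ i (toPTM q) = ((tanChart x₀ q).1, affCoord i (tanChart x₀ q).2) := rfl

theorem ptmCoordSymm_eq (x₀ : M) (i : Fin 4) (s : ℝ) {z : E4 × E3}
    (h : ((tanChart x₀).symm (z.1, affLift i s z.2)).2 ≠ 0) :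
    ptmCoordSymm x₀ i s z = toPTM ⟨(tanChart x₀).symm (z.1, affLift i s z.2), h⟩ := dif_pos h

theorem ptmDomain_saturated (x₀ : M) (i : Fin 4) (s : ℝ) {q : slit M}
    (h : toPTM q ∈ toPTM '' ptmDomain x₀ i s) : q ∈ ptmDomain x₀ i s := by
  obtain ⟨p, hp, h⟩ := h
  obtain ⟨c, hc, h⟩ := toPTM_eq.1 h
  refine ⟨by rw [h]; exact hp.1, ?_⟩
  rw [h, tanChart_smul]
  have : 0 < c * (s * (tanChart x₀ p).2 i) := mul_pos hc hp.2
  simpa [mul_left_comm] using this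

theorem isOpen_ptmDomain (x₀ : M) (i : Fin 4) (s : ℝ) : IsOpen (ptmDomain x₀ i s) := by
  have h1 : ContinuousOn (fun q : TanB M => s * (tanChart x₀ q).2 i) (tanChart x₀).source := by
    have := (tanChart x₀).continuousOn.snd
    have h2 : Continuous fun w : E4 => s * w i := by fun_prop
    exact h2.comp_continuousOn this
  have h2 := h1.isOpen_inter_preimage (tanChart x₀).open_source (isOpen_Ioi (a := 0))
  have : ptmDomain x₀ i s = Subtype.val ⁻¹' ((tanChart x₀).source ∩
      (fun q : TanB M => s * (tanChart x₀ q).2 i) ⁻¹' Ioi 0) := by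
    ext q
    exact and_congr (tanChart_source x₀ _).symm Iff.rfl
  rw [this]
  exact h2.preimage continuous_subtype_val

/-- The standard chart of `PTM⁺` over the chart of `M` at `x₀`, on the half space `s v^i > 0`
(`s = ±1`). -/
def ptmChart (x₀ : M) (i : Fin 4) (s : ℝ) (hs : s * s = 1) :
    OpenPartialHomeomorph (PTM M) (E4 × E3) where
  toFun := ptmCoord x₀ i
  invFun := ptmCoordSymm x₀ i s
  source := toPTM '' ptmDomain x₀ i s
  target := {z | z.1 ∈ (chartAt E4 x₀).target}
  map_source' := by
    rintro _ ⟨q, ⟨hq, -⟩, rfl⟩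
    exact (chartAt E4 x₀).map_source hq
  map_target' := by
    intro z hz
    have hs0 : s ≠ 0 := by rintro rfl; simp at hs
    have h := tanChart_symm_ne_zero x₀ (z := (z.1, affLift i s z.2)) hz (affLift_ne_zero i hs0 _)
    have ht := (tanChart_target x₀ (z.1, affLift i s z.2)).2 hz
    rw [ptmCoordSymm_eq x₀ i s h]
    refine ⟨_, ⟨(tanChart_source x₀ _).1 ((tanChart x₀).map_target ht), ?_⟩, rfl⟩
    rw [(tanChart x₀).right_inv ht, affLift_same, hs]
    exact one_pos
  left_inv' := by
    rintro _ ⟨q, ⟨hq, hq'⟩, rfl⟩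
    have hw : (tanChart x₀ q).2 i ≠ 0 := right_ne_zero_of_mul hq'.ne'
    have h1 : (tanChart x₀).symm ((ptmCoord x₀ i (toPTM q)).1,
        affLift i s (ptmCoord x₀ i (toPTM q)).2) =
        ⟨(q : TanB M).1, (s * ((tanChart x₀ q).2 i)⁻¹) • (q : TanB M).2⟩ := by
      rw [ptmCoord_toPTM, affLift_affCoord i hq', tanChart_symm_smul x₀ hq]
    have hc : 0 < s * ((tanChart x₀ q).2 i)⁻¹ := by
      have : s * ((tanChart x₀ q).2 i)⁻¹ = s * (tanChart x₀ q).2 i * (((tanChart x₀ q).2 i)⁻¹) ^ 2 := by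
        field_simp
      rw [this]
      positivity
    have hne : ((tanChart x₀).symm ((ptmCoord x₀ i (toPTM q)).1,
        affLift i s (ptmCoord x₀ i (toPTM q)).2)).2 ≠ 0 := by
      rw [h1]
      exact smul_ne_zero hc.ne' q.2
    rw [ptmCoordSymm_eq x₀ i s hne]
    exact (toPTM_eq.2 ⟨_, hc, h1⟩).symm
  right_inv' := by
    intro z hz
    have hs0 : s ≠ 0 := by rintro rfl; simp at hs
    have h := tanChart_symm_ne_zero x₀ (z := (z.1, affLift i s z.2)) hz (affLift_ne_zero i hs0 _)
    have ht := (tanChart_target x₀ (z.1, affLift i s z.2)).2 hz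
    rw [ptmCoordSymm_eq x₀ i s h, ptmCoord_toPTM, (tanChart x₀).right_inv ht,
      affCoord_affLift i hs0]
  open_source := isOpenQuotientMap_toPTM.isOpenMap _ (isOpen_ptmDomain x₀ i s)
  open_target := (chartAt E4 x₀).open_target.preimage continuous_fst
  continuousOn_toFun := by
    rintro _ ⟨q, hq, rfl⟩
    refine ContinuousAt.continuousWithinAt ?_
    rw [← isOpenQuotientMap_toPTM.continuousAt_comp_iff]
    have h1 : ContinuousAt (fun q : slit M => tanChart x₀ (q : TanB M)) q :=
      ((tanChart x₀).continuousAt ((tanChart_source x₀ _).2 hq.1)).comp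
        continuous_subtype_val.continuousAt
    have hw : (tanChart x₀ q).2 i ≠ 0 := right_ne_zero_of_mul hq.2.ne'
    have h2 : ContinuousAt (affCoord i) (tanChart x₀ q).2 := by
      refine (contDiffOn_affCoord i).continuousOn.continuousAt (IsOpen.mem_nhds ?_ hw)
      exact isOpen_ne_fun (by fun_prop) continuous_const
    exact h1.fst.prodMk (ContinuousAt.comp (f := fun q : slit M => (tanChart x₀ (q : TanB M)).2)
      h2 h1.snd)
  continuousOn_invFun := by
    intro z hz
    have hs0 : s ≠ 0 := by rintro rfl; simp at hs
    have hne : ∀ z : {z : E4 × E3 // z.1 ∈ (chartAt E4 x₀).target},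
        ((tanChart x₀).symm (z.1.1, affLift i s z.1.2)).2 ≠ 0 := fun z =>
      tanChart_symm_ne_zero x₀ (z := (z.1.1, affLift i s z.1.2)) z.2 (affLift_ne_zero i hs0 _)
    refine (continuousOn_iff_continuous_domRestrict.2 ?_) z hz
    have h1 : Continuous fun z : {z : E4 × E3 // z.1 ∈ (chartAt E4 x₀).target} =>
        (tanChart x₀).symm (z.1.1, affLift i s z.1.2) := by
      refine (tanChart x₀).symm.continuousOn.comp_continuous ?_
        fun z => (tanChart_target x₀ (z.1.1, affLift i s z.1.2)).2 z.2
      have := (contDiff_affLift i s).continuous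
      fun_prop
    have h2 := isOpenQuotientMap_toPTM.continuous.comp (h1.subtype_mk hne)
    convert! h2 using 1
    funext z
    exact ptmCoordSymm_eq x₀ i s (hne z)

theorem exists_mem_ptmDomain (q : slit M) :
    ∃ (i : Fin 4) (s : ℝ), s * s = 1 ∧ q ∈ ptmDomain (q : TanB M).1 i s := by
  have hne : (tanChart (q : TanB M).1 q).2 ≠ 0 := (tanChart_ne_zero _ (mem_chart_source _ _)).2 q.2
  obtain ⟨i, hi⟩ : ∃ i, (tanChart (q : TanB M).1 q).2 i ≠ 0 := by
    by_contra! h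
    exact hne (by ext j; simpa using h j)
  rcases lt_or_gt_of_ne hi with h | h
  · exact ⟨i, -1, by norm_num, mem_chart_source _ _, by linarith⟩
  · exact ⟨i, 1, by norm_num, mem_chart_source _ _, by linarith⟩

theorem exists_mem_ptmChart_source (p : PTM M) :
    ∃ c : OpenPartialHomeomorph (PTM M) (E4 × E3),
      (∃ x₀ i s hs, c = ptmChart x₀ i s hs) ∧ p ∈ c.source := by
  obtain ⟨q, rfl⟩ := isOpenQuotientMap_toPTM.surjective p
  obtain ⟨i, s, hs, h⟩ := exists_mem_ptmDomain q
  exact ⟨_, ⟨_, i, s, hs, rfl⟩, q, h, rfl⟩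

instance : ChartedSpace (E4 × E3) (PTM M) where
  atlas := {c | ∃ x₀ i s hs, c = ptmChart x₀ i s hs}
  chartAt p := (exists_mem_ptmChart_source p).choose
  mem_chart_source p := (exists_mem_ptmChart_source p).choose_spec.2
  chart_mem_atlas p := (exists_mem_ptmChart_source p).choose_spec.1

instance : IsManifold 𝓘(ℝ, E4 × E3) ∞ (PTM M) := by
  refine isManifold_of_contDiffOn _ _ _ ?_
  rintro _ _ ⟨x₀, i, s, hs, rfl⟩ ⟨x₁, j, t, ht, rfl⟩
  have hs0 : s ≠ 0 := by rintro rfl; simp at hs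
  have hΦ : ContDiffOn ℝ ∞ (tanChart x₁ ∘ (tanChart x₀).symm)
      ((tanChart x₀).symm ≫ₕ tanChart x₁).source := by
    have h := (StructureGroupoid.compatible_of_mem_maximalAtlas
      (IsManifold.chart_mem_maximalAtlas (I := (𝓡 4).tangent) (n := ∞) (⟨x₀, 0⟩ : TanB M))
      (IsManifold.chart_mem_maximalAtlas (I := (𝓡 4).tangent) (n := ∞) (⟨x₁, 0⟩ : TanB M))).1
    refine h.mono ?_
    intro z hz
    exact ⟨hz, by simp⟩
  have hset : (𝓘(ℝ, E4 × E3).symm ⁻¹' ((ptmChart x₀ i s hs).symm ≫ₕ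
      ptmChart x₁ j t ht).source ∩ range 𝓘(ℝ, E4 × E3)) ⊆
      {z | (z.1, affLift i s z.2) ∈ ((tanChart x₀).symm ≫ₕ tanChart x₁).source ∧
        (tanChart x₁ ((tanChart x₀).symm (z.1, affLift i s z.2))).2 j ≠ 0} := by
    rintro z ⟨⟨hz, hz'⟩, -⟩
    change z.1 ∈ (chartAt E4 x₀).target at hz
    change ptmCoordSymm x₀ i s z ∈ toPTM '' ptmDomain x₁ j t at hz'
    have hne := tanChart_symm_ne_zero x₀ (z := (z.1, affLift i s z.2)) hz (affLift_ne_zero i hs0 _)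
    rw [ptmCoordSymm_eq x₀ i s hne] at hz'
    have h := ptmDomain_saturated x₁ j t hz'
    exact ⟨⟨(tanChart_target x₀ _).2 hz, (tanChart_source x₁ _).2 h.1⟩,
      right_ne_zero_of_mul h.2.ne'⟩
  have hlift : ContDiff ℝ ∞ fun z : E4 × E3 => (z.1, affLift i s z.2) :=
    contDiff_fst.prodMk ((contDiff_affLift i s).comp contDiff_snd)
  have h1 : ContDiffOn ℝ ∞
      (fun z : E4 × E3 => tanChart x₁ ((tanChart x₀).symm (z.1, affLift i s z.2)))
      {z | (z.1, affLift i s z.2) ∈ ((tanChart x₀).symm ≫ₕ tanChart x₁).source ∧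
        (tanChart x₁ ((tanChart x₀).symm (z.1, affLift i s z.2))).2 j ≠ 0} :=
    hΦ.comp hlift.contDiffOn fun z hz => hz.1
  have h2 := h1.fst.prodMk ((contDiffOn_affCoord j).comp h1.snd fun z hz => hz.2)
  refine (h2.mono hset).congr fun z hz => ?_
  obtain ⟨⟨hz, -⟩, -⟩ := hz
  change z.1 ∈ (chartAt E4 x₀).target at hz
  change ptmCoord x₁ j (ptmCoordSymm x₀ i s z) = _
  have hne := tanChart_symm_ne_zero x₀ (z := (z.1, affLift i s z.2)) hz (affLift_ne_zero i hs0 _)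
  rw [ptmCoordSymm_eq x₀ i s hne]
  rfl

end PTM

section Forms

variable {M : Type*} [TopologicalSpace M] [ChartedSpace E4 M] [IsManifold (𝓡 4) ∞ M]

variable (M) in
/-- A (not necessarily smooth) field of covectors on `PTM⁺`. -/
abbrev OneForm : Type _ := (p : PTM M) → TangentSpace 𝓘(ℝ, E4 × E3) p →L[ℝ] ℝ

/-- The pullback of `θ` under the inverse of the preferred chart at `p`. -/
def OneForm.localRep (θ : OneForm M) (p : PTM M) (y : E4 × E3) : E4 × E3 →L[ℝ] ℝ :=
  (θ ((extChartAt 𝓘(ℝ, E4 × E3) p).symm y)).comp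
    (mfderiv 𝓘(ℝ, E4 × E3) 𝓘(ℝ, E4 × E3) (extChartAt 𝓘(ℝ, E4 × E3) p).symm y)

/-- `θ` is a smooth differential form on the open set `U`. -/
def OneForm.SmoothOn (θ : OneForm M) (U : Set (PTM M)) : Prop :=
  ∀ p ∈ U, ContDiffAt ℝ ∞ (θ.localRep p) (extChartAt 𝓘(ℝ, E4 × E3) p p)

/-- The exterior derivative `dθ`, computed in the preferred chart at `p` and pulled back to `p`. -/
def OneForm.d (θ : OneForm M) (p : PTM M) : TangentSpace 𝓘(ℝ, E4 × E3) p [⋀^Fin 2]→L[ℝ] ℝ :=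
  (extDeriv (fun y => ContinuousAlternatingMap.ofSubsingleton ℝ (E4 × E3) ℝ (0 : Fin 1)
      (θ.localRep p y)) (extChartAt 𝓘(ℝ, E4 × E3) p p)).compContinuousLinearMap
    (mfderiv 𝓘(ℝ, E4 × E3) 𝓘(ℝ, E4 × E3) (extChartAt 𝓘(ℝ, E4 × E3) p) p)

/-- The value of the 7-form `α ∧ β ∧ β ∧ β` on seven vectors. -/
def wedgeTop {V : Type*} [AddCommGroup V] [Module ℝ V] [TopologicalSpace V]
    (α : V →L[ℝ] ℝ) (β : V [⋀^Fin 2]→L[ℝ] ℝ) (v : Fin 7 → V) : ℝ :=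
  (1 / 8) * ∑ σ : Equiv.Perm (Fin 7), ((Equiv.Perm.sign σ : ℤ) : ℝ) *
    (α (v (σ 0)) * β ![v (σ 1), v (σ 2)] * β ![v (σ 3), v (σ 4)] * β ![v (σ 5), v (σ 6)])

/-- `θ` is a contact form on the open set `U` of the 7-dimensional manifold `PTM⁺`: it is smooth and
`θ ∧ dθ ∧ dθ ∧ dθ` vanishes nowhere on `U`. -/
def OneForm.IsContactOn (θ : OneForm M) (U : Set (PTM M)) : Prop :=
  θ.SmoothOn U ∧ ∀ p ∈ U, ∃ v : Fin 7 → TangentSpace 𝓘(ℝ, E4 × E3) p, wedgeTop (θ p) (θ.d p) v ≠ 0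

/-- `R` is a Reeb vector field of `θ` on the open set `U`: it is smooth, `θ(R) = 1` and
`i_R dθ = 0`. -/
def OneForm.IsReebOn (θ : OneForm M) (R : (p : PTM M) → TangentSpace 𝓘(ℝ, E4 × E3) p)
    (U : Set (PTM M)) : Prop :=
  ContMDiffOn 𝓘(ℝ, E4 × E3) 𝓘(ℝ, E4 × E3).tangent ∞
    (fun p => (⟨p, R p⟩ : TangentBundle 𝓘(ℝ, E4 × E3) (PTM M))) U ∧
  ∀ p ∈ U, θ p (R p) = 1 ∧ ∀ X : TangentSpace 𝓘(ℝ, E4 × E3) p, θ.d p ![R p, X] = 0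

end Forms

section Spacetime

variable {M : Type*} [TopologicalSpace M] [ChartedSpace E4 M] [IsManifold (𝓡 4) ∞ M]

/-- The coordinates `(x^i, ẋ^i)` on `TM` induced by a chart `e` of `M`. -/
def natCoord (e : OpenPartialHomeomorph M E4) (q : TanB M) : E4 × E4 :=
  (e q.1, mfderiv (𝓡 4) 𝓘(ℝ, E4) e q.1 q.2)

/-- The tangent vector with given induced coordinates. -/
def natPoint (e : OpenPartialHomeomorph M E4) (z : E4 × E4) : TanB M :=
  ⟨e.symm z.1, mfderiv 𝓘(ℝ, E4) (𝓡 4) e.symm z.1 z.2⟩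

/-- `∂f/∂x^i` for a function `f` of the coordinates `(x, ẋ)`. -/
def dBase (i : Fin 4) (f : E4 × E4 → ℝ) (z : E4 × E4) : ℝ :=
  fderiv ℝ f z (EuclideanSpace.single i 1, 0)

/-- `∂f/∂ẋ^i` for a function `f` of the coordinates `(x, ẋ)`. -/
def dFib (i : Fin 4) (f : E4 × E4 → ℝ) (z : E4 × E4) : ℝ :=
  fderiv ℝ f z (0, EuclideanSpace.single i 1)

/-- The matrix `g_ij = ½ ∂²L/∂ẋ^i∂ẋ^j` in the coordinates induced by `e`. -/
def fundMatrix (L : TanB M → ℝ) (e : OpenPartialHomeomorph M E4) (z : E4 × E4) :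
    Matrix (Fin 4) (Fin 4) ℝ :=
  Matrix.of fun i j => (1 / 2) * dFib i (dFib j (L ∘ natPoint e)) z

/-- A conic subbundle of `TM`. -/
structure IsConicSubbundle (Q : Set (TanB M)) : Prop where
  nonempty : Q.Nonempty
  isOpen : IsOpen Q
  ne_zero : ∀ q ∈ Q, q.2 ≠ 0
  exists_over : ∀ x : M, ∃ q ∈ Q, q.1 = x
  conic : ∀ q ∈ Q, ∀ c : ℝ, 0 < c → (⟨q.1, c • q.2⟩ : TanB M) ∈ Q

variable (M) in
/-- A Finsler spacetime structure on a four-dimensional manifold `M`. Only the values of `L` on the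
set `A` of admissible vectors matter. -/
structure FinslerSpacetime where
  /-- The Finsler Lagrangian. -/
  L : TanB M → ℝ
  /-- The admissible vectors. -/
  A : Set (TanB M)
  /-- The future pointing timelike vectors. -/
  T : Set (TanB M)
  conic_A : IsConicSubbundle A
  smooth : ContMDiffOn (𝓡 4).tangent 𝓘(ℝ, ℝ) ∞ L A
  homogeneous : ∀ q ∈ A, ∀ c : ℝ, 0 < c → L ⟨q.1, c • q.2⟩ = c ^ 2 * L q
  nondegenerate : ∀ q ∈ A, ∀ e ∈ IsManifold.maximalAtlas (𝓡 4) ∞ M, q.1 ∈ e.source →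
    (fundMatrix L e (natCoord e q)).det ≠ 0
  conic_T : IsConicSubbundle T
  T_subset_A : T ⊆ A
  connected_T : ∀ x : M, IsConnected {v : TangentSpace (𝓡 4) x | (⟨x, v⟩ : TanB M) ∈ T}
  pos_T : ∀ q ∈ T, 0 < L q
  /-- The matrix `g_ij` has signature `(+,-,-,-)` on `T`. -/
  lorentzian_T : ∀ q ∈ T, ∀ e ∈ IsManifold.maximalAtlas (𝓡 4) ∞ M, q.1 ∈ e.source →
    ∃ P : Matrix (Fin 4) (Fin 4) ℝ, IsUnit P.det ∧
      P.transpose * fundMatrix L e (natCoord e q) * P = Matrix.diagonal ![1, -1, -1, -1]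
  /-- `L` extends continuously by `0` to the boundary of `T`. -/
  boundary_T : ∀ q ∈ frontier T, Tendsto L (𝓝[T] q) (𝓝 0)

namespace FinslerSpacetime

variable (S : FinslerSpacetime M)

/-- The pseudo-norm `F = √|L|`. -/
def F (q : TanB M) : ℝ := Real.sqrt |S.L q|

/-- The non-null admissible vectors. -/
def A₀ : Set (TanB M) := {q ∈ S.A | S.L q ≠ 0}

/-- The non-null admissible directions, `𝒜₀⁺ = π⁺(𝒜₀)`. -/
def A₀plus : Set (PTM M) := toPTM '' {q : slit M | (q : TanB M) ∈ S.A₀}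

/-- The Hilbert form `ω = F_{·i} dx^i` on the slit tangent bundle (meaningful on `𝒜₀`): the fibre
derivative of `F` composed with the differential of the bundle projection. -/
def hilbertForm (q : slit M) : TangentSpace (𝓡 4).tangent q →L[ℝ] ℝ :=
  (fderiv ℝ (fun w : TangentSpace (𝓡 4) q.1.1 => S.F ⟨q.1.1, w⟩) q.1.2).comp
    (mfderiv (𝓡 4).tangent (𝓡 4) (fun p : slit M => p.1.1) q)

/-- `θ` is the form `ω⁺` on `𝒜₀⁺` induced by the Hilbert form: it is smooth and `(π⁺)^* θ = ω`. -/
def IsProjectedHilbertForm (θ : OneForm M) : Prop :=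
  θ.SmoothOn S.A₀plus ∧ ∀ q : slit M, (q : TanB M) ∈ S.A₀ →
    (θ (toPTM q)).comp (mfderiv (𝓡 4).tangent 𝓘(ℝ, E4 × E3) toPTM q) = S.hilbertForm q

/-- The geodesic coefficients `G^i`, where
`2G^i = ½ g^{ih} (L_{·h,j} ẋ^j - L_{,h})`. -/
def spray (e : OpenPartialHomeomorph M E4) (i : Fin 4) (z : E4 × E4) : ℝ :=
  (1 / 4) * ∑ h, (fundMatrix S.L e z)⁻¹ i h *
    ((∑ j, dBase j (dFib h (S.L ∘ natPoint e)) z * z.2 j) - dBase h (S.L ∘ natPoint e) z)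

/-- The coefficients `G^i_j = ∂G^i/∂ẋ^j` of the canonical nonlinear connection. -/
def conn (e : OpenPartialHomeomorph M E4) (i j : Fin 4) (z : E4 × E4) : ℝ :=
  dFib j (S.spray e i) z

/-- The horizontal coordinate vector `δ_i = ∂/∂x^i - G^j_i ∂/∂ẋ^j`. -/
def delta (e : OpenPartialHomeomorph M E4) (i : Fin 4) (z : E4 × E4) : E4 × E4 :=
  (EuclideanSpace.single i 1, -∑ j, S.conn e j i z • EuclideanSpace.single j (1 : ℝ))

/-- The local expression `l^i δ_i` with `l^i = ẋ^i / F`. -/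
def reebLocal (e : OpenPartialHomeomorph M E4) (z : E4 × E4) : E4 × E4 :=
  ∑ i, (z.2 i / S.F (natPoint e z)) • S.delta e i z

/-- The vector field `R` on `𝒜₀⁺` is expressed as `l^i δ_i` in all local homogeneous coordinates:
there is a vector field `ℓ` on `𝒜₀` which has the components of `l^i δ_i` in the coordinates induced
by every chart of `M`, and `R` is the projection of `ℓ` under `π⁺`. -/
def HasReebLocalForm (R : (p : PTM M) → TangentSpace 𝓘(ℝ, E4 × E3) p) : Prop :=
  ∃ ℓ : (q : slit M) → TangentSpace (𝓡 4).tangent q,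
    ∀ q : slit M, (q : TanB M) ∈ S.A₀ →
      (∀ e ∈ IsManifold.maximalAtlas (𝓡 4) ∞ M, (q : TanB M).1 ∈ e.source →
        mfderiv (𝓡 4).tangent 𝓘(ℝ, E4 × E4) (fun p : slit M => natCoord e p) q (ℓ q) =
          S.reebLocal e (natCoord e q)) ∧
      R (toPTM q) = mfderiv (𝓡 4).tangent 𝓘(ℝ, E4 × E3) toPTM q (ℓ q)

end FinslerSpacetime

/-- The tangent vector `(c(s), ċ(s))` of a curve defined on `[a, b]` (one-sided at the endpoints). -/
def tangentLift (a b : ℝ) (c : ℝ → M) (s : ℝ) : TanB M :=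
  ⟨c s, mfderivWithin 𝓘(ℝ, ℝ) (𝓡 4) c (Icc a b) s (1 : ℝ)⟩

/-- `C` is, on `[a, b]`, the canonical lift `s ↦ [(c(s), ċ(s))]` of the curve `c` to `PTM⁺`. -/
def IsCanonicalLift (a b : ℝ) (c : ℝ → M) (C : ℝ → PTM M) : Prop :=
  ∀ s ∈ Icc a b, ∃ h : (tangentLift a b c s).2 ≠ 0, C s = toPTM ⟨tangentLift a b c s, h⟩

namespace FinslerSpacetime

variable (S : FinslerSpacetime M)

/-- The arc length of a curve defined on `[a, b]`. -/
def length (a b : ℝ) (c : ℝ → M) : ℝ := ∫ s in a..b, S.F (tangentLift a b c s)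

/-- The curve `c` on `[a, b]` is a Finsler geodesic: it is a critical point of the length functional
with respect to all `C^k` variations with fixed endpoints. -/
def IsGeodesic (k : ℕ∞) (a b : ℝ) (c : ℝ → M) : Prop :=
  ∀ (r : ℝ) (Γ : ℝ → ℝ → M), 0 < r →
    ContMDiffOn 𝓘(ℝ, ℝ × ℝ) (𝓡 4) k (fun z : ℝ × ℝ => Γ z.1 z.2) (Ioo (-r) r ×ˢ Icc a b) →
    (∀ s ∈ Icc a b, Γ 0 s = c s) →
    (∀ t ∈ Ioo (-r) r, Γ t a = c a ∧ Γ t b = c b) →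
    HasDerivAt (fun t => S.length a b (Γ t)) 0 0

end FinslerSpacetime

end Spacetime

end

end Finsler

open Finsler

/-!
In the coordinates induced by a chart of `M` the Lagrangian is a function of `(x, ẋ)` on an open conic
subset of `V × V`, and everything rests on the two-form `dω` there:
`dω(X, Y) = D²F(X, (0, Y.1)) - D²F(Y, (0, X.1))` (`IsLagrangian.extD_hilb`).

*Contact form.* As `L = ±F²` with nondegenerate fibre Hessian, the fibre Hessian of `F` annihilates
`ẋ` and is nondegenerate on the kernel of `F_{·i}`. A basis of this three-dimensional kernel and its
dual basis with respect to the Hessian, placed in the vertical and horizontal directions, can be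
corrected to a Darboux basis of `dω`; together with `ẋ/F` it makes the contact volume nonzero
(`IsLagrangian.exists_darboux`, `wedgeTop_ne_zero_of_darboux`). The form descends to the oriented
directions because `F_{·i}` is homogeneous of degree zero: the projected form is the fibre derivative
of `F` at any vector of a ray, composed with the differential of `PTM⁺ → M`
(`FinslerSpacetime.projHilbert`). Uniqueness holds since `π⁺` is a submersion.

*Reeb field.* The vectors annihilated by `ω` and `dω` are the multiples of the Liouville vector
(`IsLagrangian.eq_smul_of_extD_hilb`), which span the kernel of `π⁺`; hence the Reeb vector is unique.
By homogeneity of `G^i`, `l^i δ_i` equals `F⁻¹ (ẋ^i ∂_i - 2 G^i ∂_{·i})`, and this is the solution `X` of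
`i_X d(L_{·i} dx^i) = -dL / F` (`FinslerSpacetime.isSprayDir_reebLocal`). That equation does not depend
on the coordinates (`IsSprayDir.map`), so the local expressions agree, and by `L = ±F²` it implies the
Reeb equations (`IsLagrangian.IsSprayDir.reeb`).

*Geodesics.* Let `z` be the velocity lift of a curve in coordinates. Along a variation with field
`y`, the derivative of `F_{·i} y^i` is the first variation of `F` plus `dω(z', (y, 0))`
(`IsLagrangian.hasDerivWithinAt_momentum`). With fixed endpoints the first variation of the length is
therefore `-∫ dω(z', (y, 0))` (`FinslerSpacetime.hasDerivAt_length`), so that geodesics are the curves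
with `dω(z', (ξ, 0)) = 0` for all `ξ`; necessity is tested with variations localized by a bump
function. Since `z'.1 = ẋ`, vertical vectors contribute nothing to `i_{z'} dω`, and `ω(z') = F = 1`.
Thus this equation says exactly that `z'` projects to the Reeb vector
(`FinslerSpacetime.hasMFDerivWithinAt_canonicalLift_iff`).
-/


open Set Filter Topology
open scoped Manifold ContDiff

namespace Finsler

noncomputable section

set_option linter.unusedSectionVars false

/-! ### Exterior derivatives of one-forms on a normed space -/

section Flat

variable {V W : Type*} [NormedAddCommGroup V] [NormedSpace ℝ V] [NormedAddCommGroup W]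
  [NormedSpace ℝ W]

theorem minSmoothness_two_le_infty : minSmoothness ℝ 2 ≤ (∞ : WithTop ℕ∞) := by
  rw [minSmoothness_of_isRCLikeNormedField]
  exact ENat.LEInfty.out

/-- The exterior derivative of a one-form on a normed space, as a function of two vectors. -/
def extD (α : V → V →L[ℝ] ℝ) (z X Y : V) : ℝ := fderiv ℝ α z X Y - fderiv ℝ α z Y X

theorem extD_self (α : V → V →L[ℝ] ℝ) (z X : V) : extD α z X X = 0 := sub_self _

theorem extD_add_left (α : V → V →L[ℝ] ℝ) (z X X' Y : V) :
    extD α z (X + X') Y = extD α z X Y + extD α z X' Y := by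
  simp only [extD, map_add, add_apply]; ring

theorem extD_smul_left (α : V → V →L[ℝ] ℝ) (z : V) (c : ℝ) (X Y : V) :
    extD α z (c • X) Y = c * extD α z X Y := by
  simp only [extD, map_smul, smul_apply, smul_eq_mul]; ring

theorem extD_swap (α : V → V →L[ℝ] ℝ) (z X Y : V) : extD α z X Y = -extD α z Y X := by
  simp only [extD]; ring

/-- Exterior derivatives commute with pullbacks. -/
theorem extD_pullback {α : W → W →L[ℝ] ℝ} {β : V → V →L[ℝ] ℝ} {f : V → W} {z : V}
    (hβ : ∀ᶠ y in 𝓝 z, β y = (α (f y)).comp (fderiv ℝ f y))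
    (hα : DifferentiableAt ℝ α (f z)) (hf : ContDiffAt ℝ ∞ f z) (X Y : V) :
    extD β z X Y = extD α (f z) (fderiv ℝ f z X) (fderiv ℝ f z Y) := by
  have hf1 : DifferentiableAt ℝ f z := hf.differentiableAt (by simp)
  have hf2 : DifferentiableAt ℝ (fderiv ℝ f) z :=
    (hf.fderiv_right (m := 1) (by norm_cast)).differentiableAt (by simp)
  have hsymm : IsSymmSndFDerivAt ℝ f z := hf.isSymmSndFDerivAt minSmoothness_two_le_infty
  have h : HasFDerivAt (fun y => (α (f y)).comp (fderiv ℝ f y)) _ z :=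
    (hα.hasFDerivAt.comp z hf1.hasFDerivAt).clm_comp hf2.hasFDerivAt
  have h' := (h.congr_of_eventuallyEq hβ).fderiv
  have key : ∀ X Y, fderiv ℝ β z X Y =
      fderiv ℝ α (f z) (fderiv ℝ f z X) (fderiv ℝ f z Y) + α (f z) (fderiv ℝ (fderiv ℝ f) z X Y) := by
    intro X Y
    rw [h']
    simp [add_comm]
  rw [extD, key, key, hsymm.eq X Y, extD]
  ring

/-! ### Homogeneous Lagrangians on a coordinate domain -/

/-- The Hilbert one-form `f_{·i} dx^i` of a function `f` of the coordinates `(x, ẋ)`. -/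
def hilb (f : V × V → ℝ) (z : V × V) : V × V →L[ℝ] ℝ :=
  ((fderiv ℝ f z).comp (ContinuousLinearMap.inr ℝ V V)).comp (ContinuousLinearMap.fst ℝ V V)

@[simp] theorem hilb_apply (f : V × V → ℝ) (z Y : V × V) : hilb f z Y = fderiv ℝ f z (0, Y.1) := rfl

/-- The pseudo-norm `√|L|` of a Lagrangian. -/
def pnorm (L : V × V → ℝ) (z : V × V) : ℝ := Real.sqrt |L z|

/-- `L` is a Finsler Lagrangian of the coordinates `(x, ẋ)` on the open conic set `U`, where it has
no zeros. -/
structure IsLagrangian (U : Set (V × V)) (L : V × V → ℝ) : Prop where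
  isOpen : IsOpen U
  conic : ∀ z ∈ U, ∀ c : ℝ, 0 < c → (z.1, c • z.2) ∈ U
  smooth : ContDiffOn ℝ ∞ L U
  homogeneous : ∀ z ∈ U, ∀ c : ℝ, 0 < c → L (z.1, c • z.2) = c ^ 2 * L z
  ne_zero : ∀ z ∈ U, L z ≠ 0
  nondegenerate : ∀ z ∈ U, ∀ η : V,
    (∀ η' : V, fderiv ℝ (fderiv ℝ L) z (0, η) (0, η') = 0) → η = 0

theorem fderiv_hilb {f : V × V → ℝ} {z : V × V} (hf : ContDiffAt ℝ ∞ f z) (X Y : V × V) :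
    fderiv ℝ (hilb f) z X Y = fderiv ℝ (fderiv ℝ f) z X (0, Y.1) := by
  have hf2 : DifferentiableAt ℝ (fderiv ℝ f) z :=
    (hf.fderiv_right (m := 1) (by norm_cast)).differentiableAt (by simp)
  have h : HasFDerivAt (hilb f) _ z :=
    (hf2.hasFDerivAt.clm_comp (hasFDerivAt_const (ContinuousLinearMap.inr ℝ V V) z)).clm_comp
      (hasFDerivAt_const (ContinuousLinearMap.fst ℝ V V) z)
  rw [h.fderiv]
  simp

theorem contDiffAt_hilb {f : V × V → ℝ} {z : V × V} (hf : ContDiffAt ℝ ∞ f z) :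
    ContDiffAt ℝ ∞ (hilb f) z :=
  ((hf.fderiv_right (m := ∞) (by norm_cast)).clm_comp contDiffAt_const).clm_comp contDiffAt_const

/-- The second derivative of a function that is positively homogeneous of degree `d` in `ẋ`:
Euler's relation, differentiated once more. -/
theorem euler_deriv {f : V × V → ℝ} {z : V × V} {d : ℝ} (hf : ContDiffAt ℝ ∞ f z)
    (he : ∀ᶠ y in 𝓝 z, fderiv ℝ f y (0, y.2) = d * f y) (X : V × V) :
    fderiv ℝ (fderiv ℝ f) z X (0, z.2) = d * fderiv ℝ f z X - fderiv ℝ f z (0, X.2) := by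
  have hf1 : DifferentiableAt ℝ f z := hf.differentiableAt (by simp)
  have hf2 : DifferentiableAt ℝ (fderiv ℝ f) z :=
    (hf.fderiv_right (m := 1) (by norm_cast)).differentiableAt (by simp)
  have h1 := hf2.hasFDerivAt.clm_apply
    (((ContinuousLinearMap.inr ℝ V V).comp (ContinuousLinearMap.snd ℝ V V)).hasFDerivAt (x := z))
  have h2 := (hf1.hasFDerivAt.const_mul d).congr_of_eventuallyEq he
  have h3 := DFunLike.congr_fun (h1.unique h2) X
  simp at h3
  linarith

/-- Euler's relation for a function homogeneous of degree `n` in the fibre variable. -/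
theorem euler_of_homogeneous {f : V × V → ℝ} {z : V × V} (n : ℕ) (hf : DifferentiableAt ℝ f z)
    (hh : ∀ c : ℝ, 0 < c → f (z.1, c • z.2) = c ^ n * f z) :
    fderiv ℝ f z (0, z.2) = n * f z := by
  have h1 : HasDerivAt (fun c : ℝ => ((z.1, c • z.2) : V × V)) (0, z.2) 1 := by
    have := (hasDerivAt_const (1 : ℝ) z.1).prodMk ((hasDerivAt_id (1 : ℝ)).smul_const z.2)
    simpa using this
  have hz : z = (z.1, (1 : ℝ) • z.2) := by simp
  have h2 : HasDerivAt (fun c : ℝ => f (z.1, c • z.2)) (fderiv ℝ f z (0, z.2)) 1 := by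
    have hf' : HasFDerivAt f (fderiv ℝ f z) (z.1, (1 : ℝ) • z.2) := by
      rw [← hz]; exact hf.hasFDerivAt
    exact hf'.comp_hasDerivAt (1 : ℝ) h1
  have h3 : HasDerivAt (fun c : ℝ => c ^ n * f z) (n * f z) 1 := by
    simpa using (hasDerivAt_pow n (1 : ℝ)).mul_const (f z)
  refine h2.unique (h3.congr_of_eventuallyEq ?_)
  filter_upwards [lt_mem_nhds (zero_lt_one (α := ℝ))] with c hc using hh c hc

namespace IsLagrangian

variable {U : Set (V × V)} {L : V × V → ℝ} (h : IsLagrangian U L) {z : V × V}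
include h

theorem contDiffAt (hz : z ∈ U) : ContDiffAt ℝ ∞ L z := h.smooth.contDiffAt (h.isOpen.mem_nhds hz)

theorem pnorm_pos (hz : z ∈ U) : 0 < pnorm L z := Real.sqrt_pos.2 (abs_pos.2 (h.ne_zero z hz))

theorem pnorm_smul (hz : z ∈ U) {c : ℝ} (hc : 0 < c) :
    pnorm L (z.1, c • z.2) = c * pnorm L z := by
  rw [pnorm, h.homogeneous z hz c hc, abs_mul, abs_of_pos (by positivity : 0 < c ^ 2),
    Real.sqrt_mul (by positivity), Real.sqrt_sq hc.le, pnorm]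

theorem contDiffAt_pnorm (hz : z ∈ U) : ContDiffAt ℝ ∞ (pnorm L) z :=
  ((contDiffAt_abs (h.ne_zero z hz)).comp z (h.contDiffAt hz)).sqrt (abs_pos.2 (h.ne_zero z hz)).ne'

theorem differentiableAt_pnorm (hz : z ∈ U) : DifferentiableAt ℝ (pnorm L) z :=
  (h.contDiffAt_pnorm hz).differentiableAt (by simp)

theorem euler (hz : z ∈ U) : fderiv ℝ L z (0, z.2) = 2 * L z := by
  exact_mod_cast euler_of_homogeneous 2 ((h.contDiffAt hz).differentiableAt (by simp))
    (fun c hc => h.homogeneous z hz c hc)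

theorem euler_pnorm (hz : z ∈ U) : fderiv ℝ (pnorm L) z (0, z.2) = pnorm L z := by
  have := euler_of_homogeneous 1 (h.differentiableAt_pnorm hz)
    (fun c hc => by rw [h.pnorm_smul hz hc, pow_one])
  simpa using this

theorem euler_snd (hz : z ∈ U) (X : V × V) :
    fderiv ℝ (fderiv ℝ L) z X (0, z.2) = 2 * fderiv ℝ L z X - fderiv ℝ L z (0, X.2) :=
  euler_deriv (h.contDiffAt hz)
    (by filter_upwards [h.isOpen.mem_nhds hz] with y hy using h.euler hy) X

theorem euler_pnorm_snd (hz : z ∈ U) (X : V × V) :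
    fderiv ℝ (fderiv ℝ (pnorm L)) z X (0, z.2) = fderiv ℝ (pnorm L) z (X.1, 0) := by
  rw [euler_deriv (d := 1) (h.contDiffAt_pnorm hz)
    (by filter_upwards [h.isOpen.mem_nhds hz] with y hy using by rw [h.euler_pnorm hy, one_mul]) X,
    one_mul, ← map_sub]
  simp [Prod.sub_def]

/-- Near a point `L = ε F²` with a sign `ε`. -/
theorem exists_eq_sq (hz : z ∈ U) :
    ∃ ε : ℝ, ε ≠ 0 ∧ ∀ᶠ y in 𝓝 z, y ∈ U ∧ L y = ε * pnorm L y ^ 2 := by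
  have hU := h.isOpen.mem_nhds hz
  have hc := (h.contDiffAt hz).continuousAt
  rcases lt_or_gt_of_ne (h.ne_zero z hz) with h0 | h0
  · refine ⟨-1, by norm_num, ?_⟩
    filter_upwards [hU, hc.eventually_lt_const h0] with y hy hy0
    refine ⟨hy, ?_⟩
    rw [pnorm, Real.sq_sqrt (abs_nonneg _), abs_of_neg hy0]
    ring
  · refine ⟨1, one_ne_zero, ?_⟩
    filter_upwards [hU, hc.eventually_const_lt h0] with y hy hy0
    refine ⟨hy, ?_⟩
    rw [pnorm, Real.sq_sqrt (abs_nonneg _), abs_of_pos hy0, one_mul]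

/-- The first and second derivatives of `L` in terms of those of the pseudo-norm. -/
theorem fderiv_eq (hz : z ∈ U) : ∃ ε : ℝ, ε ≠ 0 ∧
    (∀ X, fderiv ℝ L z X = 2 * ε * pnorm L z * fderiv ℝ (pnorm L) z X) ∧
    ∀ X Y, fderiv ℝ (fderiv ℝ L) z X Y = 2 * ε * (fderiv ℝ (pnorm L) z X * fderiv ℝ (pnorm L) z Y +
      pnorm L z * fderiv ℝ (fderiv ℝ (pnorm L)) z X Y) := by
  obtain ⟨ε, hε, he⟩ := h.exists_eq_sq hz
  have h1 : ∀ᶠ y in 𝓝 z, fderiv ℝ L y = (2 * ε * pnorm L y) • fderiv ℝ (pnorm L) y := by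
    filter_upwards [he.eventually_nhds] with y hy
    have hy' : L =ᶠ[𝓝 y] fun y => ε * pnorm L y ^ 2 := hy.mono fun _ h => h.2
    rw [hy'.fderiv_eq]
    have hd := (h.differentiableAt_pnorm hy.self_of_nhds.1).hasFDerivAt
    rw [((hd.pow 2).const_mul ε).fderiv]
    refine ContinuousLinearMap.ext fun X => ?_
    simp
    ring
  refine ⟨ε, hε, fun X => by rw [h1.self_of_nhds]; simp, fun X Y => ?_⟩
  have hF := h.contDiffAt_pnorm hz
  have hd := (h.differentiableAt_pnorm hz).hasFDerivAt
  have hd2 : DifferentiableAt ℝ (fderiv ℝ (pnorm L)) z :=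
    (hF.fderiv_right (m := 1) (by norm_cast)).differentiableAt (by simp)
  rw [((hd.const_mul (2 * ε)).fun_smul hd2.hasFDerivAt |>.congr_of_eventuallyEq h1).fderiv]
  simp
  ring

theorem extD_hilb (hz : z ∈ U) (X Y : V × V) : extD (hilb (pnorm L)) z X Y =
    fderiv ℝ (fderiv ℝ (pnorm L)) z X (0, Y.1) - fderiv ℝ (fderiv ℝ (pnorm L)) z Y (0, X.1) := by
  rw [extD, fderiv_hilb (h.contDiffAt_pnorm hz), fderiv_hilb (h.contDiffAt_pnorm hz)]

theorem snd_fderiv_symm (hz : z ∈ U) (X Y : V × V) :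
    fderiv ℝ (fderiv ℝ L) z X Y = fderiv ℝ (fderiv ℝ L) z Y X :=
  ((h.contDiffAt hz).isSymmSndFDerivAt minSmoothness_two_le_infty).eq X Y

theorem snd_fderiv_pnorm_symm (hz : z ∈ U) (X Y : V × V) :
    fderiv ℝ (fderiv ℝ (pnorm L)) z X Y = fderiv ℝ (fderiv ℝ (pnorm L)) z Y X :=
  ((h.contDiffAt_pnorm hz).isSymmSndFDerivAt minSmoothness_two_le_infty).eq X Y

/-- The kernel of the fibre Hessian of the pseudo-norm on the kernel of its fibre derivative is
trivial. -/
theorem eq_zero_of_hess (hz : z ∈ U) {ξ : V} (h0 : fderiv ℝ (pnorm L) z (0, ξ) = 0)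
    (h1 : ∀ η, fderiv ℝ (fderiv ℝ (pnorm L)) z (0, ξ) (0, η) = 0) : ξ = 0 := by
  obtain ⟨ε, -, -, he⟩ := h.fderiv_eq hz
  refine h.nondegenerate z hz ξ fun η => ?_
  rw [he, h0, h1]
  ring

/-- The fibre Hessian of the pseudo-norm vanishes only in the direction of `ẋ`. -/
theorem eq_smul_of_hess (hz : z ∈ U) {η : V}
    (h1 : ∀ ξ, fderiv ℝ (fderiv ℝ (pnorm L)) z (0, η) (0, ξ) = 0) :
    ∃ c : ℝ, η = c • z.2 := by
  have hF := (h.pnorm_pos hz).ne'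
  refine ⟨fderiv ℝ (pnorm L) z (0, η) / pnorm L z, sub_eq_zero.1 ?_⟩
  have e : ∀ c : ℝ, ((0 : V), η - c • z.2) = (0, η) - c • (0, z.2) := fun c => by simp
  refine h.eq_zero_of_hess hz ?_ fun ξ => ?_
  · rw [e, map_sub, map_smul, h.euler_pnorm hz, smul_eq_mul, div_mul_cancel₀ _ hF, sub_self]
  · rw [e, map_sub, map_smul, sub_apply, h1, smul_apply,
      h.snd_fderiv_pnorm_symm hz, h.euler_pnorm_snd hz, ← Prod.zero_eq_mk, map_zero, smul_zero,
      sub_zero]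

/-- A vector annihilated by the Hilbert form and its exterior derivative is a multiple of the
Liouville vector. -/
theorem eq_smul_of_extD_hilb (hz : z ∈ U) {X : V × V} (h0 : hilb (pnorm L) z X = 0)
    (h1 : ∀ Y, extD (hilb (pnorm L)) z X Y = 0) : ∃ c : ℝ, X = c • (0, z.2) := by
  have hX1 : X.1 = 0 := by
    refine h.eq_zero_of_hess hz h0 fun η => ?_
    have := h1 (0, η)
    rw [h.extD_hilb hz, ← Prod.zero_eq_mk, map_zero, zero_sub, neg_eq_zero] at this
    rw [h.snd_fderiv_pnorm_symm hz, this]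
  have hX : X = (0, X.2) := Prod.ext hX1 rfl
  obtain ⟨c, hc⟩ := h.eq_smul_of_hess hz (η := X.2) fun ξ => by
    have := h1 (ξ, 0)
    rw [h.extD_hilb hz, hX1, ← Prod.zero_eq_mk, map_zero, sub_zero] at this
    rw [← hX, this]
  exact ⟨c, by rw [hX, hc]; simp⟩

/-- The fibre derivative of the pseudo-norm is homogeneous of degree zero. -/
theorem hilb_smul (hz : z ∈ U) {c : ℝ} (hc : 0 < c) :
    hilb (pnorm L) (z.1, c • z.2) = hilb (pnorm L) z := by
  have hd := (h.differentiableAt_pnorm (h.conic z hz c hc)).hasFDerivAt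
  have h1 : HasFDerivAt (fun y : V × V => (y.1, c • y.2)) ((ContinuousLinearMap.fst ℝ V V).prod
      (c • ContinuousLinearMap.snd ℝ V V)) z :=
    hasFDerivAt_fst.prodMk (hasFDerivAt_snd.const_smul c)
  have h2 := (h.differentiableAt_pnorm hz).hasFDerivAt.const_mul c
  have h3 := (hd.comp z h1).unique (h2.congr_of_eventuallyEq (by
    filter_upwards [h.isOpen.mem_nhds hz] with y hy using h.pnorm_smul hy hc))
  refine ContinuousLinearMap.ext fun Y => ?_
  have h4 := DFunLike.congr_fun h3 (0, Y.1)
  simp only [ContinuousLinearMap.comp_apply, ContinuousLinearMap.prod_apply,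
    smul_apply, ContinuousLinearMap.coe_fst', ContinuousLinearMap.coe_snd',
    smul_eq_mul] at h4
  have e : ((0 : V), c • Y.1) = c • (0, Y.1) := by simp
  rw [e, map_smul, smul_eq_mul] at h4
  exact mul_left_cancel₀ hc.ne' h4

end IsLagrangian

/-! ### The geodesic spray of a homogeneous Lagrangian -/

/-- `X` is the geodesic spray of `L` at `z`, divided by the pseudo-norm: the vector determined by
`i_X d(L_{·i} dx^i) = -dL / F`. This description is covariant under changes of coordinates. -/
def IsSprayDir (L : V × V → ℝ) (z X : V × V) : Prop :=
  ∀ Y, extD (hilb L) z X Y = -(fderiv ℝ L z Y / pnorm L z)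

namespace IsLagrangian

variable {U : Set (V × V)} {L : V × V → ℝ} (h : IsLagrangian U L) {z : V × V}
include h

theorem extD_hilb_self (hz : z ∈ U) (X Y : V × V) : extD (hilb L) z X Y =
    fderiv ℝ (fderiv ℝ L) z X (0, Y.1) - fderiv ℝ (fderiv ℝ L) z Y (0, X.1) := by
  rw [extD, fderiv_hilb (h.contDiffAt hz), fderiv_hilb (h.contDiffAt hz)]

theorem isSprayDir_unique (hz : z ∈ U) {X X' : V × V} (hX : IsSprayDir L z X)
    (hX' : IsSprayDir L z X') : X = X' := by
  set D := X + (-1 : ℝ) • X' with hD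
  have h0 : ∀ Y, extD (hilb L) z D Y = 0 := fun Y => by
    rw [hD, extD_add_left, extD_smul_left, hX, hX']; ring
  have hD1 : D.1 = 0 := h.nondegenerate z hz _ fun η => by
    have := h0 (0, η)
    rw [h.extD_hilb_self hz, ← Prod.zero_eq_mk, map_zero, zero_sub, neg_eq_zero] at this
    rw [h.snd_fderiv_symm hz, this]
  have hD' : D = (0, D.2) := Prod.ext hD1 rfl
  have hD2 : D.2 = 0 := h.nondegenerate z hz _ fun ξ => by
    have := h0 (ξ, 0)
    rw [h.extD_hilb_self hz, hD1, ← Prod.zero_eq_mk, map_zero, sub_zero] at this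
    rw [← hD', this]
  have : D = 0 := Prod.ext hD1 hD2
  rw [hD] at this
  simpa [← sub_eq_add_neg, sub_eq_zero] using this

theorem IsSprayDir.fst_eq (hz : z ∈ U) {X : V × V} (hX : IsSprayDir L z X) :
    X.1 = (pnorm L z)⁻¹ • z.2 := by
  rw [← sub_eq_zero]
  refine h.nondegenerate z hz _ fun η => ?_
  have h1 := hX (0, η)
  rw [h.extD_hilb_self hz, ← Prod.zero_eq_mk, map_zero, zero_sub, neg_inj] at h1
  have e : ((0 : V), X.1 - (pnorm L z)⁻¹ • z.2) = (0, X.1) - (pnorm L z)⁻¹ • (0, z.2) := by simp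
  have h2 := h.euler_snd hz (0, η)
  rw [h.snd_fderiv_symm hz, e, map_sub, map_smul, h1, h2, smul_eq_mul]
  ring

/-- The normalized spray is a Reeb direction of the Hilbert form. -/
theorem IsSprayDir.reeb (hz : z ∈ U) {X : V × V} (hX : IsSprayDir L z X) :
    hilb (pnorm L) z X = 1 ∧ ∀ Y, extD (hilb (pnorm L)) z X Y = 0 := by
  have hF := (h.pnorm_pos hz).ne'
  have h1 := IsSprayDir.fst_eq h hz hX
  obtain ⟨ε, hε, hd, hd2⟩ := h.fderiv_eq hz
  have hω : hilb (pnorm L) z X = 1 := by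
    have e : ((0 : V), (pnorm L z)⁻¹ • z.2) = (pnorm L z)⁻¹ • (0, z.2) := by simp
    rw [hilb_apply, h1, e, map_smul, h.euler_pnorm hz, smul_eq_mul, inv_mul_cancel₀ hF]
  rw [hilb_apply] at hω
  have key : ∀ Y, fderiv ℝ (pnorm L) z X * fderiv ℝ (pnorm L) z (0, Y.1) +
      pnorm L z * extD (hilb (pnorm L)) z X Y = 0 := fun Y => by
    have h2 := hX Y
    rw [h.extD_hilb_self hz, hd2, hd2, hd, hω] at h2
    rw [h.extD_hilb hz]
    field_simp at h2
    have h3 : fderiv ℝ (pnorm L) z X * fderiv ℝ (pnorm L) z (0, Y.1) +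
      pnorm L z * fderiv ℝ (fderiv ℝ (pnorm L)) z X (0, Y.1) -
      (fderiv ℝ (pnorm L) z Y + pnorm L z * fderiv ℝ (fderiv ℝ (pnorm L)) z Y (0, X.1)) =
      -fderiv ℝ (pnorm L) z Y := by
      linarith
    linarith
  have h4 := key X
  rw [extD_self, hω] at h4
  have h5 : fderiv ℝ (pnorm L) z X = 0 := by linarith
  refine ⟨hω, fun Y => ?_⟩
  have h6 := key Y
  rw [h5, zero_mul, zero_add] at h6
  exact (mul_eq_zero.1 h6).resolve_left hF

end IsLagrangian

/-- The normalized spray does not depend on the coordinates: it is mapped to itself under the change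
of coordinates `Φ` of the tangent bundle induced by a change of coordinates `φ` of the base. -/
theorem IsSprayDir.map {U : Set (V × V)} {L L₀ : V × V → ℝ} (h : IsLagrangian U L)
    {Φ : V × V → V × V} {φ : V → V} {z X : V × V}
    (hΦ : ContDiffAt ℝ ∞ Φ z) (hφ : ∀ᶠ y in 𝓝 z, DifferentiableAt ℝ φ y.1 ∧
      Φ y = (φ y.1, fderiv ℝ φ y.1 y.2)) (hz : Φ z ∈ U)
    (hsurj : Function.Surjective (fderiv ℝ Φ z)) (hL : ∀ᶠ y in 𝓝 z, L₀ y = L (Φ y))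
    (hX : IsSprayDir L₀ z X) : IsSprayDir L (Φ z) (fderiv ℝ Φ z X) := by
  have hU : ∀ᶠ y in 𝓝 z, Φ y ∈ U := hΦ.continuousAt.eventually_mem (h.isOpen.mem_nhds hz)
  have hd : ∀ᶠ y in 𝓝 z, DifferentiableAt ℝ Φ y :=
    ((hΦ.of_le (m := 1) (by norm_cast)).eventually (by simp)).mono
      fun y hy => hy.differentiableAt (by simp)
  have hfst : ∀ᶠ y in 𝓝 z, ∀ Y : V × V, (fderiv ℝ Φ y Y).1 = fderiv ℝ φ y.1 Y.1 := by
    filter_upwards [hφ.eventually_nhds, hd] with y hy hdy Y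
    have h1 : HasFDerivAt (fun y => (Φ y).1) _ y := hdy.hasFDerivAt.fst
    have h2 : HasFDerivAt (fun y : V × V => φ y.1) _ y :=
      hy.self_of_nhds.1.hasFDerivAt.comp y hasFDerivAt_fst
    have h3 := h1.unique (h2.congr_of_eventuallyEq (hy.mono fun y hy => congrArg Prod.fst hy.2))
    exact DFunLike.congr_fun h3 Y
  have hsnd : ∀ᶠ y in 𝓝 z, ∀ η : V, fderiv ℝ Φ y (0, η) = (0, fderiv ℝ φ y.1 η) := by
    filter_upwards [hφ.eventually_nhds, hd] with y hy hdy η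
    have h1 : HasFDerivAt (fun v : V => Φ (y.1, v)) _ y.2 :=
      hdy.hasFDerivAt.comp y.2 (hasFDerivAt_prodMk_right y.1 y.2)
    have h2 : HasFDerivAt (fun v : V => (φ y.1, fderiv ℝ φ y.1 v)) _ y.2 :=
      (hasFDerivAt_const (φ y.1) y.2).prodMk (fderiv ℝ φ y.1).hasFDerivAt
    have hc : Tendsto (fun v : V => (y.1, v)) (𝓝 y.2) (𝓝 y) :=
      (Continuous.prodMk_right y.1).tendsto y.2
    have h3 := h1.unique (h2.congr_of_eventuallyEq ((hc.eventually hy).mono fun v hv => hv.2))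
    exact DFunLike.congr_fun h3 η
  have hdL : ∀ᶠ y in 𝓝 z, fderiv ℝ L₀ y = (fderiv ℝ L (Φ y)).comp (fderiv ℝ Φ y) := by
    filter_upwards [hL.eventually_nhds, hU, hd] with y hy hyU hdy
    rw [EventuallyEq.fderiv_eq hy]
    exact fderiv_comp y ((h.contDiffAt hyU).differentiableAt (by simp)) hdy
  have hpull : ∀ᶠ y in 𝓝 z, hilb L₀ y = (hilb L (Φ y)).comp (fderiv ℝ Φ y) := by
    filter_upwards [hdL, hfst, hsnd] with y h1 h2 h3
    refine ContinuousLinearMap.ext fun Y => ?_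
    simp only [hilb_apply, ContinuousLinearMap.comp_apply, h1, h2, h3]
  intro Y'
  obtain ⟨Y, rfl⟩ := hsurj Y'
  have h1 := hX Y
  rw [extD_pullback hpull ((contDiffAt_hilb (h.contDiffAt hz)).differentiableAt (by simp)) hΦ] at h1
  rw [h1, hdL.self_of_nhds, pnorm, hL.self_of_nhds, pnorm]
  rfl

end Flat

/-! ### Nonvanishing of the contact volume -/

section Wedge

/-- Alternating sums over permutations, expanded along the first value. -/
def altSum : (n : ℕ) → ((Fin n → Fin n) → ℤ) → ℤ
  | 0, f => f id
  | n + 1, f => ∑ i : Fin (n + 1), (if i = 0 then 1 else -1) *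
      altSum n fun t => f (Fin.cons i fun k => Equiv.swap 0 i (t k).succ)

theorem sum_sign_mul_eq_altSum : (n : ℕ) → (f : (Fin n → Fin n) → ℤ) →
    ∑ σ : Equiv.Perm (Fin n), (Equiv.Perm.sign σ : ℤ) * f σ = altSum n f
  | 0, f => by
    rw [Fintype.sum_unique]
    simp [altSum]
  | n + 1, f => by
    rw [altSum, ← Equiv.Perm.decomposeFin.symm.sum_comp, Fintype.sum_prod_type]
    refine Finset.sum_congr rfl fun i _ => ?_
    rw [← sum_sign_mul_eq_altSum n, Finset.mul_sum]
    refine Finset.sum_congr rfl fun τ _ => ?_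
    have : (⇑(Equiv.Perm.decomposeFin.symm (i, τ)) : Fin (n + 1) → Fin (n + 1)) =
        Fin.cons i fun k => Equiv.swap 0 i (τ k).succ := by
      funext k
      refine Fin.cases ?_ (fun k => ?_) k
      · simp
      · simp
    rw [this, Equiv.Perm.decomposeFin.symm_sign]
    split_ifs <;> simp

theorem altSum_zero : (n : ℕ) → altSum n (fun _ => 0) = 0
  | 0 => rfl
  | n + 1 => by simp [altSum, altSum_zero n]

/-- The matrix of a two-form in a basis `(e, f₀, g₀, f₁, g₁, f₂, g₂)` adapted to a contact form. -/
def darbouxMatrix : Fin 7 → Fin 7 → ℤ :=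
  ![![0, 0, 0, 0, 0, 0, 0], ![0, 0, 1, 0, 0, 0, 0], ![0, -1, 0, 0, 0, 0, 0],
    ![0, 0, 0, 0, 1, 0, 0], ![0, 0, 0, -1, 0, 0, 0], ![0, 0, 0, 0, 0, 0, 1],
    ![0, 0, 0, 0, 0, -1, 0]]

set_option maxRecDepth 100000 in
/-- The contact volume of an adapted basis, up to the normalization of the wedge product: exactly
the `2³ · 3!` permutations that permute and flip the three conjugate pairs contribute, each with
`1`. -/
theorem sum_darboux : ∑ σ : Equiv.Perm (Fin 7), (Equiv.Perm.sign σ : ℤ) *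
    (if σ 0 = 0 then darbouxMatrix (σ 1) (σ 2) *
      (darbouxMatrix (σ 3) (σ 4) * darbouxMatrix (σ 5) (σ 6)) else 0) = 48 := by
  refine (sum_sign_mul_eq_altSum 7 fun t => if t 0 = 0 then darbouxMatrix (t 1) (t 2) *
      (darbouxMatrix (t 3) (t 4) * darbouxMatrix (t 5) (t 6)) else 0).trans ?_
  rw [altSum, Finset.sum_eq_single 0]
  · decide +kernel
  · intro i _ hi
    simp [hi, altSum_zero]
  · simp

variable {V : Type*} [AddCommGroup V] [Module ℝ V] [TopologicalSpace V]

theorem wedgeTop_ne_zero_of_darboux (α : V →L[ℝ] ℝ) (β : V [⋀^Fin 2]→L[ℝ] ℝ) (v : Fin 7 → V)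
    (hα : ∀ i, α (v i) = if i = 0 then 1 else 0)
    (hβ : ∀ i j, i ≠ 0 → j ≠ 0 → β ![v i, v j] = darbouxMatrix i j) : wedgeTop α β v ≠ 0 := by
  have h : wedgeTop α β v = 6 := by
    rw [wedgeTop]
    have : ∀ σ : Equiv.Perm (Fin 7), ((Equiv.Perm.sign σ : ℤ) : ℝ) *
        (α (v (σ 0)) * β ![v (σ 1), v (σ 2)] * β ![v (σ 3), v (σ 4)] * β ![v (σ 5), v (σ 6)]) =
        (((Equiv.Perm.sign σ : ℤ) * (if σ 0 = 0 then darbouxMatrix (σ 1) (σ 2) *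
          (darbouxMatrix (σ 3) (σ 4) * darbouxMatrix (σ 5) (σ 6)) else 0) : ℤ) : ℝ) := by
      intro σ
      by_cases h0 : σ 0 = 0
      · have hne : ∀ i, i ≠ 0 → σ i ≠ 0 := fun i hi h => hi (σ.injective (h.trans h0.symm))
        rw [hα, hβ _ _ (hne 1 (by decide)) (hne 2 (by decide)),
          hβ _ _ (hne 3 (by decide)) (hne 4 (by decide)),
          hβ _ _ (hne 5 (by decide)) (hne 6 (by decide))]
        simp only [h0, if_true]
        push_cast
        ring
      · rw [hα]
        simp [h0]
    rw [Finset.sum_congr rfl fun σ _ => this σ, ← Int.cast_sum, sum_darboux]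
    norm_num
  rw [h]
  norm_num

end Wedge

section Darboux

variable {V : Type*} [NormedAddCommGroup V] [NormedSpace ℝ V]

theorem extD_sum_left {W : Type*} [NormedAddCommGroup W] [NormedSpace ℝ W] (α : W → W →L[ℝ] ℝ)
    (z : W) {ι : Type*} (s : Finset ι) (X : ι → W) (Y : W) :
    extD α z (∑ i ∈ s, X i) Y = ∑ i ∈ s, extD α z (X i) Y := by
  simp only [extD, map_sum, sum_apply, Finset.sum_sub_distrib]

/-- Conjugate vectors whose second halves span an isotropic space can be corrected to an adapted
basis: adding `½ ∑_c β(f_b, f_c) g_c` to `f_b` makes the first halves isotropic as well. -/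
theorem exists_darboux_of_conjugate {W : Type*} [NormedAddCommGroup W] [NormedSpace ℝ W]
    (α : W → W →L[ℝ] ℝ) (z e : W) (f g : Fin 3 → W) (he : α z e = 1) (hf : ∀ a, α z (f a) = 0)
    (hg : ∀ a, α z (g a) = 0) (hgg : ∀ a b, extD α z (g a) (g b) = 0)
    (hfg : ∀ a b, extD α z (f a) (g b) = if a = b then 1 else 0) :
    ∃ v : Fin 7 → W, (∀ i, α z (v i) = if i = 0 then 1 else 0) ∧
      ∀ i j, i ≠ 0 → j ≠ 0 → extD α z (v i) (v j) = darbouxMatrix i j := by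
  set f' : Fin 3 → W := fun b => f b + (1 / 2 : ℝ) • ∑ c, extD α z (f b) (f c) • g c with hf'
  have hgf : ∀ a b, extD α z (g a) (f b) = -if b = a then 1 else 0 := fun a b => by
    rw [extD_swap, hfg]
  have h1 : ∀ a, α z (f' a) = 0 := fun a => by simp [hf', hf, hg]
  have h2 : ∀ a b, extD α z (f' a) (g b) = if a = b then 1 else 0 := fun a b => by
    simp [hf', extD_add_left, extD_smul_left, extD_sum_left, hfg, hgg]
  have h2' : ∀ a b, extD α z (g a) (f' b) = -if b = a then 1 else 0 := fun a b => by
    rw [extD_swap, h2]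
  have hx : ∀ a y, extD α z (f' a) y =
      extD α z (f a) y + (1 / 2) * ∑ c, extD α z (f a) (f c) * extD α z (g c) y := fun a y => by
    simp only [hf', extD_add_left, extD_smul_left, extD_sum_left]
  have h3 : ∀ a b, extD α z (f a) (f' b) = (1 / 2) * extD α z (f a) (f b) := fun a b => by
    have hs := extD_swap α z (f b) (f a)
    rw [extD_swap, hx]
    simp only [hgf]
    simp
    linarith
  have h4 : ∀ a b, extD α z (f' a) (f' b) = 0 := fun a b => by
    rw [hx, h3]
    simp only [h2']
    simp
  refine ⟨![e, f' 0, g 0, f' 1, g 1, f' 2, g 2], fun i => ?_, fun i j hi hj => ?_⟩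
  · fin_cases i <;> simp [he, h1, hg]
  · fin_cases i <;> fin_cases j <;> first
      | exact absurd rfl hi
      | exact absurd rfl hj
      | simp [darbouxMatrix, h2, h2', h4, hgg]

/-- The Hilbert form of a Lagrangian in four dimensions has an adapted basis. -/
theorem IsLagrangian.exists_darboux [FiniteDimensional ℝ V] (hV : Module.finrank ℝ V = 4)
    {U : Set (V × V)} {L : V × V → ℝ} (h : IsLagrangian U L) {z : V × V} (hz : z ∈ U) :
    ∃ v : Fin 7 → V × V, (∀ i, hilb (pnorm L) z (v i) = if i = 0 then 1 else 0) ∧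
      ∀ i j, i ≠ 0 → j ≠ 0 → extD (hilb (pnorm L)) z (v i) (v j) = darbouxMatrix i j := by
  have hF := (h.pnorm_pos hz).ne'
  set a : Module.Dual ℝ V :=
    ((fderiv ℝ (pnorm L) z).comp (ContinuousLinearMap.inr ℝ V V)).toLinearMap with ha
  have ha' : ∀ ξ, a ξ = fderiv ℝ (pnorm L) z (0, ξ) := fun ξ => rfl
  have hav : a z.2 = pnorm L z := h.euler_pnorm hz
  have ha0 : a ≠ 0 := fun h0 => hF (by rw [← hav, h0]; rfl)
  -- The fibre Hessian is nondegenerate on the kernel of the fibre derivative.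
  let H : V →ₗ[ℝ] V →ₗ[ℝ] ℝ := LinearMap.mk₂ ℝ
    (fun ξ η => -fderiv ℝ (fderiv ℝ (pnorm L)) z (0, ξ) (0, η))
    (fun ξ ξ' η => by
      have : ((0 : V), ξ + ξ') = (0, ξ) + (0, ξ') := by simp
      rw [this, map_add, add_apply]; ring)
    (fun c ξ η => by
      have : ((0 : V), c • ξ) = c • (0, ξ) := by simp
      rw [this, map_smul, smul_apply]; simp)
    (fun ξ η η' => by
      have : ((0 : V), η + η') = (0, η) + (0, η') := by simp
      rw [this, map_add]; ring)
    (fun c ξ η => by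
      have : ((0 : V), c • η) = c • (0, η) := by simp
      rw [this, map_smul]; simp)
  have hH : ∀ ξ η, H ξ η = -fderiv ℝ (fderiv ℝ (pnorm L)) z (0, ξ) (0, η) := fun ξ η => rfl
  have hsymm : ∀ ξ η, H ξ η = H η ξ := fun ξ η => by
    rw [hH, hH, h.snd_fderiv_pnorm_symm hz]
  have hHv : ∀ ξ, H ξ z.2 = 0 := fun ξ => by
    rw [hH, h.euler_pnorm_snd hz, ← Prod.zero_eq_mk, map_zero, neg_zero]
  let B : LinearMap.BilinForm ℝ (LinearMap.ker a) := H.domRestrict₁₂ (LinearMap.ker a)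
    (LinearMap.ker a)
  have hB : ∀ ξ η, B ξ η = H ξ η := fun ξ η => rfl
  have hker : ∀ ξ : LinearMap.ker a, (∀ η, B ξ η = 0) → ξ = 0 := fun ξ hξ => by
    refine Subtype.ext (h.eq_zero_of_hess hz (LinearMap.mem_ker.1 ξ.2) fun η => ?_)
    have hmem : η - (a η / pnorm L z) • z.2 ∈ LinearMap.ker a := by
      rw [LinearMap.mem_ker, map_sub, map_smul, hav, smul_eq_mul, div_mul_cancel₀ _ hF, sub_self]
    have h1 := hξ ⟨_, hmem⟩
    rw [hB, map_sub, map_smul, hHv, smul_zero, sub_zero, hH, neg_eq_zero] at h1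
    exact h1
  have hnd : B.Nondegenerate :=
    ⟨hker, fun ξ hξ => hker ξ fun η => by rw [hB, hsymm]; exact hξ η⟩
  have hdim : Module.finrank ℝ (LinearMap.ker a) = 3 := by
    have := Module.Dual.finrank_ker_add_one_of_ne_zero (f := a) ha0
    omega
  let b := Module.finBasisOfFinrankEq ℝ (LinearMap.ker a) hdim
  let d := LinearMap.BilinForm.dualBasis B hnd b
  have hdb : ∀ i j, H (d i) (b j) = if i = j then 1 else 0 := fun i j => by
    rw [← hB, LinearMap.BilinForm.apply_dualBasis_left]
    simp only [eq_comm]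
  refine exists_darboux_of_conjugate (hilb (pnorm L)) z ((pnorm L z)⁻¹ • (z.2, 0))
    (fun i => ((d i : V), 0)) (fun i => (0, (b i : V))) ?_ (fun i => (d i).2) (fun i => ?_)
    (fun i j => ?_) fun i j => ?_
  · rw [map_smul, hilb_apply, h.euler_pnorm hz, smul_eq_mul, inv_mul_cancel₀ hF]
  · rw [hilb_apply, ← Prod.zero_eq_mk, map_zero]
  · rw [h.extD_hilb hz, ← Prod.zero_eq_mk, map_zero, map_zero, sub_zero]
  · rw [h.extD_hilb hz, ← Prod.zero_eq_mk, map_zero, zero_sub, ← hdb, hsymm, hH]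

end Darboux

/-! ### The geodesic spray in coordinates -/

section SprayCoord

theorem sum_smul_single (v : E4) : ∑ i, v i • (EuclideanSpace.single i (1 : ℝ) : E4) = v := by
  ext j
  simp [Finset.sum_apply, Pi.single_apply]

theorem sum_mul_single_eq_toLp (a : Fin 4 → ℝ) :
    ∑ i, a i • (EuclideanSpace.single i (1 : ℝ) : E4) = WithLp.toLp 2 a :=
  sum_smul_single (WithLp.toLp 2 a)

theorem sum_smul_zero_single (v : E4) :
    ∑ i, v i • ((0, EuclideanSpace.single i 1) : E4 × E4) = (0, v) := by
  change ∑ i, v i • ContinuousLinearMap.inr ℝ E4 E4 (EuclideanSpace.single i 1) =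
    ContinuousLinearMap.inr ℝ E4 E4 v
  simp only [← map_smul, ← map_sum, sum_smul_single]

theorem sum_smul_single_zero (v : E4) :
    ∑ i, v i • ((EuclideanSpace.single i 1, 0) : E4 × E4) = (v, 0) := by
  change ∑ i, v i • ContinuousLinearMap.inl ℝ E4 E4 (EuclideanSpace.single i 1) =
    ContinuousLinearMap.inl ℝ E4 E4 v
  simp only [← map_smul, ← map_sum, sum_smul_single]

variable {f : E4 × E4 → ℝ} {z : E4 × E4} {U : Set (E4 × E4)}

theorem contDiffAt_dFib (i : Fin 4) (hf : ContDiffAt ℝ ∞ f z) : ContDiffAt ℝ ∞ (dFib i f) z :=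
  (hf.fderiv_right (m := ∞) (by norm_cast)).clm_apply contDiffAt_const

theorem contDiffAt_dBase (i : Fin 4) (hf : ContDiffAt ℝ ∞ f z) : ContDiffAt ℝ ∞ (dBase i f) z :=
  (hf.fderiv_right (m := ∞) (by norm_cast)).clm_apply contDiffAt_const

theorem fderiv_fderiv_apply (hf : ContDiffAt ℝ ∞ f z) (X Y : E4 × E4) :
    fderiv ℝ (fun y => fderiv ℝ f y Y) z X = fderiv ℝ (fderiv ℝ f) z X Y := by
  have hf2 : DifferentiableAt ℝ (fderiv ℝ f) z :=
    (hf.fderiv_right (m := 1) (by norm_cast)).differentiableAt (by simp)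
  rw [(hf2.hasFDerivAt.clm_apply (hasFDerivAt_const Y z)).fderiv]
  simp

theorem dFib_dFib (hf : ContDiffAt ℝ ∞ f z) (i j : Fin 4) : dFib i (dFib j f) z =
    fderiv ℝ (fderiv ℝ f) z (0, EuclideanSpace.single i 1) (0, EuclideanSpace.single j 1) :=
  fderiv_fderiv_apply hf _ _

theorem dBase_dFib (hf : ContDiffAt ℝ ∞ f z) (i j : Fin 4) : dBase i (dFib j f) z =
    fderiv ℝ (fderiv ℝ f) z (EuclideanSpace.single i 1, 0) (0, EuclideanSpace.single j 1) :=
  fderiv_fderiv_apply hf _ _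

/-- Derivatives of a function with a scaling law under `(x, ẋ) ↦ (x, c ẋ)`. -/
theorem fderiv_scale (hU : IsOpen U) {c k : ℝ} (hc : ∀ z ∈ U, (z.1, c • z.2) ∈ U)
    (hf : ∀ z ∈ U, DifferentiableAt ℝ f z) (hk : ∀ z ∈ U, f (z.1, c • z.2) = k * f z) (hz : z ∈ U)
    (X : E4 × E4) : fderiv ℝ f (z.1, c • z.2) (X.1, c • X.2) = k * fderiv ℝ f z X := by
  have h1 : HasFDerivAt (fun y : E4 × E4 => (y.1, c • y.2)) ((ContinuousLinearMap.fst ℝ E4 E4).prod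
      (c • ContinuousLinearMap.snd ℝ E4 E4)) z :=
    hasFDerivAt_fst.prodMk (hasFDerivAt_snd.const_smul c)
  have h3 := ((hf _ (hc z hz)).hasFDerivAt.comp z h1).unique
    (((hf z hz).hasFDerivAt.const_mul k).congr_of_eventuallyEq (by
      filter_upwards [hU.mem_nhds hz] with y hy using hk y hy))
  exact DFunLike.congr_fun h3 X

theorem dFib_scale (hU : IsOpen U) {c k : ℝ} (hc : ∀ z ∈ U, (z.1, c • z.2) ∈ U) (hc0 : c ≠ 0)
    (hf : ∀ z ∈ U, DifferentiableAt ℝ f z) (hk : ∀ z ∈ U, f (z.1, c • z.2) = c * k * f z)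
    (i : Fin 4) (hz : z ∈ U) : dFib i f (z.1, c • z.2) = k * dFib i f z := by
  have h := fderiv_scale hU hc hf hk hz (0, EuclideanSpace.single i 1)
  have e : ((0 : E4), c • (EuclideanSpace.single i 1 : E4)) =
    c • (0, EuclideanSpace.single i 1) := by simp
  rw [e, map_smul, smul_eq_mul, mul_assoc] at h
  exact mul_left_cancel₀ hc0 h

theorem dBase_scale (hU : IsOpen U) {c k : ℝ} (hc : ∀ z ∈ U, (z.1, c • z.2) ∈ U)
    (hf : ∀ z ∈ U, DifferentiableAt ℝ f z) (hk : ∀ z ∈ U, f (z.1, c • z.2) = k * f z)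
    (i : Fin 4) (hz : z ∈ U) : dBase i f (z.1, c • z.2) = k * dBase i f z := by
  have h := fderiv_scale hU hc hf hk hz (EuclideanSpace.single i 1, 0)
  rwa [smul_zero] at h

theorem contDiffAt_det {n : Type*} [Fintype n] [DecidableEq n] {A : E4 × E4 → Matrix n n ℝ}
    (hA : ∀ i j, ContDiffAt ℝ ∞ (fun z => A z i j) z) : ContDiffAt ℝ ∞ (fun z => (A z).det) z := by
  simp only [Matrix.det_apply]
  refine ContDiffAt.sum fun σ _ => ContDiffAt.const_smul _ ?_
  exact contDiffAt_prod fun i _ => hA _ _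

theorem contDiffAt_matrix_inv {n : Type*} [Fintype n] [DecidableEq n] {A : E4 × E4 → Matrix n n ℝ}
    (hA : ∀ i j, ContDiffAt ℝ ∞ (fun z => A z i j) z) (h0 : (A z).det ≠ 0) (i j : n) :
    ContDiffAt ℝ ∞ (fun z => (A z)⁻¹ i j) z := by
  simp only [Matrix.inv_def, Ring.inverse_eq_inv', Matrix.smul_apply, smul_eq_mul,
    Matrix.adjugate_apply]
  refine ((contDiffAt_det hA).inv h0).mul (contDiffAt_det fun k l => ?_)
  by_cases hk : k = j
  · subst hk
    simp only [Matrix.updateRow_self]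
    exact contDiffAt_const
  · simp only [Matrix.updateRow_ne hk]
    exact hA k l

/-- A nondegenerate matrix `g_ij` makes the fibre Hessian of `L` nondegenerate. -/
theorem nondegenerate_of_det {M : Type*} [TopologicalSpace M] [ChartedSpace E4 M]
    [IsManifold (𝓡 4) ∞ M] {L : TanB M → ℝ} {e : OpenPartialHomeomorph M E4}
    (hf : ContDiffAt ℝ ∞ (L ∘ natPoint e) z) (h0 : (fundMatrix L e z).det ≠ 0) (η : E4)
    (hη : ∀ η', fderiv ℝ (fderiv ℝ (L ∘ natPoint e)) z (0, η) (0, η') = 0) : η = 0 := by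
  have h1 : (fun i => η i) = 0 := by
    refine Matrix.eq_zero_of_vecMul_eq_zero h0 ?_
    funext j
    have h2 := hη (EuclideanSpace.single j 1)
    rw [← sum_smul_zero_single η, map_sum, sum_apply] at h2
    simp only [map_smul, smul_apply, smul_eq_mul] at h2
    simp only [Matrix.vecMul, dotProduct, fundMatrix, Matrix.of_apply, dFib_dFib hf, Pi.zero_apply]
    rw [← mul_zero (1 / 2 : ℝ), ← h2, Finset.mul_sum]
    exact Finset.sum_congr rfl fun i _ => by ring
  ext i
  exact congrFun h1 i

namespace FinslerSpacetime

variable {M : Type*} [TopologicalSpace M] [ChartedSpace E4 M]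
  [IsManifold (𝓡 4) ∞ M] (S : FinslerSpacetime M) {e : OpenPartialHomeomorph M E4}

/-- The vector `(G^i)` of geodesic coefficients. -/
def sprayVec (e : OpenPartialHomeomorph M E4) (z : E4 × E4) : E4 :=
  WithLp.toLp 2 fun i => S.spray e i z

variable (h : IsLagrangian U (S.L ∘ natPoint e)) (hdet : ∀ z ∈ U, (fundMatrix S.L e z).det ≠ 0)
include h hdet

theorem contDiffAt_spray (hz : z ∈ U) (i : Fin 4) : ContDiffAt ℝ ∞ (S.spray e i) z := by
  have hL := h.contDiffAt hz
  refine contDiffAt_const.mul (ContDiffAt.sum fun k _ => ContDiffAt.mul ?_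
    ((ContDiffAt.sum fun j _ => ?_).sub (contDiffAt_dBase k hL)))
  · exact contDiffAt_matrix_inv
      (fun a b => contDiffAt_const.mul (contDiffAt_dFib _ (contDiffAt_dFib _ hL))) (hdet z hz) i k
  · exact (contDiffAt_dBase _ (contDiffAt_dFib _ hL)).mul (by fun_prop)

omit hdet in
theorem spray_smul (hz : z ∈ U) {c : ℝ} (hc : 0 < c) (i : Fin 4) :
    S.spray e i (z.1, c • z.2) = c ^ 2 * S.spray e i z := by
  have hU : ∀ z ∈ U, (z.1, c • z.2) ∈ U := fun z hz => h.conic z hz c hc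
  have hL : ∀ z ∈ U, ContDiffAt ℝ ∞ (S.L ∘ natPoint e) z := fun z hz => h.contDiffAt hz
  have hd : ∀ {f : E4 × E4 → ℝ}, (∀ z ∈ U, ContDiffAt ℝ ∞ f z) →
      ∀ z ∈ U, DifferentiableAt ℝ f z := fun hf z hz => (hf z hz).differentiableAt (by simp)
  have h1 : ∀ k, ∀ z ∈ U, dFib k (S.L ∘ natPoint e) (z.1, c • z.2) =
      c * dFib k (S.L ∘ natPoint e) z := fun k z hz =>
    dFib_scale h.isOpen hU hc.ne' (hd hL)
      (fun z hz => by rw [h.homogeneous z hz c hc]; ring) k hz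
  have hL1 : ∀ k, ∀ z ∈ U, ContDiffAt ℝ ∞ (dFib k (S.L ∘ natPoint e)) z :=
    fun k z hz => contDiffAt_dFib k (hL z hz)
  have h2 : ∀ j k, dFib j (dFib k (S.L ∘ natPoint e)) (z.1, c • z.2) =
      dFib j (dFib k (S.L ∘ natPoint e)) z := fun j k => by
    have := dFib_scale (k := 1) h.isOpen hU hc.ne' (hd (hL1 k))
      (fun z hz => by rw [h1 k z hz]; ring) j hz
    rwa [one_mul] at this
  have h3 : ∀ j k, dBase j (dFib k (S.L ∘ natPoint e)) (z.1, c • z.2) =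
      c * dBase j (dFib k (S.L ∘ natPoint e)) z := fun j k =>
    dBase_scale h.isOpen hU (hd (hL1 k)) (h1 k) j hz
  have h4 : ∀ k, dBase k (S.L ∘ natPoint e) (z.1, c • z.2) =
      c ^ 2 * dBase k (S.L ∘ natPoint e) z := fun k =>
    dBase_scale h.isOpen hU (hd hL) (fun z hz => h.homogeneous z hz c hc) k hz
  have h5 : fundMatrix S.L e (z.1, c • z.2) = fundMatrix S.L e z := by
    ext a b
    simp only [fundMatrix, Matrix.of_apply, h2]
  have h6 : ∀ k, ∑ j, c * dBase j (dFib k (S.L ∘ natPoint e)) z * (c * z.2 j) =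
      c ^ 2 * ∑ j, dBase j (dFib k (S.L ∘ natPoint e)) z * z.2 j := fun k => by
    rw [Finset.mul_sum]
    exact Finset.sum_congr rfl fun j _ => by ring
  simp only [spray, h5, h3, h4, PiLp.smul_apply, smul_eq_mul, h6]
  rw [mul_left_comm, Finset.mul_sum _ _ (c ^ 2)]
  congr 1
  exact Finset.sum_congr rfl fun k _ => by ring

/-- Since `G^i` is homogeneous of degree two, `l^i δ_i = F⁻¹ (ẋ^i ∂_i - 2 G^i ∂_{·i})`. -/
theorem reebLocal_eq (hz : z ∈ U) : S.reebLocal e z =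
    (pnorm (S.L ∘ natPoint e) z)⁻¹ • (z.2, (-2 : ℝ) • S.sprayVec e z) := by
  have hF : S.F (natPoint e z) = pnorm (S.L ∘ natPoint e) z := rfl
  have he : ∀ j, ∑ i, z.2 i * S.conn e j i z = 2 * S.spray e j z := fun j => by
    have h1 := euler_of_homogeneous 2
      ((S.contDiffAt_spray h hdet hz j).differentiableAt (by simp))
      fun c hc => S.spray_smul h hz hc j
    rw [← sum_smul_zero_single, map_sum] at h1
    simp only [map_smul, smul_eq_mul] at h1
    exact_mod_cast h1
  set F := pnorm (S.L ∘ natPoint e) z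
  simp only [reebLocal, hF, delta, sum_mul_single_eq_toLp]
  refine Prod.ext ?_ ?_
  · rw [Prod.fst_sum, Prod.smul_fst, ← sum_smul_single z.2, Finset.smul_sum]
    refine Finset.sum_congr rfl fun i _ => ?_
    rw [sum_smul_single, smul_smul, Prod.smul_fst, div_eq_inv_mul]
  · rw [Prod.snd_sum, Prod.smul_snd]
    ext k
    have h2 := he k
    simp only [Prod.smul_snd, smul_neg, Finset.sum_neg_distrib, sprayVec, PiLp.neg_apply,
      PiLp.smul_apply, WithLp.ofLp_sum, Finset.sum_apply, WithLp.ofLp_smul, Pi.smul_apply,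
      smul_eq_mul]
    rw [neg_mul, mul_neg, ← h2, Finset.mul_sum]
    congr 1
    exact Finset.sum_congr rfl fun i _ => by ring

theorem contDiffAt_reebLocal (hz : z ∈ U) : ContDiffAt ℝ ∞ (S.reebLocal e) z := by
  have h1 : ContDiffAt ℝ ∞ (S.sprayVec e) z := by
    rw [contDiffAt_euclidean]
    exact fun i => S.contDiffAt_spray h hdet hz i
  have h2 : ContDiffAt ℝ ∞
      (fun z => (pnorm (S.L ∘ natPoint e) z)⁻¹ • (z.2, (-2 : ℝ) • S.sprayVec e z)) z :=
    ((h.contDiffAt_pnorm hz).inv (h.pnorm_pos hz).ne').smul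
      (contDiffAt_snd.prodMk (h1.const_smul (-2 : ℝ)))
  refine h2.congr_of_eventuallyEq ?_
  filter_upwards [h.isOpen.mem_nhds hz] with y hy using S.reebLocal_eq h hdet hy

/-- The defining equation of the geodesic coefficients, without inverse matrix. -/
theorem hess_sprayVec (hz : z ∈ U) (ξ : E4) :
    2 * fderiv ℝ (fderiv ℝ (S.L ∘ natPoint e)) z (0, S.sprayVec e z) (0, ξ) =
      fderiv ℝ (fderiv ℝ (S.L ∘ natPoint e)) z (z.2, 0) (0, ξ) -
        fderiv ℝ (S.L ∘ natPoint e) z (ξ, 0) := by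
  have hL := h.contDiffAt hz
  have key : ∀ k, 2 * fderiv ℝ (fderiv ℝ (S.L ∘ natPoint e)) z (0, S.sprayVec e z)
      (0, EuclideanSpace.single k 1) =
      fderiv ℝ (fderiv ℝ (S.L ∘ natPoint e)) z (z.2, 0) (0, EuclideanSpace.single k 1) -
        fderiv ℝ (S.L ∘ natPoint e) z (EuclideanSpace.single k 1, 0) := fun k => by
    set w : Fin 4 → ℝ := fun m => (∑ j, dBase j (dFib m (S.L ∘ natPoint e)) z * z.2 j) -
      dBase m (S.L ∘ natPoint e) z with hw
    have hG : ∀ i, S.spray e i z = (1 / 4) * ((fundMatrix S.L e z)⁻¹).mulVec w i := fun i => rfl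
    have h1 : ∑ i, fundMatrix S.L e z k i * S.spray e i z = (1 / 4) * w k := by
      have h2 : (fundMatrix S.L e z).mulVec (((fundMatrix S.L e z)⁻¹).mulVec w) = w := by
        rw [Matrix.mulVec_mulVec, Matrix.mul_nonsing_inv _ (hdet z hz).isUnit, Matrix.one_mulVec]
      conv_rhs => rw [← h2]
      simp only [hG]
      rw [Matrix.mulVec, dotProduct, Finset.mul_sum]
      exact Finset.sum_congr rfl fun i _ => by ring
    simp only [fundMatrix, Matrix.of_apply, dFib_dFib hL, hw, dBase_dFib hL] at h1
    rw [h.snd_fderiv_symm hz, ← sum_smul_zero_single (S.sprayVec e z),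
      ← sum_smul_single_zero z.2, map_sum, map_sum, sum_apply]
    simp only [map_smul, smul_apply, smul_eq_mul]
    have h3 : ∑ i, S.sprayVec e z i * fderiv ℝ (fderiv ℝ (S.L ∘ natPoint e)) z
        (0, EuclideanSpace.single k 1) (0, EuclideanSpace.single i 1) =
        2 * ∑ i, 1 / 2 * fderiv ℝ (fderiv ℝ (S.L ∘ natPoint e)) z
        (0, EuclideanSpace.single k 1) (0, EuclideanSpace.single i 1) * S.spray e i z := by
      rw [Finset.mul_sum]
      exact Finset.sum_congr rfl fun i _ => by simp only [sprayVec]; ring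
    rw [h3, h1]
    have h4 : ∀ i, fderiv ℝ (fderiv ℝ (S.L ∘ natPoint e)) z (EuclideanSpace.single i 1, 0)
        (0, EuclideanSpace.single k 1) * z.2 i = z.2 i * fderiv ℝ (fderiv ℝ (S.L ∘ natPoint e)) z
        (EuclideanSpace.single i 1, 0) (0, EuclideanSpace.single k 1) := fun i => mul_comm _ _
    simp only [h4, dBase]
    ring
  rw [← sum_smul_zero_single ξ, ← sum_smul_single_zero ξ]
  simp only [map_sum, map_smul, smul_eq_mul]
  rw [Finset.mul_sum, ← Finset.sum_sub_distrib]
  refine Finset.sum_congr rfl fun k _ => ?_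
  rw [← mul_sub, ← key]
  ring

/-- The local expression `l^i δ_i` is the normalized geodesic spray. -/
theorem isSprayDir_reebLocal (hz : z ∈ U) :
    IsSprayDir (S.L ∘ natPoint e) z (S.reebLocal e z) := by
  intro Y
  have h1 := S.hess_sprayVec h hdet hz Y.1
  have h2 := h.euler_snd hz Y
  have h3 : fderiv ℝ (S.L ∘ natPoint e) z Y =
      fderiv ℝ (S.L ∘ natPoint e) z (Y.1, 0) + fderiv ℝ (S.L ∘ natPoint e) z (0, Y.2) := by
    rw [← map_add]; simp
  rw [S.reebLocal_eq h hdet hz, extD_smul_left, h.extD_hilb_self hz]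
  have e1 : (z.2, (-2 : ℝ) • S.sprayVec e z) = (z.2, 0) + (-2 : ℝ) • (0, S.sprayVec e z) := by simp
  rw [e1, map_add, map_smul, add_apply, smul_apply, smul_eq_mul, ← e1]
  change _ * (_ - fderiv ℝ (fderiv ℝ (S.L ∘ natPoint e)) z Y (0, z.2)) = _
  rw [h2, div_eq_inv_mul]
  linear_combination (pnorm (S.L ∘ natPoint e) z)⁻¹ * (-h1 - h3)

end FinslerSpacetime

end SprayCoord

/-! ### Induced coordinates on the tangent bundle -/

section Coordinates

variable {M : Type*} [TopologicalSpace M] [ChartedSpace E4 M] [IsManifold (𝓡 4) ∞ M]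
  {e : OpenPartialHomeomorph M E4}

theorem mdifferentiable_of_mem_maximalAtlas (he : e ∈ IsManifold.maximalAtlas (𝓡 4) ∞ M) :
    e.MDifferentiable (𝓡 4) 𝓘(ℝ, E4) :=
  ⟨(contMDiffOn_of_mem_maximalAtlas he).mdifferentiableOn (by simp),
    (contMDiffOn_symm_of_mem_maximalAtlas he).mdifferentiableOn (by simp)⟩

theorem chartAt_mem (x₀ : M) : chartAt E4 x₀ ∈ IsManifold.maximalAtlas (𝓡 4) ∞ M :=
  IsManifold.chart_mem_maximalAtlas x₀

theorem natPoint_natCoord (he : e ∈ IsManifold.maximalAtlas (𝓡 4) ∞ M) {q : TanB M}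
    (hq : q.1 ∈ e.source) : natPoint e (natCoord e q) = q := by
  have h := (mdifferentiable_of_mem_maximalAtlas he).symm_comp_deriv hq
  have h1 : mfderiv 𝓘(ℝ, E4) (𝓡 4) e.symm (e q.1) (mfderiv (𝓡 4) 𝓘(ℝ, E4) e q.1 q.2) = q.2 :=
    DFunLike.congr_fun h q.2
  obtain ⟨x, v⟩ := q
  simp only [natPoint, natCoord] at h1 ⊢
  rw [Bundle.TotalSpace.mk.injEq]
  exact ⟨e.left_inv hq, heq_of_eq h1⟩

theorem natCoord_natPoint (he : e ∈ IsManifold.maximalAtlas (𝓡 4) ∞ M) {z : E4 × E4}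
    (hz : z.1 ∈ e.target) : natCoord e (natPoint e z) = z := by
  have h := (mdifferentiable_of_mem_maximalAtlas he).comp_symm_deriv hz
  refine Prod.ext (e.right_inv hz) ?_
  exact DFunLike.congr_fun h z.2

theorem tanChart_eq_natCoord (x₀ : M) {q : TanB M} (hq : q.1 ∈ (chartAt E4 x₀).source) :
    tanChart x₀ q = natCoord (chartAt E4 x₀) q := by
  have h := tangentMap_chart (I := 𝓡 4) (p := (⟨x₀, 0⟩ : TanB M)) (q := q) hq
  have h' := congrArg (Bundle.TotalSpace.toProd E4 E4) h
  rw [Equiv.apply_symm_apply] at h'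
  exact h'.symm

theorem tanChart_symm_eq_natPoint (x₀ : M) {z : E4 × E4} (hz : z.1 ∈ (chartAt E4 x₀).target) :
    (tanChart x₀).symm z = natPoint (chartAt E4 x₀) z :=
  (tangentMap_chart_symm (I := 𝓡 4) (p := (⟨x₀, 0⟩ : TanB M))
    (q := (⟨z.1, z.2⟩ : TangentBundle (𝓡 4) E4)) hz).symm

theorem contMDiffOn_natPoint (he : e ∈ IsManifold.maximalAtlas (𝓡 4) ∞ M) :
    ContMDiffOn 𝓘(ℝ, E4 × E4) (𝓡 4).tangent ∞ (natPoint e) {z | z.1 ∈ e.target} := by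
  have h1 := (contMDiffOn_symm_of_mem_maximalAtlas he).contMDiffOn_tangentMapWithin
    (m := ∞) (by norm_cast) e.open_target.uniqueMDiffOn
  have h2 := contMDiff_tangentBundleModelSpaceHomeomorph_symm (I := 𝓡 4) (n := ∞)
  have h3 : ContMDiff 𝓘(ℝ, E4 × E4) (𝓡 4).tangent ∞
      (fun z : E4 × E4 => (⟨z.1, z.2⟩ : TangentBundle (𝓡 4) E4)) := by
    rw [modelWithCornersSelf_prod]
    exact h2
  refine (h1.comp h3.contMDiffOn fun z hz => hz).congr fun z hz => ?_
  change natPoint e z = tangentMapWithin (𝓡 4) (𝓡 4) e.symm e.target ⟨z.1, z.2⟩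
  rw [tangentMapWithin_eq_tangentMap (e.open_target.uniqueMDiffOn _ hz)
    ((mdifferentiable_of_mem_maximalAtlas he).mdifferentiableAt_symm hz)]
  rfl

theorem contMDiffOn_natCoord (he : e ∈ IsManifold.maximalAtlas (𝓡 4) ∞ M) :
    ContMDiffOn (𝓡 4).tangent 𝓘(ℝ, E4 × E4) ∞ (natCoord e) {q | q.1 ∈ e.source} := by
  have h1 := (contMDiffOn_of_mem_maximalAtlas he).contMDiffOn_tangentMapWithin
    (m := ∞) (by norm_cast) e.open_source.uniqueMDiffOn
  have h2 := contMDiff_tangentBundleModelSpaceHomeomorph (I := 𝓡 4) (n := ∞)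
  have h3 : ContMDiff (𝓡 4).tangent 𝓘(ℝ, E4 × E4) ∞
      (fun q : TangentBundle (𝓡 4) E4 => ((q.1, q.2) : E4 × E4)) := by
    rw [modelWithCornersSelf_prod]
    exact h2
  refine (h3.comp_contMDiffOn h1).congr fun q hq => ?_
  have h4 : tangentMapWithin (𝓡 4) (𝓡 4) e e.source q = tangentMap (𝓡 4) (𝓡 4) e q :=
    tangentMapWithin_eq_tangentMap (e.open_source.uniqueMDiffOn _ hq)
      ((mdifferentiable_of_mem_maximalAtlas he).mdifferentiableAt hq)
  rw [Function.comp_apply, h4]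
  rfl

theorem isOpen_fst_mem_source : IsOpen {q : TanB M | q.1 ∈ e.source} :=
  e.open_source.preimage (FiberBundle.continuous_proj E4 (TangentSpace (𝓡 4) : M → Type _))

theorem isOpen_fst_mem_target : IsOpen {z : E4 × E4 | z.1 ∈ e.target} :=
  e.open_target.preimage continuous_fst

theorem contMDiffAt_natCoord (he : e ∈ IsManifold.maximalAtlas (𝓡 4) ∞ M) {q : TanB M}
    (hq : q.1 ∈ e.source) : ContMDiffAt (𝓡 4).tangent 𝓘(ℝ, E4 × E4) ∞ (natCoord e) q :=
  (contMDiffOn_natCoord he).contMDiffAt (isOpen_fst_mem_source.mem_nhds hq)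

theorem contMDiffAt_natPoint (he : e ∈ IsManifold.maximalAtlas (𝓡 4) ∞ M) {z : E4 × E4}
    (hz : z.1 ∈ e.target) : ContMDiffAt 𝓘(ℝ, E4 × E4) (𝓡 4).tangent ∞ (natPoint e) z :=
  (contMDiffOn_natPoint he).contMDiffAt (isOpen_fst_mem_target.mem_nhds hz)

theorem natPoint_smul (z : E4 × E4) (c : ℝ) :
    natPoint e (z.1, c • z.2) = (⟨(natPoint e z).1, c • (natPoint e z).2⟩ : TanB M) := by
  simp only [natPoint]
  exact congrArg (Bundle.TotalSpace.mk _)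
    (map_smul (mfderiv 𝓘(ℝ, E4) (𝓡 4) e.symm z.1) c z.2)

namespace FinslerSpacetime

variable (S : FinslerSpacetime M)

theorem isOpen_A₀ : IsOpen S.A₀ := by
  have h := S.smooth.continuousOn.isOpen_inter_preimage S.conic_A.isOpen
    (isOpen_compl_singleton (x := (0 : ℝ)))
  exact h

theorem smul_mem_A₀ {q : TanB M} (hq : q ∈ S.A₀) {c : ℝ} (hc : 0 < c) :
    (⟨q.1, c • q.2⟩ : TanB M) ∈ S.A₀ := by
  refine ⟨S.conic_A.conic q hq.1 c hc, ?_⟩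
  rw [S.homogeneous q hq.1 c hc]
  exact mul_ne_zero (pow_ne_zero _ hc.ne') hq.2

/-- The coordinate expression of `𝒜₀`. -/
def coordDom (e : OpenPartialHomeomorph M E4) : Set (E4 × E4) :=
  {z | z.1 ∈ e.target ∧ natPoint e z ∈ S.A₀}

theorem det_ne_zero (he : e ∈ IsManifold.maximalAtlas (𝓡 4) ∞ M) :
    ∀ z ∈ S.coordDom e, (fundMatrix S.L e z).det ≠ 0 := fun z hz => by
  have := S.nondegenerate _ hz.2.1 e he (e.map_target hz.1)
  rwa [natCoord_natPoint he hz.1] at this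

theorem isLagrangian (he : e ∈ IsManifold.maximalAtlas (𝓡 4) ∞ M) :
    IsLagrangian (S.coordDom e) (S.L ∘ natPoint e) := by
  have hopen : IsOpen (S.coordDom e) :=
    (contMDiffOn_natPoint he).continuousOn.isOpen_inter_preimage isOpen_fst_mem_target S.isOpen_A₀
  have hsmooth : ContDiffOn ℝ ∞ (S.L ∘ natPoint e) (S.coordDom e) := by
    rw [← contMDiffOn_iff_contDiffOn]
    exact S.smooth.comp ((contMDiffOn_natPoint he).mono fun z hz => hz.1) fun z hz => hz.2.1
  refine ⟨hopen, fun z hz c hc => ⟨hz.1, ?_⟩, hsmooth, fun z hz c hc => ?_, fun z hz => hz.2.2,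
    fun z hz => nondegenerate_of_det (hsmooth.contDiffAt (hopen.mem_nhds hz))
      (S.det_ne_zero he z hz)⟩
  · rw [natPoint_smul]
    exact S.smul_mem_A₀ hz.2 hc
  · simp only [Function.comp_apply, natPoint_smul]
    exact S.homogeneous _ hz.2.1 c hc

theorem natCoord_mem (he : e ∈ IsManifold.maximalAtlas (𝓡 4) ∞ M) {q : TanB M} (hq : q ∈ S.A₀)
    (hqe : q.1 ∈ e.source) : natCoord e q ∈ S.coordDom e :=
  ⟨e.map_source hqe, by rwa [natPoint_natCoord he hqe]⟩

theorem F_natPoint (z : E4 × E4) : S.F (natPoint e z) = pnorm (S.L ∘ natPoint e) z := rfl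

theorem pnorm_natCoord (he : e ∈ IsManifold.maximalAtlas (𝓡 4) ∞ M) {q : TanB M}
    (hq : q.1 ∈ e.source) : pnorm (S.L ∘ natPoint e) (natCoord e q) = S.F q := by
  rw [← F_natPoint, natPoint_natCoord he hq]

/-- The fibre derivative `F_{·i}` of the pseudo-norm at a tangent vector. -/
def fibDeriv (q : TanB M) : E4 →L[ℝ] ℝ := fderiv ℝ (fun w : E4 => S.F ⟨q.1, w⟩) (q.2 : E4)

theorem fibDeriv_apply (he : e ∈ IsManifold.maximalAtlas (𝓡 4) ∞ M) {q : TanB M} (hq : q ∈ S.A₀)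
    (hqe : q.1 ∈ e.source) (w : E4) : S.fibDeriv q w =
      fderiv ℝ (pnorm (S.L ∘ natPoint e)) (natCoord e q) (0, mfderiv (𝓡 4) 𝓘(ℝ, E4) e q.1 w) := by
  let D : E4 →L[ℝ] E4 := mfderiv (𝓡 4) 𝓘(ℝ, E4) e q.1
  have hF : (fun w : E4 => S.F ⟨q.1, w⟩) =
      fun w : E4 => pnorm (S.L ∘ natPoint e) (e q.1, D w) := by
    funext w
    exact (S.pnorm_natCoord he (q := ⟨q.1, w⟩) hqe).symm
  have hd := ((S.isLagrangian he).differentiableAt_pnorm (S.natCoord_mem he hq hqe)).hasFDerivAt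
  have h1 : HasFDerivAt (fun w : E4 => (e q.1, D w)) ((0 : E4 →L[ℝ] E4).prod D) q.2 :=
    (hasFDerivAt_const (e q.1) _).prodMk D.hasFDerivAt
  have h2 : HasFDerivAt (fun w : E4 => pnorm (S.L ∘ natPoint e) (e q.1, D w)) _ q.2 :=
    HasFDerivAt.comp (q.2 : E4) (f := fun w : E4 => (e q.1, D w)) hd h1
  have h3 := h2.fderiv
  rw [← hF] at h3
  exact DFunLike.congr_fun h3 w

end FinslerSpacetime

end Coordinates

/-! ### The slit tangent bundle and its projectivization in coordinates -/

section Projection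

variable {M : Type*} [TopologicalSpace M] [ChartedSpace E4 M] [IsManifold (𝓡 4) ∞ M]
  {e : OpenPartialHomeomorph M E4}

theorem contMDiffAt_natCoord_slit (he : e ∈ IsManifold.maximalAtlas (𝓡 4) ∞ M) {q : slit M}
    (hq : (q : TanB M).1 ∈ e.source) :
    ContMDiffAt (𝓡 4).tangent 𝓘(ℝ, E4 × E4) ∞ (fun p : slit M => natCoord e p) q :=
  ContMDiffAt.comp (g := natCoord e) (f := fun p : slit M => (p : TanB M)) q
    (contMDiffAt_natCoord he hq) contMDiff_subtype_val.contMDiffAt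

/-- The derivative of the induced coordinates at a nonzero tangent vector. -/
def dNatCoord (e : OpenPartialHomeomorph M E4) (q : slit M) :
    TangentSpace (𝓡 4).tangent q →L[ℝ] E4 × E4 :=
  mfderiv (𝓡 4).tangent 𝓘(ℝ, E4 × E4) (fun p : slit M => natCoord e p) q

theorem isOpen_slit_source : IsOpen {q : slit M | (q : TanB M).1 ∈ e.source} :=
  isOpen_fst_mem_source.preimage continuous_subtype_val

/-- In the preferred coordinates at `q`, tangent vectors at `q` are identified with their
components. -/
theorem dNatCoord_chartAt (q : slit M) (X : TangentSpace (𝓡 4).tangent q) :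
    dNatCoord (chartAt E4 (q : TanB M).1) q X = X := by
  have h1 : (fun p : slit M => natCoord (chartAt E4 (q : TanB M).1) p) =ᶠ[𝓝 q]
      extChartAt (𝓡 4).tangent q := by
    filter_upwards [isOpen_slit_source.mem_nhds (mem_chart_source E4 (q : TanB M).1)] with p hp
    exact (tanChart_eq_natCoord _ hp).symm
  have h2 := h1.mfderiv_eq (I := (𝓡 4).tangent) (I' := 𝓘(ℝ, E4 × E4))
  have h3 := mfderiv_extChartAt_self (I := (𝓡 4).tangent) (x := q)
  rw [dNatCoord, h2]
  exact DFunLike.congr_fun h3 X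

/-- Change of coordinates for the derivative of the induced coordinates. -/
theorem dNatCoord_eq_fderiv_comp {e' : OpenPartialHomeomorph M E4}
    (he : e ∈ IsManifold.maximalAtlas (𝓡 4) ∞ M) (he' : e' ∈ IsManifold.maximalAtlas (𝓡 4) ∞ M)
    {q : slit M} (hq : (q : TanB M).1 ∈ e.source) (hq' : (q : TanB M).1 ∈ e'.source)
    (X : TangentSpace (𝓡 4).tangent q) : dNatCoord e' q X =
      fderiv ℝ (natCoord e' ∘ natPoint e) (natCoord e q) (dNatCoord e q X) := by
  have h1 : (fun p : slit M => natCoord e' p) =ᶠ[𝓝 q]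
      (natCoord e' ∘ natPoint e) ∘ fun p : slit M => natCoord e p := by
    filter_upwards [isOpen_slit_source.mem_nhds hq] with p hp
    simp only [Function.comp_apply, natPoint_natCoord he hp]
  have hq'' : (natPoint e (natCoord e (q : TanB M))).1 ∈ e'.source := by
    rwa [natPoint_natCoord he hq]
  have h2 : ContMDiffAt 𝓘(ℝ, E4 × E4) 𝓘(ℝ, E4 × E4) ∞ (natCoord e' ∘ natPoint e)
      (natCoord e (q : TanB M)) :=
    ContMDiffAt.comp _ (contMDiffAt_natCoord he' hq'')
      (contMDiffAt_natPoint he (z := natCoord e (q : TanB M)) (e.map_source hq))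
  have h3 := mfderiv_comp (f := fun p : slit M => natCoord e p) q
    (h2.mdifferentiableAt (by simp)) ((contMDiffAt_natCoord_slit he hq).mdifferentiableAt (by simp))
  rw [dNatCoord, h1.mfderiv_eq (I := (𝓡 4).tangent) (I' := 𝓘(ℝ, E4 × E4)), h3, ← mfderiv_eq_fderiv]
  rfl

theorem dNatCoord_surjective (he : e ∈ IsManifold.maximalAtlas (𝓡 4) ∞ M) {q : slit M}
    (hq : (q : TanB M).1 ∈ e.source) : Function.Surjective (dNatCoord e q) := by
  have hx := mem_chart_source E4 (q : TanB M).1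
  have hinj : Function.Injective (dNatCoord e q) := fun X Y hXY => by
    have h1 := dNatCoord_eq_fderiv_comp he (chartAt_mem (q : TanB M).1) hq hx
    rw [← dNatCoord_chartAt q X, ← dNatCoord_chartAt q Y, h1, h1, hXY]
  let T : E4 × E4 →L[ℝ] E4 × E4 := dNatCoord e q
  exact LinearMap.surjective_of_injective (f := (T : E4 × E4 →ₗ[ℝ] E4 × E4)) hinj

end Projection

/-! ### The projection onto oriented directions -/

section Projectivization

variable {M : Type*} [TopologicalSpace M] [ChartedSpace E4 M] [IsManifold (𝓡 4) ∞ M]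

theorem chartAt_eq_ptmChart (p : PTM M) : ∃ (x₀ : M) (i : Fin 4) (s : ℝ) (hs : s * s = 1),
    chartAt (E4 × E3) p = ptmChart x₀ i s hs :=
  chart_mem_atlas (E4 × E3) p

/-- The map `(x, v) ↦ (x, v^a / v^i)`, which is the coordinate expression of `π⁺`. -/
def affProj (i : Fin 4) (z : E4 × E4) : E4 × E3 := (z.1, affCoord i z.2)

/-- The section of `affProj` that corresponds to the normalization `v^i = s`. -/
def affSection (i : Fin 4) (s : ℝ) (y : E4 × E3) : E4 × E4 := (y.1, affLift i s y.2)

theorem contDiffAt_affProj {i : Fin 4} {z : E4 × E4} (hz : z.2 i ≠ 0) :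
    ContDiffAt ℝ ∞ (affProj i) z := by
  have ho : IsOpen {w : E4 | w i ≠ 0} := isOpen_ne_fun (by fun_prop) continuous_const
  exact contDiffAt_fst.prodMk
    (((contDiffOn_affCoord i).contDiffAt (ho.mem_nhds hz)).comp z contDiffAt_snd)

theorem contDiff_affSection (i : Fin 4) (s : ℝ) : ContDiff ℝ ∞ (affSection i s) :=
  contDiff_fst.prodMk ((contDiff_affLift i s).comp contDiff_snd)

theorem affSection_affProj {i : Fin 4} {s : ℝ} {z : E4 × E4} (hz : 0 < s * z.2 i) :
    affSection i s (affProj i z) = (z.1, (s * (z.2 i)⁻¹) • z.2) :=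
  Prod.ext rfl (affLift_affCoord i hz)

theorem affProj_affSection (i : Fin 4) {s : ℝ} (hs : s ≠ 0) (y : E4 × E3) :
    affProj i (affSection i s y) = y :=
  Prod.ext rfl (affCoord_affLift i hs y.2)

theorem scale_pos {s a : ℝ} (h : 0 < s * a) : 0 < s * a⁻¹ := by
  have ha : a ≠ 0 := right_ne_zero_of_mul h.ne'
  have : s * a⁻¹ = s * a * (a⁻¹) ^ 2 := by field_simp
  rw [this]
  positivity

theorem fderiv_affProj_fst {i : Fin 4} {z : E4 × E4} (hz : z.2 i ≠ 0) (X : E4 × E4) :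
    (fderiv ℝ (affProj i) z X).1 = X.1 := by
  have h := ((contDiffAt_affProj hz).differentiableAt (by simp)).hasFDerivAt.fst
  exact DFunLike.congr_fun (h.unique hasFDerivAt_fst) X

theorem fderiv_affSection_fst (i : Fin 4) (s : ℝ) (y Y : E4 × E3) :
    (fderiv ℝ (affSection i s) y Y).1 = Y.1 := by
  have h := (((contDiff_affSection i s).contDiffAt (x := y)).differentiableAt
    (by simp)).hasFDerivAt.fst
  exact DFunLike.congr_fun (h.unique hasFDerivAt_fst) Y

/-- The Liouville direction is vertical for `π⁺`. -/
theorem fderiv_affProj_liouville {i : Fin 4} {z : E4 × E4} (hz : z.2 i ≠ 0) :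
    fderiv ℝ (affProj i) z (0, z.2) = 0 := by
  have h1 : HasDerivAt (fun c : ℝ => ((z.1, c • z.2) : E4 × E4)) (0, z.2) 1 := by
    have := (hasDerivAt_const (1 : ℝ) z.1).prodMk ((hasDerivAt_id (1 : ℝ)).smul_const z.2)
    simpa using this
  have hz' : z = (z.1, (1 : ℝ) • z.2) := by simp
  have hf' : HasFDerivAt (affProj i) (fderiv ℝ (affProj i) z) (z.1, (1 : ℝ) • z.2) := by
    rw [← hz']; exact ((contDiffAt_affProj hz).differentiableAt (by simp)).hasFDerivAt
  have h2 := hf'.comp_hasDerivAt (1 : ℝ) h1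
  refine h2.unique ((hasDerivAt_const (1 : ℝ) (affProj i z)).congr_of_eventuallyEq ?_)
  filter_upwards [lt_mem_nhds (zero_lt_one (α := ℝ))] with c hc
  exact Prod.ext rfl (affCoord_smul i (ne_of_gt hc) z.2)

theorem fderiv_affProj_surjective {i : Fin 4} {s : ℝ} {z : E4 × E4} (hz : 0 < s * z.2 i) :
    Function.Surjective (fderiv ℝ (affProj i) z) := by
  have hi : z.2 i ≠ 0 := right_ne_zero_of_mul hz.ne'
  have hs : z.2 i * (z.2 i)⁻¹ = 1 := mul_inv_cancel₀ hi
  have hz' : affSection i (z.2 i) (affProj i z) = z := by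
    have h0 : 0 < z.2 i * z.2 i := mul_self_pos.2 hi
    rw [affSection_affProj h0, hs, one_smul]
  have h1 : HasFDerivAt (affProj i) (fderiv ℝ (affProj i) z)
      (affSection i (z.2 i) (affProj i z)) := by
    rw [hz']; exact ((contDiffAt_affProj hi).differentiableAt (by simp)).hasFDerivAt
  have h2 := h1.comp (affProj i z) (((contDiff_affSection i (z.2 i)).contDiffAt
    (x := affProj i z)).differentiableAt (by simp)).hasFDerivAt
  have h3 := h2.unique ((hasFDerivAt_id (affProj i z)).congr_of_eventuallyEq
    (Eventually.of_forall fun y => affProj_affSection i hi y))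
  intro Y
  exact ⟨_, DFunLike.congr_fun h3 Y⟩

/-- A vector of each ray. -/
def rep (p : PTM M) : slit M := Function.surjInv isOpenQuotientMap_toPTM.surjective p

theorem toPTM_rep (p : PTM M) : toPTM (rep p) = p :=
  Function.surjInv_eq isOpenQuotientMap_toPTM.surjective p

/-- The projection of `PTM⁺` onto `M`. -/
def ptmProj : PTM M → M :=
  Quotient.lift (s := raySetoid M) (fun q => q.1.1) (by rintro p q ⟨c, -, h⟩; rw [h])

section Chart

variable {x₀ : M} {i : Fin 4} {s : ℝ} {q : slit M}

theorem natCoord_pos (hq : q ∈ ptmDomain x₀ i s) :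
    0 < s * (natCoord (chartAt E4 x₀) q).2 i := by
  rw [← tanChart_eq_natCoord x₀ hq.1]
  exact hq.2

theorem ptmCoord_toPTM' (hq : (q : TanB M).1 ∈ (chartAt E4 x₀).source) :
    ptmCoord x₀ i (toPTM q) = affProj i (natCoord (chartAt E4 x₀) q) := by
  rw [ptmCoord_toPTM, tanChart_eq_natCoord x₀ hq]
  rfl

theorem mem_ptmDomain_of_chartAt {p : PTM M} {hs : s * s = 1}
    (hc : chartAt (E4 × E3) p = ptmChart x₀ i s hs)
    (hq : toPTM q ∈ (chartAt (E4 × E3) p).source) : q ∈ ptmDomain x₀ i s := by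
  rw [hc] at hq
  exact ptmDomain_saturated x₀ i s hq

theorem extChartAt_eq_ptmCoord {p : PTM M} {hs : s * s = 1}
    (hc : chartAt (E4 × E3) p = ptmChart x₀ i s hs) :
    (extChartAt 𝓘(ℝ, E4 × E3) p : PTM M → E4 × E3) = ptmCoord x₀ i := by
  have : (extChartAt 𝓘(ℝ, E4 × E3) p : PTM M → E4 × E3) = chartAt (E4 × E3) p := by
    simp [mfld_simps]
  rw [this, hc]
  rfl

theorem extChartAt_symm_eq_ptmCoordSymm {p : PTM M} {hs : s * s = 1}
    (hc : chartAt (E4 × E3) p = ptmChart x₀ i s hs) :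
    ((extChartAt 𝓘(ℝ, E4 × E3) p).symm : E4 × E3 → PTM M) = ptmCoordSymm x₀ i s := by
  have : ((extChartAt 𝓘(ℝ, E4 × E3) p).symm : E4 × E3 → PTM M) = (chartAt (E4 × E3) p).symm := by
    simp [mfld_simps]
  rw [this, hc]
  rfl

theorem natPoint_affSection_ne_zero (hs : s * s = 1) {y : E4 × E3}
    (hy : y.1 ∈ (chartAt E4 x₀).target) :
    (natPoint (chartAt E4 x₀) (affSection i s y)).2 ≠ 0 := by
  have hs0 : s ≠ 0 := by rintro rfl; simp at hs
  have h := tanChart_symm_ne_zero x₀ (z := affSection i s y) hy (affLift_ne_zero i hs0 _)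
  rwa [tanChart_symm_eq_natPoint x₀ (z := affSection i s y) hy] at h

theorem ptmCoordSymm_eq_toPTM (hs : s * s = 1) {y : E4 × E3}
    (hy : y.1 ∈ (chartAt E4 x₀).target) :
    ptmCoordSymm x₀ i s y = toPTM ⟨natPoint (chartAt E4 x₀) (affSection i s y),
      natPoint_affSection_ne_zero hs hy⟩ := by
  have h := natPoint_affSection_ne_zero (i := i) hs hy
  rw [← tanChart_symm_eq_natPoint x₀ (z := affSection i s y) hy] at h
  rw [ptmCoordSymm_eq x₀ i s h]
  congr 2
  exact tanChart_symm_eq_natPoint x₀ (z := affSection i s y) hy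

theorem contMDiffAt_toPTM (q : slit M) :
    ContMDiffAt (𝓡 4).tangent 𝓘(ℝ, E4 × E3) ∞ (toPTM (M := M)) q := by
  obtain ⟨x₀, i, s, hs, hc⟩ := chartAt_eq_ptmChart (toPTM q)
  have hq := mem_ptmDomain_of_chartAt hc (mem_chart_source _ _)
  rw [contMDiffAt_iff_target, extChartAt_eq_ptmCoord hc]
  refine ⟨isOpenQuotientMap_toPTM.continuous.continuousAt, ?_⟩
  have h1 : ContMDiffAt 𝓘(ℝ, E4 × E4) 𝓘(ℝ, E4 × E3) ∞ (affProj i)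
      (natCoord (chartAt E4 x₀) (q : TanB M)) :=
    (contDiffAt_affProj (right_ne_zero_of_mul (natCoord_pos hq).ne')).contMDiffAt
  refine (ContMDiffAt.comp (f := fun p : slit M => natCoord (chartAt E4 x₀) p) q h1
    (contMDiffAt_natCoord_slit (chartAt_mem x₀) hq.1)).congr_of_eventuallyEq ?_
  filter_upwards [isOpen_slit_source.mem_nhds hq.1] with p hp
  exact ptmCoord_toPTM' hp

/-- The derivative of `π⁺` in coordinates. -/
theorem mfderiv_extChartAt_toPTM {p : PTM M} {hs : s * s = 1}
    (hc : chartAt (E4 × E3) p = ptmChart x₀ i s hs)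
    (hq : q ∈ ptmDomain x₀ i s) (X : TangentSpace (𝓡 4).tangent q) :
    mfderiv 𝓘(ℝ, E4 × E3) 𝓘(ℝ, E4 × E3) (extChartAt 𝓘(ℝ, E4 × E3) p) (toPTM q)
      (mfderiv (𝓡 4).tangent 𝓘(ℝ, E4 × E3) toPTM q X) =
    fderiv ℝ (affProj i) (natCoord (chartAt E4 x₀) q) (dNatCoord (chartAt E4 x₀) q X) := by
  have hmem : toPTM q ∈ (chartAt (E4 × E3) p).source := by rw [hc]; exact ⟨q, hq, rfl⟩
  have h1 := mfderiv_comp q (mdifferentiableAt_extChartAt (I := 𝓘(ℝ, E4 × E3)) hmem)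
    ((contMDiffAt_toPTM q).mdifferentiableAt (by simp))
  have h2 := mfderiv_comp (f := fun p : slit M => natCoord (chartAt E4 x₀) p) q
    ((contDiffAt_affProj (right_ne_zero_of_mul
      (natCoord_pos hq).ne')).contMDiffAt.mdifferentiableAt (by simp))
    ((contMDiffAt_natCoord_slit (chartAt_mem x₀) hq.1).mdifferentiableAt (by simp))
  have h3 : extChartAt 𝓘(ℝ, E4 × E3) p ∘ toPTM =ᶠ[𝓝 q]
      affProj i ∘ fun p : slit M => natCoord (chartAt E4 x₀) p := by
    rw [extChartAt_eq_ptmCoord hc]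
    filter_upwards [isOpen_slit_source.mem_nhds hq.1] with p hp
    exact ptmCoord_toPTM' hp
  rw [h3.mfderiv_eq, h2, mfderiv_eq_fderiv] at h1
  exact (DFunLike.congr_fun h1 X).symm

/-- The derivative of `π⁺` in the preferred chart at the image point. -/
theorem mfderiv_toPTM_eq {hs : s * s = 1}
    (hc : chartAt (E4 × E3) (toPTM q) = ptmChart x₀ i s hs)
    (X : TangentSpace (𝓡 4).tangent q) :
    mfderiv (𝓡 4).tangent 𝓘(ℝ, E4 × E3) toPTM q X =
      fderiv ℝ (affProj i) (natCoord (chartAt E4 x₀) q) (dNatCoord (chartAt E4 x₀) q X) := by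
  have hq := mem_ptmDomain_of_chartAt hc (mem_chart_source _ _)
  rw [← mfderiv_extChartAt_toPTM hc hq, mfderiv_extChartAt_self]
  rfl

theorem mfderiv_toPTM_surjective (q : slit M) :
    Function.Surjective (mfderiv (𝓡 4).tangent 𝓘(ℝ, E4 × E3) toPTM q) := by
  obtain ⟨x₀, i, s, hs, hc⟩ := chartAt_eq_ptmChart (toPTM q)
  have hq := mem_ptmDomain_of_chartAt hc (mem_chart_source _ _)
  intro Y
  obtain ⟨Z, hZ⟩ := fderiv_affProj_surjective (natCoord_pos hq) (Y : E4 × E3)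
  obtain ⟨X, hX⟩ := dNatCoord_surjective (chartAt_mem x₀) hq.1 Z
  exact ⟨X, by rw [mfderiv_toPTM_eq hc, hX]; exact hZ⟩

theorem ptmProj_ptmCoordSymm (hs : s * s = 1) {y : E4 × E3}
    (hy : y.1 ∈ (chartAt E4 x₀).target) :
    ptmProj (ptmCoordSymm x₀ i s y) = (chartAt E4 x₀).symm y.1 := by
  rw [ptmCoordSymm_eq_toPTM hs hy]
  rfl

theorem isOpen_ptm_target : IsOpen {y : E4 × E3 | y.1 ∈ (chartAt E4 x₀).target} :=
  (chartAt E4 x₀).open_target.preimage continuous_fst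

theorem contMDiffAt_chart_symm_fst {y : E4 × E3} (hy : y.1 ∈ (chartAt E4 x₀).target) :
    ContMDiffAt 𝓘(ℝ, E4 × E3) (𝓡 4) ∞ (fun y : E4 × E3 => (chartAt E4 x₀).symm y.1) y :=
  ContMDiffAt.comp (g := (chartAt E4 x₀).symm) y
    (contMDiffAt_symm_of_mem_maximalAtlas (chartAt_mem x₀) hy) contDiff_fst.contMDiff.contMDiffAt

theorem contMDiffAt_ptmProj (p : PTM M) :
    ContMDiffAt 𝓘(ℝ, E4 × E3) (𝓡 4) ∞ (ptmProj (M := M)) p := by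
  obtain ⟨x₀, i, s, hs, hc⟩ := chartAt_eq_ptmChart p
  have hy : (extChartAt 𝓘(ℝ, E4 × E3) p p).1 ∈ (chartAt E4 x₀).target := by
    have h := mem_chart_target (E4 × E3) p
    rw [hc] at h
    rw [extChartAt_eq_ptmCoord hc]
    exact h
  rw [contMDiffAt_iff_source, extChartAt_symm_eq_ptmCoordSymm hc]
  refine ((contMDiffAt_chart_symm_fst hy).congr_of_eventuallyEq ?_).contMDiffWithinAt
  filter_upwards [isOpen_ptm_target.mem_nhds hy] with y hy using ptmProj_ptmCoordSymm hs hy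

/-- The differential of the projection `PTM⁺ → M` along the inverse of a chart. -/
theorem mfderiv_ptmProj_extChartAt_symm {p : PTM M} {hs : s * s = 1}
    (hc : chartAt (E4 × E3) p = ptmChart x₀ i s hs) {y : E4 × E3}
    (hy : y.1 ∈ (chartAt E4 x₀).target) (Y : E4 × E3) :
    (mfderiv 𝓘(ℝ, E4 × E3) (𝓡 4) ptmProj ((extChartAt 𝓘(ℝ, E4 × E3) p).symm y)
      (mfderiv 𝓘(ℝ, E4 × E3) 𝓘(ℝ, E4 × E3) (extChartAt 𝓘(ℝ, E4 × E3) p).symm y Y) : E4) =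
    mfderiv 𝓘(ℝ, E4) (𝓡 4) (chartAt E4 x₀).symm y.1 Y.1 := by
  have hd : MDifferentiableAt 𝓘(ℝ, E4 × E3) 𝓘(ℝ, E4 × E3) (extChartAt 𝓘(ℝ, E4 × E3) p).symm y := by
    have h : y ∈ (extChartAt 𝓘(ℝ, E4 × E3) p).target := by
      rw [extChartAt_target, hc]
      simp only [modelWithCornersSelf_coe_symm, range_id, modelWithCornersSelf_coe]
      exact ⟨hy, mem_univ _⟩
    have := mdifferentiableWithinAt_extChartAt_symm h
    rwa [modelWithCornersSelf_coe, range_id, mdifferentiableWithinAt_univ] at this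
  have h1 := mfderiv_comp y ((contMDiffAt_ptmProj _).mdifferentiableAt (by simp)) hd
  have h2 : ptmProj ∘ (extChartAt 𝓘(ℝ, E4 × E3) p).symm =ᶠ[𝓝 y]
      (chartAt E4 x₀).symm ∘ (Prod.fst : E4 × E3 → E4) := by
    rw [extChartAt_symm_eq_ptmCoordSymm hc]
    filter_upwards [isOpen_ptm_target.mem_nhds hy] with y hy using ptmProj_ptmCoordSymm hs hy
  have h3 := mfderiv_comp (I := 𝓘(ℝ, E4 × E3)) (I' := 𝓘(ℝ, E4)) (I'' := 𝓡 4)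
    (g := (chartAt E4 x₀).symm) (f := (Prod.fst : E4 × E3 → E4)) y
    ((mdifferentiable_of_mem_maximalAtlas (chartAt_mem x₀)).mdifferentiableAt_symm hy)
    (differentiableAt_fst.mdifferentiableAt)
  rw [h2.mfderiv_eq, h3, mfderiv_eq_fderiv, fderiv_fst] at h1
  exact (DFunLike.congr_fun h1 Y).symm

end Chart

end Projectivization

/-! ### The projected Hilbert form -/

section Contact

variable {M : Type*} [TopologicalSpace M] [ChartedSpace E4 M] [IsManifold (𝓡 4) ∞ M]

theorem OneForm.d_apply (θ : OneForm M) (p : PTM M)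
    (h : DifferentiableAt ℝ (θ.localRep p) (extChartAt 𝓘(ℝ, E4 × E3) p p)) (X Y : E4 × E3) :
    θ.d p ![X, Y] = extD (θ.localRep p) (extChartAt 𝓘(ℝ, E4 × E3) p p) X Y := by
  rw [OneForm.d, mfderiv_extChartAt_self]
  have hd : HasFDerivAt (fun y => ContinuousAlternatingMap.ofSubsingleton ℝ (E4 × E3) ℝ (0 : Fin 1)
      (θ.localRep p y)) _ (extChartAt 𝓘(ℝ, E4 × E3) p p) :=
    (ContinuousAlternatingMap.ofSubsingletonLIE (𝕜 := ℝ) (E := E4 × E3) (F := ℝ)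
      (0 : Fin 1)).toContinuousLinearEquiv.hasFDerivAt.comp _ h.hasFDerivAt
  have h1 : ∀ X Y : E4 × E3, fderiv ℝ (fun y => ContinuousAlternatingMap.ofSubsingleton ℝ (E4 × E3) ℝ
      (0 : Fin 1) (θ.localRep p y)) (extChartAt 𝓘(ℝ, E4 × E3) p p) X ![Y] =
      fderiv ℝ (θ.localRep p) (extChartAt 𝓘(ℝ, E4 × E3) p p) X Y := fun X Y => by
    rw [hd.fderiv]; rfl
  change extDeriv _ _ ![X, Y] = _
  rw [extDeriv, ContinuousAlternatingMap.alternatizeUncurryFin_apply, Fin.sum_univ_two, extD, ← h1,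
    ← h1]
  have e0 : (0 : Fin 2).removeNth ![X, Y] = ![Y] := by
    funext j; fin_cases j; rfl
  have e1 : (1 : Fin 2).removeNth ![X, Y] = ![X] := by
    funext j; fin_cases j; rfl
  rw [e0, e1]
  simp
  rfl

namespace FinslerSpacetime

variable (S : FinslerSpacetime M)

/-- The fibre derivative of the pseudo-norm is constant along rays. -/
theorem fibDeriv_congr {q q' : slit M} (hq : (q : TanB M) ∈ S.A₀) (h : toPTM q = toPTM q') :
    S.fibDeriv q' = S.fibDeriv q := by
  obtain ⟨c, hc, h⟩ := toPTM_eq.1 h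
  have hx := mem_chart_source E4 (q : TanB M).1
  have he := chartAt_mem (q : TanB M).1
  have h1 : natCoord (chartAt E4 (q : TanB M).1) ⟨(q : TanB M).1, c • (q : TanB M).2⟩ =
      ((natCoord (chartAt E4 (q : TanB M).1) q).1,
        c • (natCoord (chartAt E4 (q : TanB M).1) q).2) :=
    Prod.ext rfl (map_smul (mfderiv (𝓡 4) 𝓘(ℝ, E4) (chartAt E4 (q : TanB M).1) (q : TanB M).1) c _)
  rw [h]
  refine ContinuousLinearMap.ext fun w => ?_
  rw [S.fibDeriv_apply he (S.smul_mem_A₀ hq hc) hx, S.fibDeriv_apply he hq hx, h1]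
  exact DFunLike.congr_fun ((S.isLagrangian he).hilb_smul (S.natCoord_mem he hq hx) hc)
    (mfderiv (𝓡 4) 𝓘(ℝ, E4) (chartAt E4 (q : TanB M).1) (q : TanB M).1 w, 0)

/-- The form on `PTM⁺` induced by the Hilbert form: the fibre derivative of the pseudo-norm at any
vector of the ray, composed with the differential of the projection to `M`. -/
def projHilbert : OneForm M := fun p =>
  (S.fibDeriv (rep p)).comp (mfderiv 𝓘(ℝ, E4 × E3) (𝓡 4) ptmProj p :
    TangentSpace 𝓘(ℝ, E4 × E3) p →L[ℝ] E4)

theorem projHilbert_comp {q : slit M} (hq : (q : TanB M) ∈ S.A₀) :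
    (S.projHilbert (toPTM q)).comp (mfderiv (𝓡 4).tangent 𝓘(ℝ, E4 × E3) toPTM q) =
      S.hilbertForm q := by
  have h1 := mfderiv_comp q ((contMDiffAt_ptmProj (toPTM q)).mdifferentiableAt (by simp))
    ((contMDiffAt_toPTM q).mdifferentiableAt (by simp))
  refine ContinuousLinearMap.ext fun X => ?_
  have h2 := DFunLike.congr_fun h1 X
  have h3 := S.fibDeriv_congr hq (toPTM_rep (toPTM q)).symm
  change S.fibDeriv (rep (toPTM q)) _ = S.fibDeriv q _
  rw [h3]
  exact congrArg (S.fibDeriv q) h2.symm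

variable {x₀ : M} {i : Fin 4} {s : ℝ} {q : slit M}

/-- In coordinates, the projected Hilbert form is the pullback of `F_{·i} dx^i` under a section of
`π⁺`. -/
theorem localRep_projHilbert {p : PTM M} {hs : s * s = 1}
    (hc : chartAt (E4 × E3) p = ptmChart x₀ i s hs) {y : E4 × E3}
    (hy : affSection i s y ∈ S.coordDom (chartAt E4 x₀)) :
    S.projHilbert.localRep p y =
      (hilb (pnorm (S.L ∘ natPoint (chartAt E4 x₀))) (affSection i s y)).comp
        (fderiv ℝ (affSection i s) y) := by
  have he := chartAt_mem x₀
  have hy1 : y.1 ∈ (chartAt E4 x₀).target := hy.1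
  set q : slit M := ⟨natPoint (chartAt E4 x₀) (affSection i s y),
    natPoint_affSection_ne_zero hs hy1⟩ with hq
  have hqA : (q : TanB M) ∈ S.A₀ := hy.2
  have hp : (extChartAt 𝓘(ℝ, E4 × E3) p).symm y = toPTM q := by
    rw [extChartAt_symm_eq_ptmCoordSymm hc, ptmCoordSymm_eq_toPTM hs hy1]
  refine ContinuousLinearMap.ext fun Y => ?_
  have h1 := mfderiv_ptmProj_extChartAt_symm hc hy1 Y
  change S.fibDeriv (rep ((extChartAt 𝓘(ℝ, E4 × E3) p).symm y)) _ = _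
  rw [S.fibDeriv_congr (q := q) hqA (by rw [toPTM_rep, hp])]
  refine (congrArg (S.fibDeriv q) h1).trans ?_
  have hqs : (q : TanB M).1 ∈ (chartAt E4 x₀).source := (chartAt E4 x₀).map_target hy1
  refine (S.fibDeriv_apply he hqA hqs _).trans ?_
  rw [natCoord_natPoint he (z := affSection i s y) hy1]
  have h2 := DFunLike.congr_fun
    ((mdifferentiable_of_mem_maximalAtlas he).comp_symm_deriv hy1) Y.1
  rw [ContinuousLinearMap.comp_apply, hilb_apply, fderiv_affSection_fst]
  exact congrArg (fun w : E4 => fderiv ℝ (pnorm (S.L ∘ natPoint (chartAt E4 x₀)))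
    (affSection i s y) (0, w)) h2

theorem affSection_affProj_mem (hq : q ∈ ptmDomain x₀ i s) (hqA : (q : TanB M) ∈ S.A₀) :
    affSection i s (affProj i (natCoord (chartAt E4 x₀) q)) ∈ S.coordDom (chartAt E4 x₀) := by
  rw [affSection_affProj (natCoord_pos hq)]
  exact (S.isLagrangian (chartAt_mem x₀)).conic _ (S.natCoord_mem (chartAt_mem x₀) hqA hq.1) _
    (scale_pos (natCoord_pos hq))

theorem contDiffAt_localRep {p : PTM M} {hs : s * s = 1}
    (hc : chartAt (E4 × E3) p = ptmChart x₀ i s hs) {y : E4 × E3}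
    (hy : affSection i s y ∈ S.coordDom (chartAt E4 x₀)) :
    ContDiffAt ℝ ∞ (S.projHilbert.localRep p) y := by
  have hL := S.isLagrangian (chartAt_mem x₀)
  have hσ := (contDiff_affSection i s).contDiffAt (x := y)
  have h1 : ContDiffAt ℝ ∞ (fun y => (hilb (pnorm (S.L ∘ natPoint (chartAt E4 x₀)))
      (affSection i s y)).comp (fderiv ℝ (affSection i s) y)) y :=
    ((contDiffAt_hilb (hL.contDiffAt_pnorm hy)).comp y hσ).clm_comp
      (hσ.fderiv_right (m := ∞) (by norm_cast))
  refine h1.congr_of_eventuallyEq ?_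
  filter_upwards [hσ.continuousAt.eventually_mem (hL.isOpen.mem_nhds hy)] with y hy
  exact S.localRep_projHilbert hc hy

theorem projHilbert_apply {hs : s * s = 1}
    (hc : chartAt (E4 × E3) (toPTM q) = ptmChart x₀ i s hs) (hqA : (q : TanB M) ∈ S.A₀)
    (X : TangentSpace (𝓡 4).tangent q) :
    S.projHilbert (toPTM q) (mfderiv (𝓡 4).tangent 𝓘(ℝ, E4 × E3) toPTM q X) =
      hilb (pnorm (S.L ∘ natPoint (chartAt E4 x₀))) (natCoord (chartAt E4 x₀) q)
        (dNatCoord (chartAt E4 x₀) q X) := by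
  have hq := mem_ptmDomain_of_chartAt hc (mem_chart_source _ _)
  have he := chartAt_mem x₀
  have h0 := DFunLike.congr_fun (S.projHilbert_comp hqA) X
  have hproj : MDifferentiableAt (𝓡 4).tangent (𝓡 4) (fun p : slit M => (p : TanB M).1) q := by
    exact ((contMDiffAt_ptmProj (toPTM q)).mdifferentiableAt (by simp)).comp q
      ((contMDiffAt_toPTM q).mdifferentiableAt (by simp))
  have h1 := mfderiv_comp (f := fun p : slit M => (p : TanB M).1) q
    ((mdifferentiable_of_mem_maximalAtlas he).mdifferentiableAt hq.1) hproj
  have h2 := mfderiv_comp (I' := 𝓘(ℝ, E4 × E4)) (I'' := 𝓘(ℝ, E4)) (g := (Prod.fst : E4 × E4 → E4))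
    (f := fun p : slit M => natCoord (chartAt E4 x₀) p) q
    (differentiableAt_fst.mdifferentiableAt)
    ((contMDiffAt_natCoord_slit he hq.1).mdifferentiableAt (by simp))
  have h3 := DFunLike.congr_fun (h1.symm.trans h2) X
  rw [mfderiv_eq_fderiv, fderiv_fst] at h3
  refine h0.trans ?_
  refine (S.fibDeriv_apply he hqA hq.1 _).trans ?_
  rw [hilb_apply]
  exact congrArg (fun w : E4 => fderiv ℝ (pnorm (S.L ∘ natPoint (chartAt E4 x₀)))
    (natCoord (chartAt E4 x₀) q) (0, w)) h3

/-- The Hilbert form in coordinates is the pullback of the coordinate expression of the projected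
form under `π⁺`. -/
theorem localRep_affProj {p : PTM M} {hs : s * s = 1}
    (hc : chartAt (E4 × E3) p = ptmChart x₀ i s hs) {z : E4 × E4}
    (hz : z ∈ S.coordDom (chartAt E4 x₀)) (hzi : 0 < s * z.2 i) :
    hilb (pnorm (S.L ∘ natPoint (chartAt E4 x₀))) z =
      (S.projHilbert.localRep p (affProj i z)).comp (fderiv ℝ (affProj i) z) := by
  have hL := S.isLagrangian (chartAt_mem x₀)
  have hs' := scale_pos hzi
  have hmem : affSection i s (affProj i z) ∈ S.coordDom (chartAt E4 x₀) := by
    rw [affSection_affProj hzi]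
    exact hL.conic z hz _ hs'
  refine ContinuousLinearMap.ext fun X => ?_
  rw [S.localRep_projHilbert hc hmem]
  simp only [ContinuousLinearMap.comp_apply]
  rw [affSection_affProj hzi, hL.hilb_smul hz hs', hilb_apply, hilb_apply, fderiv_affSection_fst,
    fderiv_affProj_fst (right_ne_zero_of_mul hzi.ne')]

theorem projHilbert_d_apply {hs : s * s = 1}
    (hc : chartAt (E4 × E3) (toPTM q) = ptmChart x₀ i s hs) (hqA : (q : TanB M) ∈ S.A₀)
    (X Y : TangentSpace (𝓡 4).tangent q) :
    S.projHilbert.d (toPTM q) ![mfderiv (𝓡 4).tangent 𝓘(ℝ, E4 × E3) toPTM q X,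
      mfderiv (𝓡 4).tangent 𝓘(ℝ, E4 × E3) toPTM q Y] =
      extD (hilb (pnorm (S.L ∘ natPoint (chartAt E4 x₀)))) (natCoord (chartAt E4 x₀) q)
        (dNatCoord (chartAt E4 x₀) q X) (dNatCoord (chartAt E4 x₀) q Y) := by
  have hq := mem_ptmDomain_of_chartAt hc (mem_chart_source _ _)
  have he := chartAt_mem x₀
  have hL := S.isLagrangian he
  have hz := S.natCoord_mem he hqA hq.1
  have hpos := natCoord_pos hq
  have hy : extChartAt 𝓘(ℝ, E4 × E3) (toPTM q) (toPTM q) =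
      affProj i (natCoord (chartAt E4 x₀) q) := by
    rw [extChartAt_eq_ptmCoord hc, ptmCoord_toPTM' hq.1]
  have hd : DifferentiableAt ℝ (S.projHilbert.localRep (toPTM q))
      (affProj i (natCoord (chartAt E4 x₀) q)) :=
    (S.contDiffAt_localRep hc (S.affSection_affProj_mem hq hqA)).differentiableAt (by simp)
  have hcont : Continuous fun z : E4 × E4 => s * z.2 i := by fun_prop
  rw [mfderiv_toPTM_eq hc, mfderiv_toPTM_eq hc, OneForm.d_apply _ _ (by rw [hy]; exact hd), hy]
  refine (extD_pullback ?_ hd (contDiffAt_affProj (right_ne_zero_of_mul hpos.ne')) _ _).symm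
  filter_upwards [hL.isOpen.mem_nhds hz,
    hcont.continuousAt.eventually_const_lt hpos] with z hz hzi
  exact S.localRep_affProj hc hz hzi

theorem isProjectedHilbertForm_projHilbert : S.IsProjectedHilbertForm S.projHilbert := by
  refine ⟨?_, fun q hq => S.projHilbert_comp hq⟩
  rintro _ ⟨q, hqA, rfl⟩
  obtain ⟨x₀, i, s, hs, hc⟩ := chartAt_eq_ptmChart (toPTM q)
  have hq := mem_ptmDomain_of_chartAt hc (mem_chart_source _ _)
  rw [extChartAt_eq_ptmCoord hc, ptmCoord_toPTM' hq.1]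
  exact S.contDiffAt_localRep hc (S.affSection_affProj_mem hq hqA)

theorem projectedHilbertForm_unique {θ θ' : OneForm M} (h : S.IsProjectedHilbertForm θ)
    (h' : S.IsProjectedHilbertForm θ') : ∀ p ∈ S.A₀plus, θ' p = θ p := by
  rintro _ ⟨q, hqA, rfl⟩
  refine ContinuousLinearMap.ext fun Y => ?_
  obtain ⟨X, rfl⟩ := mfderiv_toPTM_surjective q Y
  exact DFunLike.congr_fun ((h'.2 q hqA).trans (h.2 q hqA).symm) X

theorem isContactOn_projHilbert : S.projHilbert.IsContactOn S.A₀plus := by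
  refine ⟨S.isProjectedHilbertForm_projHilbert.1, ?_⟩
  rintro _ ⟨q, hqA, rfl⟩
  obtain ⟨x₀, i, s, hs, hc⟩ := chartAt_eq_ptmChart (toPTM q)
  have hq := mem_ptmDomain_of_chartAt hc (mem_chart_source _ _)
  have he := chartAt_mem x₀
  obtain ⟨v, hv, hv'⟩ := (S.isLagrangian he).exists_darboux (by simp) (S.natCoord_mem he hqA hq.1)
  choose X hX using fun j => dNatCoord_surjective he hq.1 (v j)
  refine ⟨fun j => mfderiv (𝓡 4).tangent 𝓘(ℝ, E4 × E3) toPTM q (X j),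
    wedgeTop_ne_zero_of_darboux _ _ _ (fun j => ?_) fun j k hj hk => ?_⟩
  · rw [S.projHilbert_apply hc hqA, hX, hv]
  · rw [S.projHilbert_d_apply hc hqA, hX, hX, hv' j k hj hk]

end FinslerSpacetime

end Contact

/-! ### The Reeb field -/

section Reeb

variable {M : Type*} [TopologicalSpace M] [ChartedSpace E4 M] [IsManifold (𝓡 4) ∞ M]

namespace FinslerSpacetime

variable (S : FinslerSpacetime M)

/-- The defining equations of the Reeb field for a vector at a point of `PTM⁺`. -/
def IsReebVec (p : PTM M) (X : E4 × E3) : Prop :=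
  S.projHilbert p X = 1 ∧ ∀ Y : E4 × E3, S.projHilbert.d p ![X, Y] = 0

variable {x₀ : M} {i : Fin 4} {s : ℝ} {q : slit M}

/-- The Reeb equations at `π⁺(q)` in terms of a vector at `q`. -/
theorem isReebVec_iff {hs : s * s = 1}
    (hc : chartAt (E4 × E3) (toPTM q) = ptmChart x₀ i s hs) (hqA : (q : TanB M) ∈ S.A₀)
    (X : TangentSpace (𝓡 4).tangent q) :
    S.IsReebVec (toPTM q) (mfderiv (𝓡 4).tangent 𝓘(ℝ, E4 × E3) toPTM q X) ↔
      hilb (pnorm (S.L ∘ natPoint (chartAt E4 x₀))) (natCoord (chartAt E4 x₀) q)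
        (dNatCoord (chartAt E4 x₀) q X) = 1 ∧
      ∀ Z, extD (hilb (pnorm (S.L ∘ natPoint (chartAt E4 x₀)))) (natCoord (chartAt E4 x₀) q)
        (dNatCoord (chartAt E4 x₀) q X) Z = 0 := by
  have hq := mem_ptmDomain_of_chartAt hc (mem_chart_source _ _)
  refine and_congr (by rw [S.projHilbert_apply hc hqA]) ⟨fun h Z => ?_, fun h Y => ?_⟩
  · obtain ⟨Y, rfl⟩ := dNatCoord_surjective (chartAt_mem x₀) hq.1 Z
    rw [← S.projHilbert_d_apply hc hqA]
    exact h _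
  · obtain ⟨Y, rfl⟩ := mfderiv_toPTM_surjective q Y
    exact (S.projHilbert_d_apply hc hqA X Y).trans (h _)

theorem isReebVec_unique {p : PTM M} (hp : p ∈ S.A₀plus) {X X' : E4 × E3} (hX : S.IsReebVec p X)
    (hX' : S.IsReebVec p X') : X = X' := by
  obtain ⟨q, hqA, rfl⟩ := hp
  obtain ⟨x₀, i, s, hs, hc⟩ := chartAt_eq_ptmChart (toPTM q)
  have hq := mem_ptmDomain_of_chartAt hc (mem_chart_source _ _)
  have he := chartAt_mem x₀
  have hL := S.isLagrangian he
  have hz := S.natCoord_mem he hqA hq.1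
  obtain ⟨Z, rfl⟩ := mfderiv_toPTM_surjective q X
  obtain ⟨Z', rfl⟩ := mfderiv_toPTM_surjective q X'
  have h1 := (S.isReebVec_iff hc hqA Z).1 hX
  have h2 := (S.isReebVec_iff hc hqA Z').1 hX'
  set W := dNatCoord (chartAt E4 x₀) q Z
  set W' := dNatCoord (chartAt E4 x₀) q Z'
  obtain ⟨c, hcW⟩ := hL.eq_smul_of_extD_hilb hz (X := W + (-1 : ℝ) • W')
    (by rw [map_add, map_smul, h1.1, h2.1]; norm_num)
    (fun Y => by rw [extD_add_left, extD_smul_left, h1.2, h2.2]; norm_num)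
  have h3 := congrArg (fderiv ℝ (affProj i) (natCoord (chartAt E4 x₀) q)) hcW
  rw [map_smul, fderiv_affProj_liouville (right_ne_zero_of_mul (natCoord_pos hq).ne'), smul_zero,
    map_add, map_smul, neg_one_smul, ← sub_eq_add_neg, sub_eq_zero] at h3
  exact (mfderiv_toPTM_eq hc Z).trans (h3.trans (mfderiv_toPTM_eq hc Z').symm)

/-- The normalized geodesic spray on `𝒜₀`: the vector with components `l^i δ_i` in the coordinates
induced by the preferred chart. -/
def sprayField (q : slit M) : TangentSpace (𝓡 4).tangent q :=
  S.reebLocal (chartAt E4 (q : TanB M).1) (natCoord (chartAt E4 (q : TanB M).1) q)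

/-- The normalized geodesic spray has the components `l^i δ_i` in all induced coordinates. -/
theorem dNatCoord_sprayField {e : OpenPartialHomeomorph M E4}
    (he : e ∈ IsManifold.maximalAtlas (𝓡 4) ∞ M) (hqA : (q : TanB M) ∈ S.A₀)
    (hq : (q : TanB M).1 ∈ e.source) :
    dNatCoord e q (S.sprayField q) = S.reebLocal e (natCoord e q) := by
  set x := (q : TanB M).1 with hxdef
  have hx : (q : TanB M).1 ∈ (chartAt E4 x).source := mem_chart_source E4 x
  have h₀ := chartAt_mem x
  set z := natCoord (chartAt E4 x) (q : TanB M) with hz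
  have hzt : z.1 ∈ (chartAt E4 x).target := (chartAt E4 x).map_source hx
  have hpt : natPoint (chartAt E4 x) z = q := natPoint_natCoord h₀ hx
  have h1 := S.isSprayDir_reebLocal (S.isLagrangian h₀) (S.det_ne_zero h₀) (S.natCoord_mem h₀ hqA hx)
  have h2 : dNatCoord e q (S.sprayField q) =
      fderiv ℝ (natCoord e ∘ natPoint (chartAt E4 x)) z (S.reebLocal (chartAt E4 x) z) := by
    rw [dNatCoord_eq_fderiv_comp h₀ he hx hq, dNatCoord_chartAt]
    rfl
  have hΦz : (natCoord e ∘ natPoint (chartAt E4 x)) z = natCoord e q := by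
    rw [Function.comp_apply, hpt]
  have hsrc : (natPoint (chartAt E4 x) z).1 ∈ e.source := by rwa [hpt]
  have hΦ : ContDiffAt ℝ ∞ (natCoord e ∘ natPoint (chartAt E4 x)) z := by
    rw [← contMDiffAt_iff_contDiffAt]
    exact ContMDiffAt.comp z (contMDiffAt_natCoord he hsrc) (contMDiffAt_natPoint h₀ hzt)
  have hev : ∀ᶠ y in 𝓝 z, y.1 ∈ (chartAt E4 x).target ∧
      (natPoint (chartAt E4 x) y).1 ∈ e.source := by
    filter_upwards [isOpen_fst_mem_target.mem_nhds hzt,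
      (contMDiffAt_natPoint h₀ hzt).continuousAt.eventually_mem
        (isOpen_fst_mem_source.mem_nhds hsrc)] with y h h' using ⟨h, h'⟩
  have hφ : ∀ᶠ y in 𝓝 z, DifferentiableAt ℝ (e ∘ (chartAt E4 x).symm) y.1 ∧
      (natCoord e ∘ natPoint (chartAt E4 x)) y =
        ((e ∘ (chartAt E4 x).symm) y.1, fderiv ℝ (e ∘ (chartAt E4 x).symm) y.1 y.2) := by
    filter_upwards [hev] with y hy
    have hd := (mdifferentiable_of_mem_maximalAtlas he).mdifferentiableAt hy.2
    have hd' := (mdifferentiable_of_mem_maximalAtlas h₀).mdifferentiableAt_symm hy.1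
    refine ⟨(MDifferentiableAt.comp y.1 hd hd').differentiableAt, Prod.ext rfl ?_⟩
    have h3 := mfderiv_comp y.1 hd hd'
    rw [mfderiv_eq_fderiv] at h3
    exact (DFunLike.congr_fun h3 y.2).symm
  have hsurj : Function.Surjective (fderiv ℝ (natCoord e ∘ natPoint (chartAt E4 x)) z) := by
    intro Y
    obtain ⟨X, rfl⟩ := dNatCoord_surjective he hq Y
    exact ⟨_, (dNatCoord_eq_fderiv_comp h₀ he hx hq X).symm⟩
  have hL : ∀ᶠ y in 𝓝 z, (S.L ∘ natPoint (chartAt E4 x)) y =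
      (S.L ∘ natPoint e) ((natCoord e ∘ natPoint (chartAt E4 x)) y) := by
    filter_upwards [hev] with y hy
    simp only [Function.comp_apply, natPoint_natCoord he hy.2]
  have hzU : (natCoord e ∘ natPoint (chartAt E4 x)) z ∈ S.coordDom e := by
    rw [hΦz]; exact S.natCoord_mem he hqA hq
  have h4 := IsSprayDir.map (S.isLagrangian he) hΦ hφ hzU hsurj hL h1
  rw [hΦz] at h4
  rw [h2]
  exact (S.isLagrangian he).isSprayDir_unique (S.natCoord_mem he hqA hq) h4
    (S.isSprayDir_reebLocal (S.isLagrangian he) (S.det_ne_zero he) (S.natCoord_mem he hqA hq))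

/-- The Reeb field: the projection of the normalized geodesic spray. -/
def reeb (p : PTM M) : TangentSpace 𝓘(ℝ, E4 × E3) p :=
  (mfderiv (𝓡 4).tangent 𝓘(ℝ, E4 × E3) toPTM (rep p) (S.sprayField (rep p)) : E4 × E3)

theorem isReebVec_sprayField (hqA : (q : TanB M) ∈ S.A₀) :
    S.IsReebVec (toPTM q) (mfderiv (𝓡 4).tangent 𝓘(ℝ, E4 × E3) toPTM q (S.sprayField q)) := by
  obtain ⟨x₀, i, s, hs, hc⟩ := chartAt_eq_ptmChart (toPTM q)
  have hq := mem_ptmDomain_of_chartAt hc (mem_chart_source _ _)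
  have he := chartAt_mem x₀
  have hz := S.natCoord_mem he hqA hq.1
  rw [S.isReebVec_iff hc hqA, S.dNatCoord_sprayField he hqA hq.1]
  exact IsLagrangian.IsSprayDir.reeb (S.isLagrangian he) hz
    (S.isSprayDir_reebLocal (S.isLagrangian he) (S.det_ne_zero he) hz)

theorem rep_mem_A₀ {p : PTM M} (hp : p ∈ S.A₀plus) : (rep p : TanB M) ∈ S.A₀ := by
  obtain ⟨q, hqA, rfl⟩ := hp
  obtain ⟨c, hc, h⟩ := toPTM_eq.1 (toPTM_rep (toPTM q)).symm
  rw [h]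
  exact S.smul_mem_A₀ hqA hc

theorem isReebVec_reeb {p : PTM M} (hp : p ∈ S.A₀plus) : S.IsReebVec p (S.reeb p) := by
  have h := S.isReebVec_sprayField (S.rep_mem_A₀ hp)
  rwa [toPTM_rep] at h

theorem reeb_toPTM (hqA : (q : TanB M) ∈ S.A₀) :
    S.reeb (toPTM q) = mfderiv (𝓡 4).tangent 𝓘(ℝ, E4 × E3) toPTM q (S.sprayField q) :=
  S.isReebVec_unique ⟨q, hqA, rfl⟩ (S.isReebVec_reeb ⟨q, hqA, rfl⟩) (S.isReebVec_sprayField hqA)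

theorem hasReebLocalForm_reeb : S.HasReebLocalForm S.reeb :=
  ⟨S.sprayField, fun _ hqA => ⟨fun _ he hq => S.dNatCoord_sprayField he hqA hq, S.reeb_toPTM hqA⟩⟩

theorem contMDiffOn_reeb : ContMDiffOn 𝓘(ℝ, E4 × E3) 𝓘(ℝ, E4 × E3).tangent ∞
    (fun p => (⟨p, S.reeb p⟩ : TangentBundle 𝓘(ℝ, E4 × E3) (PTM M))) S.A₀plus := by
  rintro p₀ ⟨q, hqA, rfl⟩
  refine ContMDiffAt.contMDiffWithinAt ?_
  obtain ⟨x₀, i, s, hs, hc⟩ := chartAt_eq_ptmChart (toPTM q)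
  have hq := mem_ptmDomain_of_chartAt hc (mem_chart_source _ _)
  have he := chartAt_mem x₀
  have hL := S.isLagrangian he
  have hs0 : s ≠ 0 := by rintro rfl; simp at hs
  set y₀ := extChartAt 𝓘(ℝ, E4 × E3) (toPTM q) (toPTM q) with hy₀def
  have hy₀ : y₀ = affProj i (natCoord (chartAt E4 x₀) q) := by
    rw [hy₀def, extChartAt_eq_ptmCoord hc, ptmCoord_toPTM' hq.1]
  have hmem : affSection i s y₀ ∈ S.coordDom (chartAt E4 x₀) := by
    rw [hy₀]; exact S.affSection_affProj_mem hq hqA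
  have hσ := (contDiff_affSection i s).contDiffAt (x := y₀)
  -- The coordinate expression of the Reeb field.
  set G : E4 × E3 → E4 × E3 := fun y => fderiv ℝ (affProj i) (affSection i s y)
    (S.reebLocal (chartAt E4 x₀) (affSection i s y)) with hG
  have hi : ∀ y, (affSection i s y).2 i = s := fun y => affLift_same i s y.2
  have hGs : ContDiffAt ℝ ∞ G y₀ := by
    refine ContDiffAt.clm_apply ?_
      ((S.contDiffAt_reebLocal hL (S.det_ne_zero he) hmem).comp y₀ hσ)
    exact ((contDiffAt_affProj (by rw [hi]; exact hs0)).fderiv_right (m := ∞)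
      (by norm_cast)).comp y₀ hσ
  rw [Bundle.contMDiffAt_section]
  have hext : ContMDiffAt 𝓘(ℝ, E4 × E3) 𝓘(ℝ, E4 × E3) ∞ (extChartAt 𝓘(ℝ, E4 × E3) (toPTM q))
      (toPTM q) := contMDiffAt_extChartAt
  refine (ContMDiffAt.comp (toPTM q) hGs.contMDiffAt hext).congr_of_eventuallyEq ?_
  filter_upwards [(chartAt (E4 × E3) (toPTM q)).open_source.mem_nhds (mem_chart_source _ (toPTM q)),
    hext.continuousAt.eventually_mem
      ((hL.isOpen.preimage (contDiff_affSection i s).continuous).mem_nhds hmem)] with p hp hp'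
  have hp1 : (extChartAt 𝓘(ℝ, E4 × E3) (toPTM q) p).1 ∈ (chartAt E4 x₀).target := hp'.1
  set y := extChartAt 𝓘(ℝ, E4 × E3) (toPTM q) p with hy
  set q' : slit M := ⟨natPoint (chartAt E4 x₀) (affSection i s y),
    natPoint_affSection_ne_zero hs hp1⟩ with hq'
  have hpq : p = toPTM q' := by
    rw [← ptmCoordSymm_eq_toPTM hs hp1, ← extChartAt_symm_eq_ptmCoordSymm hc, hy,
      (extChartAt 𝓘(ℝ, E4 × E3) (toPTM q)).left_inv (by rwa [extChartAt_source])]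
  have hqA' : (q' : TanB M) ∈ S.A₀ := hp'.2
  have hdom : q' ∈ ptmDomain x₀ i s := mem_ptmDomain_of_chartAt hc (by rwa [← hpq])
  have hz' : natCoord (chartAt E4 x₀) (q' : TanB M) = affSection i s y :=
    natCoord_natPoint he (z := affSection i s y) hp1
  have h1 := mfderiv_extChartAt_toPTM hc hdom (S.sprayField q')
  rw [S.dNatCoord_sprayField he hqA' hdom.1, hz', ← S.reeb_toPTM hqA'] at h1
  have h2 := TangentBundle.continuousLinearMapAt_trivializationAt (𝕜 := ℝ) (I := 𝓘(ℝ, E4 × E3)) hp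
  have h3 := DFunLike.congr_fun h2 (S.reeb p)
  rw [Bundle.Trivialization.continuousLinearMapAt_apply,
    Bundle.Trivialization.linearMapAt_apply, if_pos (by simpa using hp)] at h3
  rw [← hpq] at h1
  exact h3.trans h1

theorem isReebOn_reeb : S.projHilbert.IsReebOn S.reeb S.A₀plus :=
  ⟨S.contMDiffOn_reeb, fun _ hp => S.isReebVec_reeb hp⟩

theorem reeb_unique {R : (p : PTM M) → TangentSpace 𝓘(ℝ, E4 × E3) p}
    (hR : S.projHilbert.IsReebOn R S.A₀plus) : ∀ p ∈ S.A₀plus, R p = S.reeb p := fun p hp =>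
  S.isReebVec_unique hp (hR.2 p hp) (S.isReebVec_reeb hp)

end FinslerSpacetime

end Reeb

/-! ### Differentiation under the integral sign and the first variation in coordinates -/

/-- The set of pairs `(t, s)` of a variation parameter `t` and a curve parameter `s`. -/
abbrev strip (r a b : ℝ) : Set (ℝ × ℝ) := Ioo (-r) r ×ˢ Icc a b

section Strip

variable {r a b : ℝ}

theorem mem_strip_zero (hr : 0 < r) {s : ℝ} (hs : s ∈ Icc a b) : ((0 : ℝ), s) ∈ strip r a b :=
  ⟨⟨neg_lt_zero.2 hr, hr⟩, hs⟩

theorem uniqueDiffOn_strip (hab : a < b) : UniqueDiffOn ℝ (strip r a b) :=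
  isOpen_Ioo.uniqueDiffOn.prod (uniqueDiffOn_Icc hab)

theorem mem_closure_interior_strip (hab : a < b) {p : ℝ × ℝ} (hp : p ∈ strip r a b) :
    p ∈ closure (interior (strip r a b)) := by
  rw [interior_prod_eq, closure_prod_eq, interior_Icc, closure_Ioo hab.ne]
  exact ⟨subset_closure (by simpa using hp.1), hp.2⟩

/-- The derivative of a slice `s ↦ f (t, s)`. -/
theorem hasDerivWithinAt_slice {E : Type*} [NormedAddCommGroup E] [NormedSpace ℝ E]
    {f : ℝ × ℝ → E} {t s : ℝ} (ht : t ∈ Ioo (-r) r)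
    (hf : DifferentiableWithinAt ℝ f (strip r a b) (t, s)) :
    HasDerivWithinAt (fun s => f (t, s)) (fderivWithin ℝ f (strip r a b) (t, s) (0, 1))
      (Icc a b) s := by
  have h1 : HasDerivWithinAt (fun s : ℝ => (t, s)) ((0 : ℝ), (1 : ℝ)) (Icc a b) s :=
    (hasDerivWithinAt_const s (Icc a b) t).prodMk (hasDerivWithinAt_id s (Icc a b))
  exact hf.hasFDerivWithinAt.comp_hasDerivWithinAt s h1 fun s hs => ⟨ht, hs⟩

/-- The derivative of a slice `t ↦ f (t, s)`. -/
theorem hasDerivAt_slice {E : Type*} [NormedAddCommGroup E] [NormedSpace ℝ E]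
    {f : ℝ × ℝ → E} {t s : ℝ} (ht : t ∈ Ioo (-r) r) (hs : s ∈ Icc a b)
    (hf : DifferentiableWithinAt ℝ f (strip r a b) (t, s)) :
    HasDerivAt (fun t => f (t, s)) (fderivWithin ℝ f (strip r a b) (t, s) (1, 0)) t := by
  have h1 : HasDerivWithinAt (fun t : ℝ => (t, s)) ((1 : ℝ), (0 : ℝ)) (Ioo (-r) r) t :=
    (hasDerivWithinAt_id t (Ioo (-r) r)).prodMk (hasDerivWithinAt_const t (Ioo (-r) r) s)
  have hm : MapsTo (fun t : ℝ => (t, s)) (Ioo (-r) r) (strip r a b) := fun t ht => ⟨ht, hs⟩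
  exact (hf.hasFDerivWithinAt.comp_hasDerivWithinAt t h1 hm).hasDerivAt (isOpen_Ioo.mem_nhds ht)

theorem continuousOn_fderivWithin_strip (hr : 0 < r) (hab : a < b) {H : ℝ × ℝ → ℝ}
    (hH : ∀ s ∈ Icc a b, ContDiffWithinAt ℝ 1 H (strip r a b) (0, s)) (v : ℝ × ℝ) :
    ContinuousOn (fun s => fderivWithin ℝ H (strip r a b) (0, s) v) (Icc a b) := by
  intro s hs
  have h1 := ((hH s hs).fderivWithin_right (m := 0) (uniqueDiffOn_strip hab) (by norm_num)
    (mem_strip_zero hr hs)).continuousWithinAt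
  have h2 : ContinuousWithinAt (fun s : ℝ => ((0 : ℝ), s)) (Icc a b) s := by fun_prop
  have h3 := ContinuousWithinAt.comp (g := fderivWithin ℝ H (strip r a b)) h1 h2
    fun s hs => mem_strip_zero hr hs
  exact h3.clm_apply continuousWithinAt_const

/-- Differentiation under the integral sign, for a function that is continuously differentiable
along the slice `t = 0` only. -/
theorem hasDerivAt_integral_strip (hr : 0 < r) (hab : a < b) {H : ℝ × ℝ → ℝ}
    (hH : ∀ s ∈ Icc a b, ContDiffWithinAt ℝ 1 H (strip r a b) (0, s)) :
    HasDerivAt (fun t => ∫ s in a..b, H (t, s))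
      (∫ s in a..b, fderivWithin ℝ H (strip r a b) (0, s) (1, 0)) 0 := by
  have hcont := continuousOn_fderivWithin_strip hr hab hH (1, 0)
  -- By compactness of `[a, b]`, differentiability and a bound on the derivative hold uniformly for
  -- small `t`.
  obtain ⟨K, hK⟩ := isCompact_Icc.exists_bound_of_continuousOn hcont
  have hev : ∀ᶠ t in 𝓝 (0 : ℝ), ∀ s ∈ Icc a b, t ∈ Ioo (-r) r → (t, s) ∈ strip r a b →
      ContDiffWithinAt ℝ 1 H (strip r a b) (t, s) ∧
        ‖fderivWithin ℝ H (strip r a b) (t, s) (1, 0)‖ ≤ K + 1 := by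
    refine isCompact_Icc.eventually_forall_of_forall_eventually fun s hs => ?_
    have hmem := mem_strip_zero hr hs
    have h1 := (hH s hs).eventually (by simp)
    rw [insert_eq_of_mem hmem] at h1
    have h2 := ((hH s hs).fderivWithin_right (m := 0) (uniqueDiffOn_strip hab) (by norm_num)
      hmem).continuousWithinAt
    have h3 : ContinuousWithinAt (fun p => ‖fderivWithin ℝ H (strip r a b) p (1, 0)‖)
        (strip r a b) (0, s) := (h2.clm_apply continuousWithinAt_const).norm
    have h4 := h3.eventually (gt_mem_nhds ((hK s hs).trans_lt (lt_add_one K)))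
    filter_upwards [eventually_nhdsWithin_iff.1 h1, eventually_nhdsWithin_iff.1 h4] with p h h' _ hp
    exact ⟨h hp, (h' hp).le⟩
  have hev' : ∀ᶠ t in 𝓝 (0 : ℝ), t ∈ Ioo (-r) r ∧ ∀ s ∈ Icc a b,
      ContDiffWithinAt ℝ 1 H (strip r a b) (t, s) ∧
        ‖fderivWithin ℝ H (strip r a b) (t, s) (1, 0)‖ ≤ K + 1 := by
    filter_upwards [hev, Ioo_mem_nhds (neg_lt_zero.2 hr) hr] with t h ht
    exact ⟨ht, fun s hs => h s hs ht ⟨ht, hs⟩⟩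
  have hslice : ∀ t, (t ∈ Ioo (-r) r ∧ ∀ s ∈ Icc a b,
      ContDiffWithinAt ℝ 1 H (strip r a b) (t, s) ∧
        ‖fderivWithin ℝ H (strip r a b) (t, s) (1, 0)‖ ≤ K + 1) →
      ContinuousOn (fun s => H (t, s)) (Icc a b) := fun t ht s hs =>
    (hasDerivWithinAt_slice ht.1
      ((ht.2 s hs).1.differentiableWithinAt (by simp))).continuousWithinAt
  have hsub : uIoc a b ⊆ Icc a b := by rw [uIoc_of_le hab.le]; exact Ioc_subset_Icc_self
  have hmeas : ∀ {f : ℝ → ℝ}, ContinuousOn f (Icc a b) →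
      MeasureTheory.AEStronglyMeasurable f (MeasureTheory.volume.restrict (uIoc a b)) :=
    fun hf => (hf.mono hsub).aestronglyMeasurable measurableSet_uIoc
  refine (intervalIntegral.hasDerivAt_integral_of_dominated_loc_of_deriv_le
    (F := fun t s => H (t, s)) (F' := fun t s => fderivWithin ℝ H (strip r a b) (t, s) (1, 0))
    (bound := fun _ => K + 1) hev' ?_ ?_ (hmeas hcont) ?_ ?_ ?_).2
  · filter_upwards [hev'] with t ht using hmeas (hslice t ht)
  · refine ContinuousOn.intervalIntegrable ?_
    rw [uIcc_of_le hab.le]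
    exact hslice 0 hev'.self_of_nhds
  · exact .of_forall fun s hs t ht => (ht.2 s (hsub hs)).2
  · simp
  · exact .of_forall fun s hs t ht => hasDerivAt_slice ht.1 (hsub hs)
      ((ht.2 s (hsub hs)).1.differentiableWithinAt (by simp))

end Strip

section Flat

variable {V : Type*} [NormedAddCommGroup V] [NormedSpace ℝ V] {U : Set (V × V)} {L : V × V → ℝ}
  {r a b s₀ : ℝ} {y : ℝ × ℝ → V}

/-- The velocity lifts of the curves `s ↦ y (t, s)`. -/
def flatLift (r a b : ℝ) (y : ℝ × ℝ → V) (p : ℝ × ℝ) : V × V :=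
  (y p, fderivWithin ℝ y (strip r a b) p (0, 1))

theorem contDiffWithinAt_flatLift (hab : a < b) {p : ℝ × ℝ} (hp : p ∈ strip r a b)
    (hy : ContDiffWithinAt ℝ 2 y (strip r a b) p) :
    ContDiffWithinAt ℝ 1 (flatLift r a b y) (strip r a b) p :=
  (hy.of_le (by norm_num)).prodMk ((hy.fderivWithin_right (m := 1) (uniqueDiffOn_strip hab)
    (by norm_num) hp).clm_apply contDiffWithinAt_const)

/-- The first variation formula before integration: along the curve `t = 0`, the derivative of
`F_{·i} y^i`, where `y^i` is the variation field, is the sum of the first variation of `F` and the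
value of `dω` on the velocity of the lifted curve and the variation field. -/
theorem IsLagrangian.hasDerivWithinAt_momentum (hL : IsLagrangian U L) (hr : 0 < r) (hab : a < b)
    (hs : s₀ ∈ Icc a b) (hy : ContDiffWithinAt ℝ 2 y (strip r a b) (0, s₀))
    (hU : flatLift r a b y (0, s₀) ∈ U) :
    HasDerivWithinAt
      (fun s => fderiv ℝ (pnorm L) (flatLift r a b y (0, s))
        (0, fderivWithin ℝ y (strip r a b) (0, s) (1, 0)))
      (fderivWithin ℝ (pnorm L ∘ flatLift r a b y) (strip r a b) (0, s₀) (1, 0) +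
        extD (hilb (pnorm L)) (flatLift r a b y (0, s₀))
          (fderivWithin ℝ (flatLift r a b y) (strip r a b) (0, s₀) (0, 1))
          (fderivWithin ℝ y (strip r a b) (0, s₀) (1, 0), 0)) (Icc a b) s₀ := by
  have hmem := mem_strip_zero hr hs
  have hud := uniqueDiffOn_strip (r := r) hab
  have h0 : (0 : ℝ) ∈ Ioo (-r) r := hmem.1
  have hN := contDiffWithinAt_flatLift hab hmem hy
  have hNd := hN.differentiableWithinAt (by simp)
  have hyd := hy.differentiableWithinAt (by simp)
  have hDy := (hy.fderivWithin_right (m := 1) hud (by norm_num) hmem).differentiableWithinAt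
    (by simp)
  have hFs := hL.contDiffAt_pnorm hU
  have hF := hL.differentiableAt_pnorm hU
  have hDF : DifferentiableAt ℝ (fderiv ℝ (pnorm L)) (flatLift r a b y (0, s₀)) :=
    (hFs.fderiv_right (m := 1) (by norm_cast)).differentiableAt (by simp)
  -- The derivatives of the lift are those of `y` and of its velocity.
  have hNder : ∀ v, fderivWithin ℝ (flatLift r a b y) (strip r a b) (0, s₀) v =
      (fderivWithin ℝ y (strip r a b) (0, s₀) v,
        fderivWithin ℝ (fderivWithin ℝ y (strip r a b)) (strip r a b) (0, s₀) v (0, 1)) := by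
    intro v
    have h1 := hyd.hasFDerivWithinAt.prodMk
      (hDy.hasFDerivWithinAt.clm_apply (hasFDerivWithinAt_const ((0 : ℝ), (1 : ℝ)) _ _))
    have h2 : fderivWithin ℝ (flatLift r a b y) (strip r a b) (0, s₀) = _ :=
      h1.fderivWithin (hud _ hmem)
    rw [h2]
    simp
  have hsymm := hy.isSymmSndFDerivWithinAt (by simp) hud
    (mem_closure_interior_strip hab hmem) hmem (1, 0) (0, 1)
  have hN' := hasDerivWithinAt_slice h0 hNd
  have hY' : HasDerivWithinAt (fun s => fderivWithin ℝ y (strip r a b) (0, s) (1, 0))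
      (fderivWithin ℝ (fderivWithin ℝ y (strip r a b)) (strip r a b) (0, s₀) (0, 1) (1, 0))
      (Icc a b) s₀ := by
    have := (hasDerivWithinAt_slice h0 hDy).clm_apply
      (hasDerivWithinAt_const s₀ (Icc a b) ((1 : ℝ), (0 : ℝ)))
    simpa using this
  have hDF' : HasDerivWithinAt (fun s => fderiv ℝ (pnorm L) (flatLift r a b y (0, s)))
      (fderiv ℝ (fderiv ℝ (pnorm L)) (flatLift r a b y (0, s₀))
        (fderivWithin ℝ (flatLift r a b y) (strip r a b) (0, s₀) (0, 1))) (Icc a b) s₀ :=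
    HasFDerivAt.comp_hasDerivWithinAt (f := fun s => flatLift r a b y (0, s)) s₀
      hDF.hasFDerivAt hN'
  have h1 := hDF'.clm_apply ((hasDerivWithinAt_const s₀ (Icc a b) (0 : V)).prodMk hY')
  refine h1.congr_deriv ?_
  have h2 : fderivWithin ℝ (pnorm L ∘ flatLift r a b y) (strip r a b) (0, s₀) =
      (fderiv ℝ (pnorm L) (flatLift r a b y (0, s₀))).comp
        (fderivWithin ℝ (flatLift r a b y) (strip r a b) (0, s₀)) :=
    fderiv_comp_fderivWithin _ hF hNd (hud _ hmem)
  have h3 : fderiv ℝ (fderiv ℝ (pnorm L)) (flatLift r a b y (0, s₀))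
      (fderivWithin ℝ y (strip r a b) (0, s₀) (1, 0), 0)
      (0, fderivWithin ℝ y (strip r a b) (0, s₀) (0, 1)) = _ :=
    hL.euler_pnorm_snd hU (fderivWithin ℝ y (strip r a b) (0, s₀) (1, 0), 0)
  rw [hL.extD_hilb hU, h2, ContinuousLinearMap.comp_apply, hNder, hNder, hsymm]
  rw [h3]
  have h4 : ∀ u w : V, fderiv ℝ (pnorm L) (flatLift r a b y (0, s₀)) (u, w) =
      fderiv ℝ (pnorm L) (flatLift r a b y (0, s₀)) (u, 0) +
        fderiv ℝ (pnorm L) (flatLift r a b y (0, s₀)) (0, w) := fun u w => by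
    rw [← map_add]; simp
  rw [h4 (fderivWithin ℝ y (strip r a b) (0, s₀) (1, 0))]
  ring

end Flat

/-! ### Velocity lifts of curves -/

section Lift

variable {M : Type*} [TopologicalSpace M] [ChartedSpace E4 M] [IsManifold (𝓡 4) ∞ M]
  {e : OpenPartialHomeomorph M E4} {a b s₀ : ℝ}

theorem tangentLift_congr {γ γ' : ℝ → M} (h : EqOn γ γ' (Icc a b)) {s : ℝ} (hs : s ∈ Icc a b) :
    tangentLift a b γ s = tangentLift a b γ' s := by
  have h1 := mfderivWithin_congr (I := 𝓘(ℝ, ℝ)) (I' := 𝓡 4) h (h hs)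
  simp only [tangentLift]
  rw [Bundle.TotalSpace.mk.injEq]
  exact ⟨h hs, heq_of_eq (DFunLike.congr_fun h1 (1 : ℝ))⟩

theorem natCoord_tangentLift (he : e ∈ IsManifold.maximalAtlas (𝓡 4) ∞ M) (hab : a < b)
    {γ : ℝ → M} {s : ℝ} (hs : s ∈ Icc a b) (hγ : MDifferentiableWithinAt 𝓘(ℝ, ℝ) (𝓡 4) γ (Icc a b) s)
    (hse : γ s ∈ e.source) :
    natCoord e (tangentLift a b γ s) = (e (γ s), derivWithin (e ∘ γ) (Icc a b) s) := by
  have h1 := mfderiv_comp_mfderivWithin s ((mdifferentiable_of_mem_maximalAtlas he).mdifferentiableAt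
    hse) hγ (uniqueDiffOn_Icc hab s hs).uniqueMDiffWithinAt
  rw [mfderivWithin_eq_fderivWithin] at h1
  refine Prod.ext rfl ?_
  rw [derivWithin, h1]
  rfl

theorem contDiffWithinAt_comp_chart {E : Type*} [NormedAddCommGroup E] [NormedSpace ℝ E]
    {n : ℕ∞} (he : e ∈ IsManifold.maximalAtlas (𝓡 4) ∞ M) {γ : E → M} {t : Set E} {x : E}
    (hγ : ContMDiffWithinAt 𝓘(ℝ, E) (𝓡 4) n γ t x) (hx : γ x ∈ e.source) :
    ContDiffWithinAt ℝ n (e ∘ γ) t x := by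
  rw [← contMDiffWithinAt_iff_contDiffWithinAt]
  exact ((contMDiffAt_of_mem_maximalAtlas he hx).of_le
    (by exact_mod_cast le_top)).comp_contMDiffWithinAt x hγ

theorem contDiffWithinAt_natCoord_tangentLift (he : e ∈ IsManifold.maximalAtlas (𝓡 4) ∞ M)
    (hab : a < b) {c : ℝ → M} (hc : ContMDiffOn 𝓘(ℝ, ℝ) (𝓡 4) 2 c (Icc a b))
    (hs : s₀ ∈ Icc a b) (hse : c s₀ ∈ e.source) :
    ContDiffWithinAt ℝ 1 (fun s => natCoord e (tangentLift a b c s)) (Icc a b) s₀ := by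
  have h1 : ContDiffWithinAt ℝ 2 (e ∘ c) (Icc a b) s₀ :=
    contDiffWithinAt_comp_chart (n := 2) he (hc s₀ hs) hse
  have h2 := (h1.of_le (m := 1) (by norm_num)).prodMk
    (h1.derivWithin (m := 1) (uniqueDiffOn_Icc hab) (by norm_num) hs)
  have h3 : ∀ s ∈ Icc a b, c s ∈ e.source → natCoord e (tangentLift a b c s) =
      (e (c s), derivWithin (e ∘ c) (Icc a b) s) := fun s hs h =>
    natCoord_tangentLift he hab hs ((hc s hs).mdifferentiableWithinAt (by simp)) h
  refine h2.congr_of_eventuallyEq ?_ (h3 s₀ hs hse)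
  filter_upwards [self_mem_nhdsWithin,
    (hc s₀ hs).continuousWithinAt (e.open_source.mem_nhds hse)] with s hs h using h3 s hs h

/-- The base component of the derivative of a velocity lift is the velocity. -/
theorem fst_derivWithin_natCoord_tangentLift (he : e ∈ IsManifold.maximalAtlas (𝓡 4) ∞ M)
    (hab : a < b) {c : ℝ → M} (hc : ContMDiffOn 𝓘(ℝ, ℝ) (𝓡 4) 2 c (Icc a b))
    (hs : s₀ ∈ Icc a b) (hse : c s₀ ∈ e.source) :
    (derivWithin (fun s => natCoord e (tangentLift a b c s)) (Icc a b) s₀).1 =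
      (natCoord e (tangentLift a b c s₀)).2 := by
  have h1 := ((contDiffWithinAt_natCoord_tangentLift he hab hc hs hse).differentiableWithinAt
    (by simp)).hasDerivWithinAt
  have h2 : HasDerivWithinAt (e ∘ c)
      (derivWithin (fun s => natCoord e (tangentLift a b c s)) (Icc a b) s₀).1 (Icc a b) s₀ :=
    (ContinuousLinearMap.fst ℝ E4 E4).hasFDerivAt.comp_hasDerivWithinAt s₀ h1
  rw [natCoord_tangentLift he hab hs ((hc s₀ hs).mdifferentiableWithinAt (by simp)) hse]
  exact (h2.derivWithin (uniqueDiffOn_Icc hab s₀ hs)).symm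

namespace FinslerSpacetime

variable (S : FinslerSpacetime M)

/-- The Euler–Lagrange covector of a curve in the coordinates induced by `e`: the value of `dω` on
the velocity of the lifted curve and the vector `(ξ, 0)`. -/
def eulerLagrange (e : OpenPartialHomeomorph M E4) (a b : ℝ) (c : ℝ → M) (s : ℝ) (ξ : E4) : ℝ :=
  extD (hilb (pnorm (S.L ∘ natPoint e))) (natCoord e (tangentLift a b c s))
    (derivWithin (fun s => natCoord e (tangentLift a b c s)) (Icc a b) s) (ξ, 0)

theorem eulerLagrange_congr {γ γ' : ℝ → M} (h : EqOn γ γ' (Icc a b)) {s : ℝ} (hs : s ∈ Icc a b)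
    (ξ : E4) : S.eulerLagrange e a b γ s ξ = S.eulerLagrange e a b γ' s ξ := by
  have h1 : EqOn (fun s => natCoord e (tangentLift a b γ s))
      (fun s => natCoord e (tangentLift a b γ' s)) (Icc a b) := fun s hs => by
    simp only [tangentLift_congr h hs]
  rw [eulerLagrange, eulerLagrange, derivWithin_congr h1 (h1 hs), tangentLift_congr h hs]

theorem continuousWithinAt_eulerLagrange (he : e ∈ IsManifold.maximalAtlas (𝓡 4) ∞ M)
    (hab : a < b) {c : ℝ → M} (hc : ContMDiffOn 𝓘(ℝ, ℝ) (𝓡 4) 2 c (Icc a b))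
    (hs : s₀ ∈ Icc a b) (hse : c s₀ ∈ e.source) (hA : tangentLift a b c s₀ ∈ S.A₀) (ξ : E4) :
    ContinuousWithinAt (fun s => S.eulerLagrange e a b c s ξ) (Icc a b) s₀ := by
  have hz := contDiffWithinAt_natCoord_tangentLift he hab hc hs hse
  have hz' := (hz.derivWithin (m := 0) (uniqueDiffOn_Icc hab) (by norm_num) hs).continuousWithinAt
  have hω := contDiffAt_hilb ((S.isLagrangian he).contDiffAt_pnorm (S.natCoord_mem he hA hse))
  have hdω := (hω.fderiv_right (m := 0) (by norm_cast)).continuousAt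
  have h1 : ContinuousWithinAt (fun s => fderiv ℝ (hilb (pnorm (S.L ∘ natPoint e)))
      (natCoord e (tangentLift a b c s))) (Icc a b) s₀ :=
    ContinuousAt.comp_continuousWithinAt (f := fun s => natCoord e (tangentLift a b c s)) hdω
      hz.continuousWithinAt
  exact ((h1.clm_apply hz').clm_apply continuousWithinAt_const).sub
    ((h1.clm_apply continuousWithinAt_const).clm_apply hz')

/-- The value of `dω` on the velocity of a lifted curve and any vector `Z` depends only on the base
component of `Z`. -/
theorem extD_eq_eulerLagrange (he : e ∈ IsManifold.maximalAtlas (𝓡 4) ∞ M)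
    (hab : a < b) {c : ℝ → M} (hc : ContMDiffOn 𝓘(ℝ, ℝ) (𝓡 4) 2 c (Icc a b))
    (hs : s₀ ∈ Icc a b) (hse : c s₀ ∈ e.source) (hA : tangentLift a b c s₀ ∈ S.A₀) (Z : E4 × E4) :
    extD (hilb (pnorm (S.L ∘ natPoint e))) (natCoord e (tangentLift a b c s₀))
      (derivWithin (fun s => natCoord e (tangentLift a b c s)) (Icc a b) s₀) Z =
        S.eulerLagrange e a b c s₀ Z.1 := by
  have hL := S.isLagrangian he
  have hz := S.natCoord_mem he hA hse
  rw [eulerLagrange, hL.extD_hilb hz, hL.extD_hilb hz,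
    fst_derivWithin_natCoord_tangentLift he hab hc hs hse, hL.euler_pnorm_snd hz,
    hL.euler_pnorm_snd hz]

/-- The canonical lift of a curve parametrized by arc length is tangent to the Reeb field at a point
exactly where the Euler–Lagrange covector vanishes. -/
theorem hasMFDerivWithinAt_canonicalLift_iff (hab : a < b) {c : ℝ → M} {C : ℝ → PTM M}
    (hc : ContMDiffOn 𝓘(ℝ, ℝ) (𝓡 4) 2 c (Icc a b))
    (hA : ∀ s ∈ Icc a b, tangentLift a b c s ∈ S.A₀)
    (hF : ∀ s ∈ Icc a b, S.F (tangentLift a b c s) = 1) (hC : IsCanonicalLift a b c C)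
    (hs : s₀ ∈ Icc a b) :
    ∃ e ∈ IsManifold.maximalAtlas (𝓡 4) ∞ M, c s₀ ∈ e.source ∧
      (HasMFDerivWithinAt 𝓘(ℝ, ℝ) 𝓘(ℝ, E4 × E3) C (Icc a b) s₀
        ((1 : ℝ →L[ℝ] ℝ).smulRight (S.reeb (C s₀))) ↔
          ∀ ξ, S.eulerLagrange e a b c s₀ ξ = 0) := by
  obtain ⟨hne, hCs⟩ := hC s₀ hs
  set q : slit M := ⟨tangentLift a b c s₀, hne⟩ with hq
  have hqA : (q : TanB M) ∈ S.A₀ := hA s₀ hs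
  obtain ⟨x₀, i, σ, hσ, hch⟩ := chartAt_eq_ptmChart (toPTM q)
  have he := chartAt_mem x₀
  have hdom := mem_ptmDomain_of_chartAt hch (mem_chart_source _ _)
  have hse : c s₀ ∈ (chartAt E4 x₀).source := hdom.1
  refine ⟨chartAt E4 x₀, he, hse, ?_⟩
  set e := chartAt E4 x₀ with hedef
  have hL := S.isLagrangian he
  have hzU := S.natCoord_mem he hqA hdom.1
  have hz := contDiffWithinAt_natCoord_tangentLift he hab hc hs hse
  have hzd := (hz.differentiableWithinAt (by simp)).hasDerivWithinAt
  have hpos := natCoord_pos hdom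
  have hproj : ContDiffAt ℝ ∞ (affProj i) (natCoord e (tangentLift a b c s₀)) :=
    contDiffAt_affProj (right_ne_zero_of_mul hpos.ne')
  -- Near `s₀` the curve `C` stays in the domain of the preferred chart at `C s₀`.
  have hev : ∀ᶠ s in 𝓝[Icc a b] s₀, C s ∈ (chartAt (E4 × E3) (toPTM q)).source ∧
      extChartAt 𝓘(ℝ, E4 × E3) (toPTM q) (C s) = affProj i (natCoord e (tangentLift a b c s)) := by
    have h1 : ∀ᶠ s in 𝓝[Icc a b] s₀, 0 < σ * (natCoord e (tangentLift a b c s)).2 i := by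
      have : ContinuousAt (fun z : E4 × E4 => σ * z.2 i) (natCoord e (tangentLift a b c s₀)) := by
        fun_prop
      exact (this.comp_continuousWithinAt (f := fun s => natCoord e (tangentLift a b c s))
        hz.continuousWithinAt).eventually (lt_mem_nhds hpos)
    filter_upwards [self_mem_nhdsWithin,
      (hc s₀ hs).continuousWithinAt (e.open_source.mem_nhds hse), h1] with s hs' hs1 hs2
    obtain ⟨hne', hCs'⟩ := hC s hs'
    have hb : (tangentLift a b c s).1 ∈ (chartAt E4 x₀).source := hs1
    rw [hCs', extChartAt_eq_ptmCoord hch, hch]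
    refine ⟨⟨_, ⟨hb, ?_⟩, rfl⟩, ptmCoord_toPTM' (q := ⟨tangentLift a b c s, hne'⟩) hb⟩
    rw [tanChart_eq_natCoord x₀ hb]
    exact hs2
  have hext₀ : extChartAt 𝓘(ℝ, E4 × E3) (toPTM q) (C s₀) =
      affProj i (natCoord e (tangentLift a b c s₀)) := (hev.self_of_nhdsWithin hs).2
  have hcont : ContinuousWithinAt C (Icc a b) s₀ := by
    have h1 : ContinuousWithinAt (fun s => affProj i (natCoord e (tangentLift a b c s)))
        (Icc a b) s₀ :=
      ContinuousAt.comp_continuousWithinAt (f := fun s => natCoord e (tangentLift a b c s))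
        hproj.continuousAt hz.continuousWithinAt
    have h2 : ContinuousAt (extChartAt 𝓘(ℝ, E4 × E3) (toPTM q)).symm
        (affProj i (natCoord e (tangentLift a b c s₀))) := by
      rw [← hext₀, hCs]
      exact continuousAt_extChartAt_symm _
    have h3 : ∀ s, C s ∈ (chartAt (E4 × E3) (toPTM q)).source ∧
        extChartAt 𝓘(ℝ, E4 × E3) (toPTM q) (C s) = affProj i (natCoord e (tangentLift a b c s)) →
        C s = (extChartAt 𝓘(ℝ, E4 × E3) (toPTM q)).symm
          (affProj i (natCoord e (tangentLift a b c s))) := fun s h => by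
      rw [← h.2, (extChartAt 𝓘(ℝ, E4 × E3) (toPTM q)).left_inv (by rw [extChartAt_source]; exact h.1)]
    refine (ContinuousAt.comp_continuousWithinAt
      (f := fun s => affProj i (natCoord e (tangentLift a b c s))) h2 h1).congr_of_eventuallyEq ?_
      (h3 s₀ (hev.self_of_nhdsWithin hs))
    filter_upwards [hev] with s h using h3 s h
  have hder : HasDerivWithinAt (fun s => extChartAt 𝓘(ℝ, E4 × E3) (toPTM q) (C s))
      (fderiv ℝ (affProj i) (natCoord e (tangentLift a b c s₀))
        (derivWithin (fun s => natCoord e (tangentLift a b c s)) (Icc a b) s₀)) (Icc a b) s₀ := by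
    refine (HasFDerivAt.comp_hasDerivWithinAt (f := fun s => natCoord e (tangentLift a b c s)) s₀
      (hproj.differentiableAt (by simp)).hasFDerivAt hzd).congr_of_eventuallyEq ?_ hext₀
    filter_upwards [hev] with s h using h.2
  obtain ⟨X, hX⟩ := dNatCoord_surjective he hdom.1
    (derivWithin (fun s => natCoord e (tangentLift a b c s)) (Icc a b) s₀)
  have h1 : HasMFDerivWithinAt 𝓘(ℝ, ℝ) 𝓘(ℝ, E4 × E3) C (Icc a b) s₀
      ((1 : ℝ →L[ℝ] ℝ).smulRight (S.reeb (C s₀))) ↔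
      HasDerivWithinAt (fun s => extChartAt 𝓘(ℝ, E4 × E3) (toPTM q) (C s))
        (S.reeb (toPTM q) : E4 × E3) (Icc a b) s₀ := by
    rw [← hCs]
    refine (and_iff_right hcont).trans ?_
    simp only [writtenInExtChartAt, mfld_simps]
    rfl
  have h2 : HasDerivWithinAt (fun s => extChartAt 𝓘(ℝ, E4 × E3) (toPTM q) (C s))
        (S.reeb (toPTM q) : E4 × E3) (Icc a b) s₀ ↔
      mfderiv (𝓡 4).tangent 𝓘(ℝ, E4 × E3) toPTM q X = S.reeb (toPTM q) := by
    rw [mfderiv_toPTM_eq hch, hX]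
    refine ⟨fun h => ?_, fun h => ?_⟩
    · exact UniqueDiffWithinAt.eq_deriv (F := E4 × E3) _ (uniqueDiffOn_Icc hab s₀ hs) hder h
    · exact hder.congr_deriv h
  have hqp : toPTM q ∈ S.A₀plus := ⟨q, hqA, rfl⟩
  have h3 : mfderiv (𝓡 4).tangent 𝓘(ℝ, E4 × E3) toPTM q X = S.reeb (toPTM q) ↔
      S.IsReebVec (toPTM q) (mfderiv (𝓡 4).tangent 𝓘(ℝ, E4 × E3) toPTM q X) :=
    ⟨fun h => h ▸ S.isReebVec_reeb hqp, fun h => S.isReebVec_unique hqp h (S.isReebVec_reeb hqp)⟩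
  have hnorm : hilb (pnorm (S.L ∘ natPoint e)) (natCoord e (tangentLift a b c s₀))
      (derivWithin (fun s => natCoord e (tangentLift a b c s)) (Icc a b) s₀) = 1 := by
    rw [hilb_apply, fst_derivWithin_natCoord_tangentLift he hab hc hs hse, hL.euler_pnorm hzU,
      S.pnorm_natCoord he hdom.1, hF s₀ hs]
  rw [h1, h2, h3, S.isReebVec_iff hch hqA, hX]
  refine ⟨fun h ξ => h.2 _, fun h => ⟨hnorm, fun Z => ?_⟩⟩
  exact (S.extD_eq_eulerLagrange he hab hc hs hse hqA Z).trans (h _)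

end FinslerSpacetime

end Lift

/-! ### The first variation of arc length -/

section Variation

variable {M : Type*} [TopologicalSpace M] [ChartedSpace E4 M] [IsManifold (𝓡 4) ∞ M]
  {e : OpenPartialHomeomorph M E4} {r a b s₀ : ℝ} {Γ : ℝ → ℝ → M}

theorem mdifferentiableWithinAt_slice {p : ℝ × ℝ} (hp : p ∈ strip r a b)
    (hΓ : ContMDiffOn 𝓘(ℝ, ℝ × ℝ) (𝓡 4) 2 (fun z : ℝ × ℝ => Γ z.1 z.2) (strip r a b)) :
    MDifferentiableWithinAt 𝓘(ℝ, ℝ) (𝓡 4) (Γ p.1) (Icc a b) p.2 := by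
  have h1 : MDifferentiableWithinAt 𝓘(ℝ, ℝ) 𝓘(ℝ, ℝ × ℝ) (fun s : ℝ => (p.1, s)) (Icc a b) p.2 := by
    rw [mdifferentiableWithinAt_iff_differentiableWithinAt]
    fun_prop
  have hm : MapsTo (fun s : ℝ => (p.1, s)) (Icc a b) (strip r a b) := fun s hs => ⟨hp.1, hs⟩
  exact MDifferentiableWithinAt.comp (g := fun z : ℝ × ℝ => Γ z.1 z.2) p.2
    ((hΓ p hp).mdifferentiableWithinAt (by simp)) h1 hm

theorem natCoord_variation (he : e ∈ IsManifold.maximalAtlas (𝓡 4) ∞ M) (hab : a < b)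
    (hΓ : ContMDiffOn 𝓘(ℝ, ℝ × ℝ) (𝓡 4) 2 (fun z : ℝ × ℝ => Γ z.1 z.2) (strip r a b))
    {p : ℝ × ℝ} (hp : p ∈ strip r a b) (hpe : Γ p.1 p.2 ∈ e.source) :
    natCoord e (tangentLift a b (Γ p.1) p.2) =
      flatLift r a b (e ∘ fun z : ℝ × ℝ => Γ z.1 z.2) p := by
  have h1 : ContDiffWithinAt ℝ 2 (e ∘ fun z : ℝ × ℝ => Γ z.1 z.2) (strip r a b) p :=
    contDiffWithinAt_comp_chart (n := 2) he (hΓ p hp) hpe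
  have h2 := hasDerivWithinAt_slice hp.1 (h1.differentiableWithinAt (by simp))
  rw [natCoord_tangentLift he hab hp.2 (mdifferentiableWithinAt_slice hp hΓ) hpe]
  exact Prod.ext rfl (h2.derivWithin (uniqueDiffOn_Icc hab _ hp.2))

/-- If the base point at parameter `s` is fixed, the variation field vanishes there. -/
theorem fderivWithin_variation_eq_zero (he : e ∈ IsManifold.maximalAtlas (𝓡 4) ∞ M) (hr : 0 < r)
    (hΓ : ContMDiffOn 𝓘(ℝ, ℝ × ℝ) (𝓡 4) 2 (fun z : ℝ × ℝ => Γ z.1 z.2) (strip r a b))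
    {s : ℝ} (hs : s ∈ Icc a b) (hse : Γ 0 s ∈ e.source) {x : M}
    (hx : ∀ t ∈ Ioo (-r) r, Γ t s = x) :
    fderivWithin ℝ (e ∘ fun z : ℝ × ℝ => Γ z.1 z.2) (strip r a b) (0, s) (1, 0) = 0 := by
  have hmem := mem_strip_zero hr hs
  have h1 : ContDiffWithinAt ℝ 2 (e ∘ fun z : ℝ × ℝ => Γ z.1 z.2) (strip r a b) (0, s) :=
    contDiffWithinAt_comp_chart (n := 2) he (hΓ _ hmem) hse
  refine (hasDerivAt_slice hmem.1 hs (h1.differentiableWithinAt (by simp))).unique ?_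
  refine (hasDerivAt_const (0 : ℝ) (e x)).congr_of_eventuallyEq ?_
  filter_upwards [isOpen_Ioo.mem_nhds hmem.1] with t ht
  simp only [Function.comp_apply, hx t ht]

namespace FinslerSpacetime

variable (S : FinslerSpacetime M)

/-- The integrand `F(γ, γ̇)` of the length functional along a variation. -/
def speed (a b : ℝ) (Γ : ℝ → ℝ → M) (p : ℝ × ℝ) : ℝ := S.F (tangentLift a b (Γ p.1) p.2)

/-- The value `F_{·i} y^i` of the fibre derivative of `F` on the variation field. -/
def momentum (r a b : ℝ) (Γ : ℝ → ℝ → M) (s : ℝ) : ℝ :=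
  S.fibDeriv (tangentLift a b (Γ 0) s)
    (mfderivWithin 𝓘(ℝ, ℝ × ℝ) (𝓡 4) (fun z : ℝ × ℝ => Γ z.1 z.2) (strip r a b) (0, s)
      ((1, 0) : ℝ × ℝ) : E4)

theorem speed_eventuallyEq (he : e ∈ IsManifold.maximalAtlas (𝓡 4) ∞ M) (hab : a < b)
    (hΓ : ContMDiffOn 𝓘(ℝ, ℝ × ℝ) (𝓡 4) 2 (fun z : ℝ × ℝ => Γ z.1 z.2) (strip r a b))
    {p : ℝ × ℝ} (hp : p ∈ strip r a b) (hpe : Γ p.1 p.2 ∈ e.source) :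
    S.speed a b Γ =ᶠ[𝓝[strip r a b] p] pnorm (S.L ∘ natPoint e) ∘
      flatLift r a b (e ∘ fun z : ℝ × ℝ => Γ z.1 z.2) := by
  have h1 : ∀ᶠ z in 𝓝[strip r a b] p, Γ z.1 z.2 ∈ e.source :=
    (hΓ p hp).continuousWithinAt (e.open_source.mem_nhds hpe)
  filter_upwards [self_mem_nhdsWithin, h1] with z hz hze
  rw [Function.comp_apply, ← natCoord_variation he hab hΓ hz hze, S.pnorm_natCoord he hze]
  rfl

theorem contDiffWithinAt_speed (hab : a < b) (hr : 0 < r)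
    (hΓ : ContMDiffOn 𝓘(ℝ, ℝ × ℝ) (𝓡 4) 2 (fun z : ℝ × ℝ => Γ z.1 z.2) (strip r a b))
    (hs : s₀ ∈ Icc a b) (hA : tangentLift a b (Γ 0) s₀ ∈ S.A₀) :
    ContDiffWithinAt ℝ 1 (S.speed a b Γ) (strip r a b) (0, s₀) := by
  have hmem := mem_strip_zero hr hs
  have he := chartAt_mem (Γ 0 s₀)
  have hse := mem_chart_source E4 (Γ 0 s₀)
  have hev := S.speed_eventuallyEq he hab hΓ hmem hse
  refine ContDiffWithinAt.congr_of_eventuallyEq ?_ hev (hev.self_of_nhdsWithin hmem)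
  have h1 := contDiffWithinAt_flatLift hab hmem (contDiffWithinAt_comp_chart (n := 2) he
    (hΓ _ hmem) hse)
  refine ContDiffAt.comp_contDiffWithinAt _ ?_ h1
  rw [← natCoord_variation he hab hΓ hmem hse]
  exact ((S.isLagrangian he).contDiffAt_pnorm (S.natCoord_mem he hA hse)).of_le
    (by exact_mod_cast le_top)

theorem momentum_eq (he : e ∈ IsManifold.maximalAtlas (𝓡 4) ∞ M) (hab : a < b) (hr : 0 < r)
    (hΓ : ContMDiffOn 𝓘(ℝ, ℝ × ℝ) (𝓡 4) 2 (fun z : ℝ × ℝ => Γ z.1 z.2) (strip r a b))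
    {s : ℝ} (hs : s ∈ Icc a b) (hse : Γ 0 s ∈ e.source) (hA : tangentLift a b (Γ 0) s ∈ S.A₀) :
    S.momentum r a b Γ s = fderiv ℝ (pnorm (S.L ∘ natPoint e))
      (flatLift r a b (e ∘ fun z : ℝ × ℝ => Γ z.1 z.2) (0, s))
      (0, fderivWithin ℝ (e ∘ fun z : ℝ × ℝ => Γ z.1 z.2) (strip r a b) (0, s) (1, 0)) := by
  have hmem := mem_strip_zero hr hs
  have h1 := mfderiv_comp_mfderivWithin (f := fun z : ℝ × ℝ => Γ z.1 z.2) ((0 : ℝ), s)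
    ((mdifferentiable_of_mem_maximalAtlas he).mdifferentiableAt hse)
    ((hΓ _ hmem).mdifferentiableWithinAt (by simp))
    (uniqueDiffOn_strip hab _ hmem).uniqueMDiffWithinAt
  rw [mfderivWithin_eq_fderivWithin] at h1
  rw [← natCoord_variation he hab hΓ hmem hse, h1]
  exact S.fibDeriv_apply he hA hse _

/-- The first variation formula before integration. -/
theorem hasDerivWithinAt_momentum (he : e ∈ IsManifold.maximalAtlas (𝓡 4) ∞ M) (hab : a < b)
    (hr : 0 < r)
    (hΓ : ContMDiffOn 𝓘(ℝ, ℝ × ℝ) (𝓡 4) 2 (fun z : ℝ × ℝ => Γ z.1 z.2) (strip r a b))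
    (hA : ∀ s ∈ Icc a b, tangentLift a b (Γ 0) s ∈ S.A₀) (hs : s₀ ∈ Icc a b)
    (hse : Γ 0 s₀ ∈ e.source) :
    HasDerivWithinAt (S.momentum r a b Γ)
      (fderivWithin ℝ (S.speed a b Γ) (strip r a b) (0, s₀) (1, 0) +
        S.eulerLagrange e a b (Γ 0) s₀
          (fderivWithin ℝ (e ∘ fun z : ℝ × ℝ => Γ z.1 z.2) (strip r a b) (0, s₀) (1, 0)))
      (Icc a b) s₀ := by
  have hmem := mem_strip_zero hr hs
  have hy : ContDiffWithinAt ℝ 2 (e ∘ fun z : ℝ × ℝ => Γ z.1 z.2) (strip r a b) (0, s₀) :=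
    contDiffWithinAt_comp_chart (n := 2) he (hΓ _ hmem) hse
  have hsrc : ∀ᶠ s in 𝓝[Icc a b] s₀, Γ 0 s ∈ e.source :=
    (mdifferentiableWithinAt_slice hmem hΓ).continuousWithinAt (e.open_source.mem_nhds hse)
  have hN := natCoord_variation he hab hΓ hmem hse
  have hU := S.natCoord_mem he (hA s₀ hs) hse
  have h1 := (S.isLagrangian he).hasDerivWithinAt_momentum hr hab hs hy (hN ▸ hU)
  have h2 : derivWithin (fun s => natCoord e (tangentLift a b (Γ 0) s)) (Icc a b) s₀ =
      fderivWithin ℝ (flatLift r a b (e ∘ fun z : ℝ × ℝ => Γ z.1 z.2)) (strip r a b) (0, s₀)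
        (0, 1) := by
    refine HasDerivWithinAt.derivWithin (HasDerivWithinAt.congr_of_eventuallyEq
      (hasDerivWithinAt_slice hmem.1 ((contDiffWithinAt_flatLift hab hmem
        hy).differentiableWithinAt (by simp))) ?_ hN) (uniqueDiffOn_Icc hab s₀ hs)
    filter_upwards [self_mem_nhdsWithin, hsrc] with s hs' hs1
    exact natCoord_variation he hab hΓ (mem_strip_zero hr hs') hs1
  rw [(S.speed_eventuallyEq he hab hΓ hmem hse).fderivWithin_eq_of_mem hmem, eulerLagrange, h2, hN]
  refine h1.congr_of_eventuallyEq ?_ (S.momentum_eq he hab hr hΓ hs hse (hA s₀ hs))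
  filter_upwards [self_mem_nhdsWithin, hsrc] with s hs' hs1
  exact S.momentum_eq he hab hr hΓ hs' hs1 (hA s hs')

/-- The first variation formula for a variation with fixed endpoints: `K` is the Euler–Lagrange covector evaluated on the variation
field. -/
theorem hasDerivAt_length (hab : a < b) (hr : 0 < r)
    (hΓ : ContMDiffOn 𝓘(ℝ, ℝ × ℝ) (𝓡 4) 2 (fun z : ℝ × ℝ => Γ z.1 z.2) (strip r a b))
    (hA : ∀ s ∈ Icc a b, tangentLift a b (Γ 0) s ∈ S.A₀) {xa xb : M}
    (hends : ∀ t ∈ Ioo (-r) r, Γ t a = xa ∧ Γ t b = xb) {K : ℝ → ℝ} (hKc : ContinuousOn K (Icc a b))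
    (hK : ∀ s ∈ Icc a b, ∃ e ∈ IsManifold.maximalAtlas (𝓡 4) ∞ M, Γ 0 s ∈ e.source ∧
      S.eulerLagrange e a b (Γ 0) s
        (fderivWithin ℝ (e ∘ fun z : ℝ × ℝ => Γ z.1 z.2) (strip r a b) (0, s) (1, 0)) = K s) :
    HasDerivAt (fun t => S.length a b (Γ t)) (-∫ s in a..b, K s) 0 := by
  have hspeed : ∀ s ∈ Icc a b, ContDiffWithinAt ℝ 1 (S.speed a b Γ) (strip r a b) (0, s) :=
    fun s hs => S.contDiffWithinAt_speed hab hr hΓ hs (hA s hs)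
  have hhc := continuousOn_fderivWithin_strip hr hab hspeed (1, 0)
  have hmom : ∀ s ∈ Icc a b, HasDerivWithinAt (S.momentum r a b Γ)
      (fderivWithin ℝ (S.speed a b Γ) (strip r a b) (0, s) (1, 0) + K s) (Icc a b) s := by
    intro s hs
    obtain ⟨e, he, hse, hKs⟩ := hK s hs
    rw [← hKs]
    exact S.hasDerivWithinAt_momentum he hab hr hΓ hA hs hse
  have hzero : ∀ s ∈ Icc a b, ∀ x, (∀ t ∈ Ioo (-r) r, Γ t s = x) → S.momentum r a b Γ s = 0 := by
    intro s hs x hx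
    rw [S.momentum_eq (chartAt_mem (Γ 0 s)) hab hr hΓ hs (mem_chart_source _ _) (hA s hs),
      fderivWithin_variation_eq_zero (chartAt_mem (Γ 0 s)) hr hΓ hs (mem_chart_source _ _) hx]
    exact map_zero _
  have hi : ∀ {f : ℝ → ℝ}, ContinuousOn f (Icc a b) →
      IntervalIntegrable f MeasureTheory.volume a b := fun hf =>
    ContinuousOn.intervalIntegrable (by rwa [uIcc_of_le hab.le])
  have h1 := intervalIntegral.integral_eq_sub_of_hasDerivAt_of_le hab.le
    (fun s hs => (hmom s hs).continuousWithinAt)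
    (fun s hs => (hmom s (Ioo_subset_Icc_self hs)).hasDerivAt (Icc_mem_nhds hs.1 hs.2))
    (hi (hhc.add hKc))
  rw [intervalIntegral.integral_add (hi hhc) (hi hKc),
    hzero a (left_mem_Icc.2 hab.le) xa fun t ht => (hends t ht).1,
    hzero b (right_mem_Icc.2 hab.le) xb fun t ht => (hends t ht).2, sub_zero] at h1
  rw [← eq_neg_of_add_eq_zero_left h1]
  exact hasDerivAt_integral_strip hr hab hspeed

theorem eulerLagrange_smul (c : ℝ → M) (s t : ℝ) (ξ : E4) :
    S.eulerLagrange e a b c s (t • ξ) = t * S.eulerLagrange e a b c s ξ := by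
  have : ((t • ξ, 0) : E4 × E4) = t • (ξ, 0) := by simp
  simp only [eulerLagrange, extD, this, map_smul, smul_apply, smul_eq_mul]
  ring

theorem eulerLagrange_zero (c : ℝ → M) (s : ℝ) : S.eulerLagrange e a b c s 0 = 0 := by
  simpa using S.eulerLagrange_smul (e := e) (a := a) (b := b) c s 0 0

theorem eulerLagrange_neg (c : ℝ → M) (s : ℝ) (ξ : E4) :
    S.eulerLagrange e a b c s (-ξ) = -S.eulerLagrange e a b c s ξ := by
  rw [← neg_one_smul ℝ ξ, eulerLagrange_smul, neg_one_mul]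

/-- A curve is a geodesic if at each parameter its Euler–Lagrange covector vanishes in some chart. -/
theorem isGeodesic_of_eulerLagrange {k : ℕ∞} (hk : 2 ≤ k) (hab : a < b) {c : ℝ → M}
    (hA : ∀ s ∈ Icc a b, tangentLift a b c s ∈ S.A₀)
    (h : ∀ s ∈ Icc a b, ∃ e ∈ IsManifold.maximalAtlas (𝓡 4) ∞ M, c s ∈ e.source ∧
      ∀ ξ, S.eulerLagrange e a b c s ξ = 0) : S.IsGeodesic k a b c := by
  intro r Γ hr hΓ h0 hends
  have hΓ2 : ContMDiffOn 𝓘(ℝ, ℝ × ℝ) (𝓡 4) 2 (fun z : ℝ × ℝ => Γ z.1 z.2) (strip r a b) :=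
    hΓ.of_le (WithTop.coe_le_coe.2 hk)
  have h1 := S.hasDerivAt_length hab hr hΓ2 (fun s hs => tangentLift_congr h0 hs ▸ hA s hs) hends
    (K := fun _ => 0) continuousOn_const fun s hs => by
      obtain ⟨e, he, hse, hE⟩ := h s hs
      exact ⟨e, he, h0 s hs ▸ hse, by rw [S.eulerLagrange_congr h0 hs, hE]⟩
  simpa using h1

end FinslerSpacetime

end Variation

/-! ### Geodesics are the projections of the integral curves of the Reeb field -/

section Converse

variable {M : Type*} [TopologicalSpace M] [ChartedSpace E4 M] [IsManifold (𝓡 4) ∞ M]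
  {e : OpenPartialHomeomorph M E4} {r a b s₀ : ℝ} {c : ℝ → M}

open Classical in
/-- The variation of `c` which, in the chart `e`, translates the points with parameter in `B` by
`t φ(s) ξ`. -/
def bumpVariation (e : OpenPartialHomeomorph M E4) (c : ℝ → M) (B : Set ℝ) (φ : ℝ → ℝ) (ξ : E4)
    (t s : ℝ) : M :=
  if s ∈ B then e.symm (e (c s) + (t * φ s) • ξ) else c s

variable {B : Set ℝ} {φ : ℝ → ℝ} {ξ : E4}

theorem bumpVariation_of_mem {s : ℝ} (hs : s ∈ B) (t : ℝ) :
    bumpVariation e c B φ ξ t s = e.symm (e (c s) + (t * φ s) • ξ) := if_pos hs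

theorem bumpVariation_of_eq_zero (hB : ∀ s ∈ B ∩ Icc a b, c s ∈ e.source) {s t : ℝ}
    (hs : s ∈ Icc a b) (h : t * φ s = 0) : bumpVariation e c B φ ξ t s = c s := by
  by_cases hsB : s ∈ B
  · rw [bumpVariation_of_mem hsB, h, zero_smul, add_zero, e.left_inv (hB s ⟨hsB, hs⟩)]
  · exact if_neg hsB

theorem contMDiffOn_bumpVariation {k : ℕ∞} (he : e ∈ IsManifold.maximalAtlas (𝓡 4) ∞ M)
    (hc : ContMDiffOn 𝓘(ℝ, ℝ) (𝓡 4) k c (Icc a b)) (hBo : IsOpen B)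
    (hB : ∀ s ∈ B ∩ Icc a b, c s ∈ e.source) (hφ : ContDiff ℝ ∞ φ) (hφB : tsupport φ ⊆ B)
    (hr : ∀ t ∈ Ioo (-r) r, ∀ s ∈ B ∩ Icc a b, e (c s) + (t * φ s) • ξ ∈ e.target) :
    ContMDiffOn 𝓘(ℝ, ℝ × ℝ) (𝓡 4) k (fun z : ℝ × ℝ => bumpVariation e c B φ ξ z.1 z.2)
      (strip r a b) := by
  rintro ⟨t, s⟩ ⟨ht, hs⟩
  have hsnd : ContMDiff 𝓘(ℝ, ℝ × ℝ) 𝓘(ℝ, ℝ) k (Prod.snd : ℝ × ℝ → ℝ) :=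
    contDiff_snd.contMDiff
  have hc2 : ContMDiffWithinAt 𝓘(ℝ, ℝ × ℝ) (𝓡 4) k (fun z : ℝ × ℝ => c z.2) (strip r a b) (t, s) :=
    ContMDiffWithinAt.comp (g := c) (t, s) (hc s hs) (hsnd _).contMDiffWithinAt fun z hz => hz.2
  by_cases hsB : s ∈ B
  · have h1 : ContDiffWithinAt ℝ k (fun z : ℝ × ℝ => e (c z.2) + (z.1 * φ z.2) • ξ)
        (strip r a b) (t, s) := by
      have h2 : ContDiffWithinAt ℝ k (e ∘ fun z : ℝ × ℝ => c z.2) (strip r a b) (t, s) :=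
        contDiffWithinAt_comp_chart he hc2 (hB s ⟨hsB, hs⟩)
      have h3 : ContDiff ℝ k fun z : ℝ × ℝ => (z.1 * φ z.2) • ξ :=
        (contDiff_fst.mul ((hφ.of_le (by exact_mod_cast le_top)).comp contDiff_snd)).smul
          contDiff_const
      exact h2.add h3.contDiffWithinAt
    have h4 : ContMDiffAt 𝓘(ℝ, E4) (𝓡 4) k e.symm (e (c s) + (t * φ s) • ξ) :=
      ((contMDiffOn_symm_of_mem_maximalAtlas he).contMDiffAt
        (e.open_target.mem_nhds (hr t ht s ⟨hsB, hs⟩))).of_le (by exact_mod_cast le_top)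
    refine (ContMDiffAt.comp_contMDiffWithinAt
      (f := fun z : ℝ × ℝ => e (c z.2) + (z.1 * φ z.2) • ξ) (t, s) h4
      h1.contMDiffWithinAt).congr_of_eventuallyEq ?_ (bumpVariation_of_mem hsB t)
    filter_upwards [mem_nhdsWithin_of_mem_nhds ((hBo.preimage continuous_snd).mem_nhds hsB)]
      with z hz using bumpVariation_of_mem hz _
  · have hs' : s ∈ (tsupport φ)ᶜ := fun h => hsB (hφB h)
    have h0 : ∀ z ∈ strip r a b, z.2 ∈ (tsupport φ)ᶜ →
        bumpVariation e c B φ ξ z.1 z.2 = c z.2 := fun z hz h => by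
      refine bumpVariation_of_eq_zero hB hz.2 ?_
      rw [image_eq_zero_of_notMem_tsupport h, mul_zero]
    refine hc2.congr_of_eventuallyEq ?_ (h0 _ ⟨ht, hs⟩ hs')
    filter_upwards [self_mem_nhdsWithin, mem_nhdsWithin_of_mem_nhds
      (((isClosed_tsupport φ).isOpen_compl.preimage continuous_snd).mem_nhds hs')] with z hz hz'
      using h0 z hz hz'

namespace FinslerSpacetime

variable (S : FinslerSpacetime M)

/-- The Euler–Lagrange covector of a geodesic is nowhere positive on any `ξ`, and hence vanishes: a
bump function supported where it is positive on `ξ` would give a variation with negative first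
derivative of the length. -/
theorem eulerLagrange_nonpos_of_isGeodesic {k : ℕ∞} (hk : 2 ≤ k) (hab : a < b)
    (hc : ContMDiffOn 𝓘(ℝ, ℝ) (𝓡 4) k c (Icc a b))
    (hA : ∀ s ∈ Icc a b, tangentLift a b c s ∈ S.A₀) (hgeo : S.IsGeodesic k a b c)
    (he : e ∈ IsManifold.maximalAtlas (𝓡 4) ∞ M) (hs : s₀ ∈ Icc a b) (hse : c s₀ ∈ e.source)
    (ξ : E4) : S.eulerLagrange e a b c s₀ ξ ≤ 0 := by
  by_contra! hpos
  have hc2 : ContMDiffOn 𝓘(ℝ, ℝ) (𝓡 4) 2 c (Icc a b) := hc.of_le (WithTop.coe_le_coe.2 hk)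
  obtain ⟨ρ, hρ, hball⟩ := Metric.isOpen_iff.1 e.open_target _ (e.map_source hse)
  have hcont := (contDiffWithinAt_natCoord_tangentLift he hab hc2 hs hse).continuousWithinAt.fst
  have hev : ∀ᶠ s in 𝓝[Icc a b] s₀, c s ∈ e.source ∧ e (c s) ∈ Metric.ball (e (c s₀)) (ρ / 2) ∧
      0 < S.eulerLagrange e a b c s ξ := by
    filter_upwards [(hc s₀ hs).continuousWithinAt (e.open_source.mem_nhds hse),
      hcont (Metric.ball_mem_nhds _ (half_pos hρ)),
      (S.continuousWithinAt_eulerLagrange he hab hc2 hs hse (hA s₀ hs) ξ).eventually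
        (lt_mem_nhds hpos)] with s h1 h2 h3 using ⟨h1, h2, h3⟩
  obtain ⟨ε, hε, hB⟩ := Metric.mem_nhdsWithin_iff.1 hev
  set B := Metric.ball s₀ ε with hBdef
  have hBsrc : ∀ s ∈ B ∩ Icc a b, c s ∈ e.source := fun s hs => (hB hs).1
  -- If `s₀` is an endpoint, the support of the bump function cannot be centred at `s₀`.
  obtain ⟨m, hm⟩ : (B ∩ Ioo a b).Nonempty := by
    refine mem_closure_iff_nhds.1 ?_ B (Metric.ball_mem_nhds s₀ hε)
    rwa [closure_Ioo hab.ne]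
  obtain ⟨δ, hδ, hδB⟩ := Metric.nhds_basis_closedBall.mem_iff.1
    ((Metric.isOpen_ball.inter isOpen_Ioo).mem_nhds hm)
  let φ : ContDiffBump m := ⟨δ / 2, δ, half_pos hδ, half_lt_self hδ⟩
  have hφsupp : tsupport φ = Metric.closedBall m δ := φ.tsupport_eq
  have hφB : tsupport φ ⊆ B := hφsupp ▸ fun s hs => (hδB hs).1
  have hφ0 : ∀ s, s ∉ B ∩ Ioo a b → φ s = 0 := fun s hs =>
    image_eq_zero_of_notMem_tsupport fun h => hs (hδB (hφsupp ▸ h))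
  -- For `|t| < r` the translated points move by less than `ρ / 2` and stay in the chart.
  set r := ρ / (2 * (‖ξ‖ + 1)) with hrdef
  have hr : 0 < r := by positivity
  have htarget : ∀ t ∈ Ioo (-r) r, ∀ s ∈ B ∩ Icc a b, e (c s) + (t * φ s) • ξ ∈ e.target := by
    intro t ht s hs
    refine hball ?_
    have h1 : ‖(t * φ s) • ξ‖ ≤ ρ / 2 := by
      rw [norm_smul, norm_mul, Real.norm_eq_abs, Real.norm_eq_abs, abs_of_nonneg φ.nonneg]
      calc |t| * φ s * ‖ξ‖ ≤ r * 1 * (‖ξ‖ + 1) := by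
            have := φ.nonneg (x := s)
            have := φ.le_one (x := s)
            have := (abs_lt.2 ht).le
            gcongr
            linarith
        _ = ρ / 2 := by rw [hrdef]; field_simp
    have h2 : dist (e (c s)) (e (c s₀)) < ρ / 2 := (hB hs).2.1
    rw [Metric.mem_ball, dist_eq_norm, add_sub_right_comm]
    rw [dist_eq_norm] at h2
    linarith [norm_add_le (e (c s) - e (c s₀)) ((t * φ s) • ξ)]
  set Γ := bumpVariation e c B φ ξ with hΓdef
  have hΓ := contMDiffOn_bumpVariation he hc Metric.isOpen_ball hBsrc φ.contDiff hφB htarget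
  have hΓ2 : ContMDiffOn 𝓘(ℝ, ℝ × ℝ) (𝓡 4) 2 (fun z : ℝ × ℝ => Γ z.1 z.2) (strip r a b) :=
    hΓ.of_le (WithTop.coe_le_coe.2 hk)
  have hΓ0 : ∀ s ∈ Icc a b, Γ 0 s = c s := fun s hs =>
    bumpVariation_of_eq_zero hBsrc hs (zero_mul _)
  have hfix : ∀ s ∈ Icc a b, φ s = 0 → ∀ t, Γ t s = c s := fun s hs h t =>
    bumpVariation_of_eq_zero hBsrc hs (by rw [h, mul_zero])
  have hends : ∀ t ∈ Ioo (-r) r, Γ t a = c a ∧ Γ t b = c b := fun t _ =>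
    ⟨hfix a (left_mem_Icc.2 hab.le) (hφ0 a fun h => h.2.1.false) t,
      hfix b (right_mem_Icc.2 hab.le) (hφ0 b fun h => h.2.2.false) t⟩
  have hfield : ∀ s ∈ B ∩ Icc a b, fderivWithin ℝ (e ∘ fun z : ℝ × ℝ => Γ z.1 z.2)
      (strip r a b) (0, s) (1, 0) = φ s • ξ := by
    intro s hs
    have hmem := mem_strip_zero hr hs.2
    have h1 : ContDiffWithinAt ℝ 2 (e ∘ fun z : ℝ × ℝ => Γ z.1 z.2) (strip r a b) (0, s) :=
      contDiffWithinAt_comp_chart (n := 2) he (hΓ2 _ hmem) (hΓ0 s hs.2 ▸ hBsrc s hs)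
    refine (hasDerivAt_slice hmem.1 hs.2 (h1.differentiableWithinAt (by simp))).unique ?_
    have h2 : HasDerivAt (fun t : ℝ => e (c s) + (t * φ s) • ξ) (φ s • ξ) 0 := by
      simpa using (((hasDerivAt_id (0 : ℝ)).mul_const (φ s)).smul_const ξ).const_add (e (c s))
    refine h2.congr_of_eventuallyEq ?_
    filter_upwards [isOpen_Ioo.mem_nhds hmem.1] with t ht
    rw [Function.comp_apply, hΓdef, bumpVariation_of_mem hs.1, e.right_inv (htarget t ht s hs)]
  have hKc : ContinuousOn (fun s => φ s * S.eulerLagrange e a b c s ξ) (Icc a b) := by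
    intro s hs
    by_cases hsB : s ∈ B
    · exact φ.continuous.continuousWithinAt.mul
        (S.continuousWithinAt_eulerLagrange he hab hc2 hs (hBsrc s ⟨hsB, hs⟩) (hA s hs) ξ)
    · have hs' : s ∈ (tsupport φ)ᶜ := fun h => hsB (hφB h)
      refine (continuousWithinAt_const (b := (0 : ℝ))).congr_of_eventuallyEq ?_ ?_
      · filter_upwards [mem_nhdsWithin_of_mem_nhds
          ((isClosed_tsupport φ).isOpen_compl.mem_nhds hs')] with u hu
        rw [image_eq_zero_of_notMem_tsupport hu, zero_mul]
      · rw [image_eq_zero_of_notMem_tsupport hs', zero_mul]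
  have h1 := S.hasDerivAt_length hab hr hΓ2
    (fun s hs => tangentLift_congr hΓ0 hs ▸ hA s hs) hends hKc fun s hs => by
      by_cases hsB : s ∈ B
      · refine ⟨e, he, hΓ0 s hs ▸ hBsrc s ⟨hsB, hs⟩, ?_⟩
        rw [hfield s ⟨hsB, hs⟩, S.eulerLagrange_congr hΓ0 hs, S.eulerLagrange_smul]
      · have h0 : φ s = 0 := hφ0 s fun h => hsB h.1
        refine ⟨_, chartAt_mem (Γ 0 s), mem_chart_source _ _, ?_⟩
        rw [fderivWithin_variation_eq_zero (chartAt_mem (Γ 0 s)) hr hΓ2 hs (mem_chart_source _ _)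
          fun t _ => hfix s hs h0 t, S.eulerLagrange_zero, h0, zero_mul]
  have h2 := h1.unique (hgeo r Γ hr hΓ hΓ0 hends)
  have h3 : 0 < ∫ s in a..b, φ s * S.eulerLagrange e a b c s ξ := by
    refine intervalIntegral.integral_pos hab hKc (fun s hs => ?_) ⟨m, Ioo_subset_Icc_self hm.2, ?_⟩
    · by_cases hsB : s ∈ B
      · exact mul_nonneg φ.nonneg (hB ⟨hsB, Ioc_subset_Icc_self hs⟩).2.2.le
      · rw [hφ0 s fun h => hsB h.1, zero_mul]
    · rw [φ.one_of_mem_closedBall (Metric.mem_closedBall_self (half_pos hδ).le), one_mul]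
      exact (hB ⟨hm.1, Ioo_subset_Icc_self hm.2⟩).2.2
  linarith

/-- A curve parametrized by arc length is a geodesic if and only if its canonical lift is an integral
curve of the Reeb field. -/
theorem isMIntegralCurveOn_reeb_iff {k : ℕ∞} (hk : 2 ≤ k) (hab : a < b) {C : ℝ → PTM M}
    (hc : ContMDiffOn 𝓘(ℝ, ℝ) (𝓡 4) k c (Icc a b))
    (hA : ∀ s ∈ Icc a b, tangentLift a b c s ∈ S.A₀)
    (hF : ∀ s ∈ Icc a b, S.F (tangentLift a b c s) = 1) (hC : IsCanonicalLift a b c C) :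
    IsMIntegralCurveOn (I := 𝓘(ℝ, E4 × E3)) C S.reeb (Icc a b) ↔ S.IsGeodesic k a b c := by
  have hc2 : ContMDiffOn 𝓘(ℝ, ℝ) (𝓡 4) 2 c (Icc a b) := hc.of_le (WithTop.coe_le_coe.2 hk)
  refine ⟨fun h => S.isGeodesic_of_eulerLagrange hk hab hA fun s hs => ?_, fun h s hs => ?_⟩
  · obtain ⟨e, he, hse, hiff⟩ := S.hasMFDerivWithinAt_canonicalLift_iff hab hc2 hA hF hC hs
    exact ⟨e, he, hse, hiff.1 (h s hs)⟩
  · obtain ⟨e, he, hse, hiff⟩ := S.hasMFDerivWithinAt_canonicalLift_iff hab hc2 hA hF hC hs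
    refine hiff.2 fun ξ => le_antisymm
      (S.eulerLagrange_nonpos_of_isGeodesic hk hab hc hA h he hs hse ξ) ?_
    have := S.eulerLagrange_nonpos_of_isGeodesic hk hab hc hA h he hs hse (-ξ)
    rw [S.eulerLagrange_neg] at this
    linarith

end FinslerSpacetime

end Converse

end

end Finsler

theorem mainTheorem9 {M : Type*} [TopologicalSpace M] [T2Space M] [SecondCountableTopology M]
    [ConnectedSpace M] [ChartedSpace E4 M] [IsManifold (𝓡 4) ∞ M] (S : FinslerSpacetime M) :
    ∃ θ : OneForm M,
      S.IsProjectedHilbertForm θ ∧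
      (∀ θ' : OneForm M, S.IsProjectedHilbertForm θ' → ∀ p ∈ S.A₀plus, θ' p = θ p) ∧
      θ.IsContactOn S.A₀plus ∧
      ∃ R : (p : PTM M) → TangentSpace 𝓘(ℝ, E4 × E3) p,
        θ.IsReebOn R S.A₀plus ∧
        (∀ R' : (p : PTM M) → TangentSpace 𝓘(ℝ, E4 × E3) p,
          θ.IsReebOn R' S.A₀plus → ∀ p ∈ S.A₀plus, R' p = R p) ∧
        S.HasReebLocalForm R ∧
        ∀ (k : ℕ∞) (a b : ℝ) (c : ℝ → M) (C : ℝ → PTM M), 2 ≤ k → a < b →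
          ContMDiffOn 𝓘(ℝ, ℝ) (𝓡 4) k c (Icc a b) →
          (∀ s ∈ Icc a b, tangentLift a b c s ∈ S.A₀) →
          (∀ s ∈ Icc a b, S.F (tangentLift a b c s) = 1) →
          IsCanonicalLift a b c C →
          (IsMIntegralCurveOn (I := 𝓘(ℝ, E4 × E3)) C R (Icc a b) ↔ S.IsGeodesic k a b c) := by
  refine ⟨S.projHilbert, S.isProjectedHilbertForm_projHilbert, fun θ' h => ?_,
    S.isContactOn_projHilbert, S.reeb, S.isReebOn_reeb, fun R' h => S.reeb_unique h,
    S.hasReebLocalForm_reeb, fun k a b c C hk hab hc hA hF hC =>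
      S.isMIntegralCurveOn_reeb_iff hk hab hc hA hF hC⟩
  exact S.projectedHilbertForm_unique S.isProjectedHilbertForm_projHilbert h
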